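/- Let $A,B,C$ be finite (possibly empty) sets of qubits, $N=|A|+|B|+|C|$, and let $|\psi\rangle$ be a stabilizer state of these $N$ qubits: a unit vector, unique up to a scalar, fixed by $N$ independent, pairwise commuting elements $g_1,\dots,g_N$ of the $N$-qubit Pauli group $\{i^kP_1\otimes\cdots\otimes P_N\}$, $P_j\in\{I,X,Y,Z\}$ (independent: no $g_i$ is a product of the others). Let $G=\langle g_1,\dots,g_N\rangle$, and let $G_{AB},G_{BC},G_{AC}$ be the sets of elements of $G$ that act as the identity on the qubits in $C$, $A$, $B$ respectively; put $G_{AB}\cdot G_{BC}\cdot G_{AC}=\{fgh: f\in G_{AB}, g\in G_{BC}, h\in G_{AC}\}$. All logarithms are to base $2$. Let $S(C)=-\mathrm{Tr}\,\rho_C\log\rho_C$ be the entanglement entropy of $C$. Let $S^{(R)}(A:B)$ be the reflected entropy, i.e. the von Neumann entropy of $\rho_{AA^*}=\mathrm{Tr}_{BB^*}|\sqrt{\rho_{AB}}\rangle\langle\sqrt{\rho_{AB}}|$, where $|\sqrt{\rho_{AB}}\rangle$ is the canonical purification of $\rho_{AB}$. For an integer $n\ge 1$ let $Z_n$ be the number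 obtained by placing a copy of $\psi$ and a copy of $\bar\psi$ at each site of $(\mathbb Z/n)^3$ and contracting, for each party $a\in\{1,2,3\}$ and each site $r$, the party-$a$ index of $\psi$ at $r$ with the party-$a$ index of $\bar\psi$ at $r+e_a$. The tripartite multi-entropy is $S^{(3)}(A:B:C)=\lim_{n\to1}\frac{1}{(1-n)n}\log Z_n$, where the limit refers to the analytic continuation in $n$: a function holomorphic and of exponential type less than $\pi$ on the half-plane $\mathrm{Re}\, n>1$ that takes the values $\frac{1}{(1-n)n}\log Z_n$ at the integers $n\ge2$. Say that a GHZ state can be extracted from $|\psi\rangle$ if for some unitaries $U_A,U_B,U_C$ on the three parties, $(U_A\otimes U_B\otimes U_C)|\psi\rangle$ is the tensor product of $\frac{1}{\sqrt2}(|000\rangle+|111\rangle)$ on one qubit of each of $A,B,C$ with a state of the remaining qubits. Say that $|\psi\rangle$ has genuine tripartite entanglement if there are no splittings $A=A_1\sqcup A_2$, $B=B_1\sqcup B_2$, $C=C_1\sqcup C_2$ of the qubits and unitaries $U_A,U_B,U_C$ such that $(U_A\otimes U_B\otimes U_C)|\psi\rangle=|\phi\rangle_{A_1B_1}\otimes|\chi\rangle_{A_2C_1}\otimes|\xi\rangle_{B_2C_2}$.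 Then the multi-entropy $S^{(3)}(A:B:C)$ exists (there is exactly one value for the limit above), and: 1. $\tfrac12S^{(R)}(A:B)+S(C)\le S^{(3)}(A:B:C)$; that is, the GHZ-forbidding inequality $\tfrac12S^{(R)}(A:B)+S(C)\ge S^{(3)}(A:B:C)$ is violated or saturated, never strictly satisfied. 2. The GHZ-forbidding inequality $\tfrac12S^{(R)}(A:B)+S(C)\ge S^{(3)}(A:B:C)$ holds if and only if $|G_{AB}\cdot G_{BC}\cdot G_{AC}|\ge|G|$. 3. Equality $\tfrac12S^{(R)}(A:B)+S(C)=S^{(3)}(A:B:C)$ holds if and only if $G_{AB}\cdot G_{BC}\cdot G_{AC}=G$, and if and only if no GHZ state can be extracted from $|\psi\rangle$. 4. The strict inequality $\tfrac12S^{(R)}(A:B)+S(C)<S^{(3)}(A:B:C)$ holds if and only if a GHZ state can be extracted from $|\psi\rangle$, and if and only if $|\psi\rangle$ has genuine tripartite entanglement. -/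

import Mathlib

open scoped Matrix Pointwise Topology

namespace TripartiteStabilizer

noncomputable section

/-! ### Pauli operators and stabilizer states -/

/-- Labels of the four single-qubit Pauli matrices. -/
inductive Pauli
  | I
  | X
  | Y
  | Z

/-- The `2 × 2` Pauli matrices. -/
def Pauli.mat : Pauli → Matrix (Fin 2) (Fin 2) ℂ
  | .I => 1
  | .X => !![0, 1; 1, 0]
  | .Y => !![0, -Complex.I; Complex.I, 0]
  | .Z => !![1, 0; 0, -1]

/-- The tensor product `⨂ᵢ Pᵢ`, as a matrix in the computational basis of the qubits `ι`. -/
def pauliString {ι : Type*} [Fintype ι] (P : ι → Pauli) :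
    Matrix (ι → Fin 2) (ι → Fin 2) ℂ :=
  Matrix.of fun x y => ∏ i, (P i).mat (x i) (y i)

/-- Unitary operators on a register of qubits `ι`. -/
abbrev QubitOp (ι : Type*) [Fintype ι] [DecidableEq ι] :=
  Matrix.unitaryGroup (ι → Fin 2) ℂ

/-- `g` belongs to the Pauli group and acts as the identity on the qubits in `T`:
`g = iᵏ ⨂ᵢ Pᵢ` with `Pᵢ = I` for all `i ∈ T`. -/
def IsPauliTrivialOn {ι : Type*} [Fintype ι] [DecidableEq ι] (T : Set ι) (g : QubitOp ι) : Prop :=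
  ∃ (k : Fin 4) (P : ι → Pauli),
    (g : Matrix (ι → Fin 2) (ι → Fin 2) ℂ) = Complex.I ^ (k : ℕ) • pauliString P ∧
      ∀ i ∈ T, P i = Pauli.I

/-- Membership in the Pauli group. -/
def IsPauli {ι : Type*} [Fintype ι] [DecidableEq ι] (g : QubitOp ι) : Prop :=
  IsPauliTrivialOn ∅ g

/-- `ψ` is the stabilizer state of the register `ι` with generators `g`: a unit vector, unique
up to a scalar, fixed by `|ι|` independent commuting elements of the Pauli group. -/
structure IsStabilizerState {ι : Type*} [Fintype ι] [DecidableEq ι]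
    (g : Fin (Fintype.card ι) → QubitOp ι) (ψ : (ι → Fin 2) → ℂ) : Prop where
  pauli : ∀ i, IsPauli (g i)
  commute : ∀ i j, Commute (g i) (g j)
  independent : ∀ i, g i ∉ Subgroup.closure (g '' {j | j ≠ i})
  norm_one : ∑ x, ‖ψ x‖ ^ 2 = 1
  stabilizes : ∀ i, (g i : Matrix (ι → Fin 2) (ι → Fin 2) ℂ) *ᵥ ψ = ψ
  unique : ∀ φ : (ι → Fin 2) → ℂ,
    (∀ i, (g i : Matrix (ι → Fin 2) (ι → Fin 2) ℂ) *ᵥ φ = φ) → ∃ c : ℂ, φ = c • ψ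

/-- The group generated by the generators `g`. -/
def stabilizerGroup {ι : Type*} [Fintype ι] [DecidableEq ι] {n : ℕ} (g : Fin n → QubitOp ι) :
    Subgroup (QubitOp ι) :=
  Subgroup.closure (Set.range g)

section Parties

variable {A B C : Type*} [Fintype A] [Fintype B] [Fintype C]
  [DecidableEq A] [DecidableEq B] [DecidableEq C]

/-- `G_AB`: the elements of `G` with trivial action on `C`. -/
def groupAB (G : Subgroup (QubitOp (A ⊕ B ⊕ C))) : Set (QubitOp (A ⊕ B ⊕ C)) :=
  {g | g ∈ G ∧ IsPauliTrivialOn {i | ∃ c : C, i = Sum.inr (Sum.inr c)} g}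

/-- `G_BC`: the elements of `G` with trivial action on `A`. -/
def groupBC (G : Subgroup (QubitOp (A ⊕ B ⊕ C))) : Set (QubitOp (A ⊕ B ⊕ C)) :=
  {g | g ∈ G ∧ IsPauliTrivialOn {i | ∃ a : A, i = Sum.inl a} g}

/-- `G_AC`: the elements of `G` with trivial action on `B`. -/
def groupAC (G : Subgroup (QubitOp (A ⊕ B ⊕ C))) : Set (QubitOp (A ⊕ B ⊕ C)) :=
  {g | g ∈ G ∧ IsPauliTrivialOn {i | ∃ b : B, i = Sum.inr (Sum.inl b)} g}

/-- `G_AB · G_BC · G_AC`, the set of all products `f * g * h`. -/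
def groupProd (G : Subgroup (QubitOp (A ⊕ B ⊕ C))) : Set (QubitOp (A ⊕ B ⊕ C)) :=
  groupAB G * groupBC G * groupAC G

end Parties

/-- The components `ψ_{abc}` of a state of the qubits `A ⊕ B ⊕ C`. -/
def components {A B C : Type*} (ψ : (A ⊕ B ⊕ C → Fin 2) → ℂ) :
    (A → Fin 2) → (B → Fin 2) → (C → Fin 2) → ℂ :=
  fun a b c => ψ (Sum.elim a (Sum.elim b c))

/-! ### Entropies. Tripartite pure states are given by their components `ψ a b c`;
all entropies use the logarithm to base 2. -/

/-- The reduced density matrix of the vector `φ` on the first tensor factor. -/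
def reducedDensity {m k : Type*} [Fintype k] (φ : m → k → ℂ) : Matrix m m ℂ :=
  Matrix.of fun x y => ∑ z, φ x z * star (φ y z)

/-- The von Neumann entropy `-Tr (ρ log₂ ρ)`, with the logarithm taken by functional calculus
(the value of `Real.logb 2` at `0` is `0`). -/
def vonNeumannEntropy {m : Type*} [Fintype m] [DecidableEq m] (ρ : Matrix m m ℂ) : ℝ :=
  -(Matrix.trace (ρ * cfc (Real.logb 2) ρ)).re

section Entropies

variable {α β γ : Type*} [Fintype α] [Fintype β] [Fintype γ]

/-- The entanglement entropy `S(C)`. -/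
def entropyC [DecidableEq γ] (ψ : α → β → γ → ℂ) : ℝ :=
  vonNeumannEntropy (reducedDensity fun (c : γ) (ab : α × β) => ψ ab.1 ab.2 c)

/-- The square root of the reduced density matrix `ρ_AB`. -/
def sqrtDensityAB [DecidableEq α] [DecidableEq β] (ψ : α → β → γ → ℂ) :
    Matrix (α × β) (α × β) ℂ :=
  cfc Real.sqrt (reducedDensity fun (ab : α × β) (c : γ) => ψ ab.1 ab.2 c)

/-- The reflected entropy `S^(R)(A:B)`: the entropy of `AA*` in the canonical purification of
`ρ_AB`, whose component at `(a, b, a*, b*)` is the entry `((a, b), (a*, b*))` of `√ρ_AB`. -/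
def reflectedEntropy [DecidableEq α] [DecidableEq β] (ψ : α → β → γ → ℂ) : ℝ :=
  vonNeumannEntropy
    (reducedDensity fun (a : α × α) (b : β × β) => sqrtDensityAB ψ (a.1, b.1) (a.2, b.2))

/-- The full contraction `Z_n^(3)` of `n³` copies of `ψ` and of its conjugate, placed on the sites
of the torus `(ℤ/n)³`: the leg of `ψ` at the site `r` belonging to a party is contracted with the
leg, of the same party, of the conjugate at the site next to `r` in the direction of this party.
Here `a r`, `b r`, `c r` are the indices on the legs of `ψ` at `r`. -/
def replicaContraction (ψ : α → β → γ → ℂ) (n : ℕ) [NeZero n] : ℂ :=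
  ∑ a : ZMod n × ZMod n × ZMod n → α,
    ∑ b : ZMod n × ZMod n × ZMod n → β,
      ∑ c : ZMod n × ZMod n × ZMod n → γ,
        ∏ r : ZMod n × ZMod n × ZMod n,
          ψ (a r) (b r) (c r) *
            star (ψ (a (r - (1, 0, 0))) (b (r - (0, 1, 0))) (c (r - (0, 0, 1))))

/-- The quantity `log₂ Z_n^(3) / ((1 - n) n)`, for integers `n ≥ 2`. -/
def renyiMultiEntropy (ψ : α → β → γ → ℂ) (n : ℕ) [NeZero n] : ℂ :=
  1 / ((1 - (n : ℂ)) * (n : ℂ)) *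
    (Complex.log (replicaContraction ψ n) / Complex.log 2)

/-- `s` is the tripartite multi-entropy `S^(3)(A:B:C)`, i.e. the limit `n → 1` of
`log₂ Z_n^(3) / ((1 - n) n)`. The limit refers to the analytic continuation in `n` in the sense of
Carlson's theorem: the function `f`, holomorphic and of exponential type less than `π` in the
half-plane `Re z > 1`, that takes the given values at the integers `n ≥ 2`. -/
def IsMultiEntropy (ψ : α → β → γ → ℂ) (s : ℝ) : Prop :=
  ∃ f : ℂ → ℂ,
    DifferentiableOn ℂ f {z | 1 < z.re} ∧
    (∃ K τ : ℝ, τ < Real.pi ∧ ∀ z : ℂ, 1 < z.re → ‖f z‖ ≤ K * Real.exp (τ * ‖z‖)) ∧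
    (∀ (n : ℕ) [NeZero n], 2 ≤ n → f n = renyiMultiEntropy ψ n) ∧
    Filter.Tendsto f (𝓝[{z | 1 < z.re}] 1) (𝓝 (s : ℂ))

/-- `φ = (U_A ⊗ U_B ⊗ U_C) ψ` for some unitaries. -/
def LocalUnitaryEquiv [DecidableEq α] [DecidableEq β] [DecidableEq γ]
    (ψ φ : α → β → γ → ℂ) : Prop :=
  ∃ (U : Matrix.unitaryGroup α ℂ) (V : Matrix.unitaryGroup β ℂ) (W : Matrix.unitaryGroup γ ℂ),
    ∀ a b c, φ a b c = ∑ a', ∑ b', ∑ c', U.1 a a' * V.1 b b' * W.1 c c' * ψ a' b' c'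

end Entropies

/-! ### Tripartite entanglement -/

/-- The three-qubit state `(|000⟩ + |111⟩) / √2`. -/
def ghz (i j k : Fin 2) : ℂ :=
  if i = j ∧ j = k then 1 / (Real.sqrt 2 : ℂ) else 0

section Extraction

variable {A B C : Type*} [Fintype A] [Fintype B] [Fintype C]
  [DecidableEq A] [DecidableEq B] [DecidableEq C]

/-- A GHZ state can be extracted: up to local unitaries, the state is the tensor product of a GHZ
state of one qubit of each party with some state of the remaining qubits. -/
def CanExtractGHZ (ψ : (A → Fin 2) → (B → Fin 2) → (C → Fin 2) → ℂ) : Prop :=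
  ∃ (a₀ : A) (b₀ : B) (c₀ : C)
    (χ : ({i // i ≠ a₀} → Fin 2) → ({j // j ≠ b₀} → Fin 2) → ({k // k ≠ c₀} → Fin 2) → ℂ),
    LocalUnitaryEquiv ψ fun a b c =>
      ghz (a a₀) (b b₀) (c c₀) * χ (fun i => a i) (fun j => b j) (fun k => c k)

/-- Up to local unitaries, the state is a tensor product of states each shared by two parties:
the qubits of each party split into two groups, and the state is
`φ_{A₁B₁} ⊗ χ_{A₂C₁} ⊗ ξ_{B₂C₂}`. -/
def IsProductOfBipartite (ψ : (A → Fin 2) → (B → Fin 2) → (C → Fin 2) → ℂ) : Prop :=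
  ∃ (S : Set A) (T : Set B) (R : Set C)
    (φ : ({i // i ∈ S} → Fin 2) → ({j // j ∈ T} → Fin 2) → ℂ)
    (χ : ({i // i ∉ S} → Fin 2) → ({k // k ∈ R} → Fin 2) → ℂ)
    (ξ : ({j // j ∉ T} → Fin 2) → ({k // k ∉ R} → Fin 2) → ℂ),
    LocalUnitaryEquiv ψ fun a b c =>
      φ (fun i => a i) (fun j => b j) * χ (fun i => a i) (fun k => c k) *
        ξ (fun j => b j) (fun k => c k)

/-- Genuine tripartite entanglement: the entanglement is not just bipartite entanglement between
pairs of parties. -/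
def HasGenuineTripartiteEntanglement
    (ψ : (A → Fin 2) → (B → Fin 2) → (C → Fin 2) → ℂ) : Prop :=
  ¬ IsProductOfBipartite ψ

end Extraction

end

end TripartiteStabilizer

namespace TripartiteStabilizer

noncomputable section

/-! ### Carlson's theorem -/

section Carlson

open Complex Filter Asymptotics Bornology

/-! Modulo phases, the stabilizer group is a Lagrangian subspace of the symplectic `𝔽₂`-space of
Pauli exponents, which splits orthogonally into the spaces of the three parties
(`IsStabilizerState.isLagrangian`). The heart of the proof is a normal form: up to local unitaries
the state is a product of blocks `∑ₛ |s ⋯ s⟩`, each with one qubit of every party in a nonempty set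
`κ`. These are single-qubit states, Bell pairs and GHZ states. `IsBlockSystem.exists_extension`
shows that a block can be split off as long as something is left over. In a complete system the
block operators of each party satisfy the relations of the Pauli matrices of its qubits, so a
unitary of this party makes them standard (`exists_diagonalizing_unitary`). The stabilizer equations
then force the product form (`eq_prod_blockTensor`).

All entropies are additive over blocks. The contraction of a block counts bit-valued functions on a
quotient of the torus, which gives `2 ^ n ^ (4 - |κ|)`. After normalization its Rényi multi-entropy
is `0`, `n`, `n + 1` for `|κ| = 1, 2, 3`, and the value at `n = 1` is `|κ| - 1`. These functions are
of exponential type less than `π`, and Carlson's theorem makes the continuation unique. All reduced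
states are multiples of projections, so `S(C)` and the reflected entropy come from quadratic matrix
identities for single blocks. Comparing the contributions (`two_mul_card_block`), only GHZ blocks
leave a difference, namely `1/2` each: the multi-entropy equals `S^(R)/2 + S(C) + p/2`, where `p` is
the number of GHZ blocks.

It remains to see that every criterion says `p = 0`. For the group product this is linear algebra
(`IsBlockSystem.forall_exists_sum_iff`). A GHZ block can be extracted, and without GHZ blocks the
state is a product of bipartite states. The two possibilities exclude each other: on a GHZ state
each party alone can perform the same nontrivial operation, a sign flip, whereas on a product of
bipartite states such an operation is a scalar (`exists_smul_of_act_eq`). -/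

lemma norm_le_exp_re_sub_im {F : ℂ → ℂ} {K τ δ : ℝ} (hτ : 0 ≤ τ) (hδ : 0 < δ) (hK : 0 ≤ K)
    (hd : ∀ z : ℂ, 0 ≤ z.re → DifferentiableAt ℂ F z)
    (hb : ∀ z : ℂ, 0 ≤ z.re → ‖F z‖ ≤ K * Real.exp (τ * ‖z‖))
    (him : ∀ y : ℝ, ‖F (y * I)‖ ≤ K * Real.exp (-δ * |y|)) {z : ℂ} (hz : 0 ≤ z.re) :
    ‖F z‖ ≤ K * Real.exp (τ * z.re - δ * |z.im|) := by
  -- Phragmén–Lindelöf is applied in each quadrant to `F w * exp (-τ w - i s δ w)`, with `s = 1`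
  -- above and `s = -1` below the real axis. The factor cancels the growth on the real axis and uses
  -- up exactly the decay on the imaginary axis. Here its a priori growth is checked.
  have key : ∀ s : ℝ, |s| = 1 → ∀ S : Set ℂ, (∀ w ∈ S, 0 ≤ w.re) →
      (fun w => F w * cexp (-τ * w - I * (s * δ) * w)) =O[cobounded ℂ ⊓ 𝓟 S]
        fun w => Real.exp ((τ + (τ + δ)) * ‖w‖ ^ (1 : ℝ)) := by
    intro s hs S hS
    refine IsBigO.of_bound K ?_
    refine eventually_inf_principal.2 (Eventually.of_forall fun w hw => ?_)
    rw [norm_mul, Complex.norm_exp, Real.norm_eq_abs, Real.abs_exp, Real.rpow_one,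
      add_mul τ, Real.exp_add, ← mul_assoc K]
    refine mul_le_mul (hb w (hS w hw)) (Real.exp_le_exp.2 ?_) (by positivity) (by positivity)
    have h1 : (-τ * w - I * (s * δ) * w).re ≤ ‖-τ * w - I * (s * δ) * w‖ := re_le_norm _
    refine h1.trans ((norm_sub_le _ _).trans ?_)
    simp [hs, abs_of_nonneg hτ, abs_of_pos hδ, add_mul]
  have hexp : ∀ s : ℝ, ∀ w : ℂ, ‖F w * cexp (-τ * w - I * (s * δ) * w)‖ =
      ‖F w‖ * Real.exp (-τ * w.re + s * δ * w.im) := by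
    intro s w
    rw [norm_mul, Complex.norm_exp]
    simp
  have hdiff : ∀ s : ℝ, ∀ S : Set ℂ, (∀ w ∈ S, 0 ≤ w.re) →
      DiffContOnCl ℂ (fun w => F w * cexp (-τ * w - I * (s * δ) * w)) S := by
    intro s S hS
    have hcl : closure S ⊆ {w : ℂ | 0 ≤ w.re} :=
      closure_minimal hS (isClosed_le continuous_const continuous_re)
    refine ⟨fun w hw => ?_, fun w hw => ?_⟩
    · exact ((hd w (hS w hw)).mul (by fun_prop)).differentiableWithinAt
    · exact ((hd w (hcl hw)).mul (by fun_prop)).continuousAt.continuousWithinAt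
  have hreal : ∀ s x : ℝ, 0 ≤ x → ‖F x * cexp (-τ * x - I * (s * δ) * x)‖ ≤ K := by
    intro s x hx
    rw [hexp]
    have := hb x (by simpa using hx)
    rw [Complex.norm_real, Real.norm_eq_abs, abs_of_nonneg hx] at this
    calc _ ≤ K * Real.exp (τ * x) * Real.exp (-τ * x + s * δ * 0) := by
          simp only [ofReal_re, ofReal_im]
          gcongr
      _ = K := by rw [mul_assoc, ← Real.exp_add]; simp
  have himag : ∀ s y : ℝ, s * y = |y| → ‖F (y * I) * cexp (-τ * (y * I) - I * (s * δ) * (y * I))‖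
      ≤ K := by
    intro s y hy
    rw [hexp]
    calc _ ≤ K * Real.exp (-δ * |y|) * Real.exp (δ * |y|) := by
          have : -τ * ((y : ℂ) * I).re + s * δ * ((y : ℂ) * I).im = δ * |y| := by
            simp [← hy]; ring
          rw [this]
          gcongr
          exact him y
      _ = K := by rw [mul_assoc, ← Real.exp_add]; simp
  have fin : ∀ s : ℝ, s * z.im = |z.im| → ‖F z * cexp (-τ * z - I * (s * δ) * z)‖ ≤ K →
      ‖F z‖ ≤ K * Real.exp (τ * z.re - δ * |z.im|) := by
    intro s hs h
    rw [hexp] at h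
    have e : τ * z.re - δ * |z.im| = -(-τ * z.re + s * δ * z.im) := by rw [← hs]; ring
    rw [e, Real.exp_neg, ← div_eq_mul_inv, le_div_iff₀ (Real.exp_pos _)]
    exact h
  rcases le_total 0 z.im with hi | hi
  · refine fin 1 (by simp [abs_of_nonneg hi]) ?_
    refine PhragmenLindelof.quadrant_I
      (f := fun w => F w * cexp (-τ * w - I * ((1 : ℝ) * δ) * w)) (hdiff 1 _ fun w hw => le_of_lt hw.1)
      ⟨1, by norm_num, _, key 1 (by simp) _ fun w hw => le_of_lt hw.1⟩ (hreal 1)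
      (fun y hy => himag 1 y (by simp [abs_of_nonneg hy])) hz hi
  · refine fin (-1) (by simp [abs_of_nonpos hi]) ?_
    refine PhragmenLindelof.quadrant_IV
      (f := fun w => F w * cexp (-τ * w - I * ((-1 : ℝ) * δ) * w)) (hdiff (-1) _ fun w hw => le_of_lt hw.1)
      ⟨1, by norm_num, _, key (-1) (by simp) _ fun w hw => le_of_lt hw.1⟩ (hreal (-1))
      (fun y hy => himag (-1) y (by simp [abs_of_nonpos hy])) hz hi

/-- A function of exponential type in the right half-plane that decays exponentially along the
imaginary axis vanishes on the positive real axis. -/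
lemma eq_zero_of_exp_decay_imaginary {F : ℂ → ℂ} {K τ δ : ℝ} (hτ : 0 ≤ τ) (hδ : 0 < δ)
    (hK : 0 ≤ K) (hd : ∀ z : ℂ, 0 ≤ z.re → DifferentiableAt ℂ F z)
    (hb : ∀ z : ℂ, 0 ≤ z.re → ‖F z‖ ≤ K * Real.exp (τ * ‖z‖))
    (him : ∀ y : ℝ, ‖F (y * I)‖ ≤ K * Real.exp (-δ * |y|)) {x : ℝ} (hx : 0 < x) :
    F x = 0 := by
  have h1 := fun z hz => norm_le_exp_re_sub_im hτ hδ hK hd hb him (z := z) hz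
  have h2 : ∀ B : ℝ, 0 < B → ‖F x‖ ≤ K * Real.exp (-B * x) := by
    intro B hB
    -- By the preceding bound, `F w * exp (B w)` is at most `K * exp (|w| ((τ + B) cos θ - δ sin
    -- θ))` on the rays `arg w = ± θ`. This `θ` makes the exponent zero.
    obtain ⟨θ, hθ0, hθ1, hθ⟩ : ∃ θ : ℝ, 0 < θ ∧ θ < Real.pi / 2 ∧ Real.tan θ = (B + τ) / δ := by
      refine ⟨Real.arctan ((B + τ) / δ), Real.arctan_pos.2 (by positivity),
        Real.arctan_lt_pi_div_two _, Real.tan_arctan _⟩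
    have hcos : 0 < Real.cos θ := Real.cos_pos_of_mem_Ioo ⟨by linarith [Real.pi_pos], hθ1⟩
    have htan : δ * Real.sin θ = (B + τ) * Real.cos θ := by
      rw [Real.tan_eq_sin_div_cos] at hθ
      field_simp at hθ
      linarith
    have hre : ∀ ζ : ℂ, |ζ.im| ≤ θ → 0 < (cexp ζ).re := by
      intro ζ hζ
      rw [exp_re]
      have := abs_le.1 hζ
      exact mul_pos (Real.exp_pos _)
        (Real.cos_pos_of_mem_Ioo ⟨by linarith, by linarith⟩)
    have hnorm : ∀ w : ℂ, ‖F w * cexp (B * w)‖ = ‖F w‖ * Real.exp (B * w.re) := by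
      intro w
      rw [norm_mul, Complex.norm_exp]
      simp
    have hdA : ∀ ζ : ℂ, |ζ.im| ≤ θ →
        DifferentiableAt ℂ (fun ζ => F (cexp ζ) * cexp (B * cexp ζ)) ζ := by
      intro ζ hζ
      exact (DifferentiableAt.comp ζ (hd _ (hre ζ hζ).le) (by fun_prop)).mul (by fun_prop)
    have hcl : closure (im ⁻¹' Set.Ioo (-θ) θ) ⊆ {ζ : ℂ | |ζ.im| ≤ θ} :=
      closure_minimal (fun ζ hζ => abs_le.2 ⟨hζ.1.le, hζ.2.le⟩)
        (isClosed_le (by fun_prop) continuous_const)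
    have hbd : ∀ ζ : ℂ, |ζ.im| = θ → ‖F (cexp ζ) * cexp (B * cexp ζ)‖ ≤ K := by
      intro ζ hζ
      rw [hnorm]
      have hc : (cexp ζ).re = Real.exp ζ.re * Real.cos θ := by
        rw [exp_re, ← Real.cos_abs, hζ]
      have hs : |(cexp ζ).im| = Real.exp ζ.re * Real.sin θ := by
        rw [exp_im, abs_mul, Real.abs_exp]
        congr 1
        have hsin : 0 ≤ Real.sin θ :=
          Real.sin_nonneg_of_nonneg_of_le_pi hθ0.le (by linarith [Real.pi_pos])
        rcases abs_eq hθ0.le |>.1 hζ with h | h <;> rw [h]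
        · exact abs_of_nonneg hsin
        · rw [Real.sin_neg, abs_neg, abs_of_nonneg hsin]
      calc _ ≤ K * Real.exp (τ * (cexp ζ).re - δ * |(cexp ζ).im|) * Real.exp (B * (cexp ζ).re) := by
            gcongr
            exact h1 _ (hre ζ hζ.le).le
        _ = K := by
            rw [mul_assoc, ← Real.exp_add, hc, hs]
            have : τ * (Real.exp ζ.re * Real.cos θ) - δ * (Real.exp ζ.re * Real.sin θ) +
              B * (Real.exp ζ.re * Real.cos θ) = 0 := by
              linear_combination -Real.exp ζ.re * htan
            rw [this]; simp
    -- The exponential maps the strip `|im ζ| < θ` onto the sector between the rays. The opening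
    -- `2θ` is less than `π`, so order-one growth in `w` is admissible. At `w = x` this gives `‖F x‖
    -- ≤ K * exp (-B x)`, and then `B → ∞`.
    have := PhragmenLindelof.horizontal_strip (a := -θ) (b := θ) (C := K) (z := (Real.log x : ℂ))
      (f := fun ζ => F (cexp ζ) * cexp (B * cexp ζ))
      ⟨fun ζ hζ => (hdA ζ (abs_le.2 ⟨hζ.1.le, hζ.2.le⟩)).differentiableWithinAt,
        fun ζ hζ => (hdA ζ (hcl hζ)).continuousAt.continuousWithinAt⟩
      ⟨1, by rw [lt_div_iff₀ (by linarith)]; linarith, τ + B, by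
        refine IsBigO.of_bound K (eventually_inf_principal.2 (Eventually.of_forall fun ζ hζ => ?_))
        have hζ' : |ζ.im| ≤ θ := abs_le.2 ⟨hζ.1.le, hζ.2.le⟩
        rw [hnorm, Real.norm_eq_abs, Real.abs_exp, add_mul, Real.exp_add, ← mul_assoc]
        have hle : Real.exp ζ.re ≤ Real.exp (1 * |ζ.re|) := by
          rw [one_mul]; exact Real.exp_le_exp.2 (le_abs_self _)
        refine mul_le_mul ((hb _ (hre ζ hζ').le).trans ?_) (Real.exp_le_exp.2 ?_) (by positivity)
          (by positivity)
        · rw [Complex.norm_exp]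
          gcongr
        · gcongr
          exact (re_le_norm _).trans ((Complex.norm_exp _).le.trans hle)⟩
      (fun ζ hζ => hbd ζ (by rw [hζ, abs_neg, abs_of_pos hθ0]))
      (fun ζ hζ => hbd ζ (by rw [hζ, abs_of_pos hθ0])) (by simp [hθ0.le])
      (by simp [hθ0.le])
    have hlog : cexp (Real.log x : ℂ) = x := by
      rw [← ofReal_exp, Real.exp_log hx]
    simp only [hlog] at this
    rw [hnorm] at this
    rw [neg_mul, Real.exp_neg, ← div_eq_mul_inv, le_div_iff₀ (Real.exp_pos _)]
    simpa using this
  have h3 : Tendsto (fun B : ℝ => K * Real.exp (-B * x)) atTop (𝓝 (K * 0)) := by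
    refine Tendsto.const_mul _ (Real.tendsto_exp_atBot.comp ?_)
    simp only [neg_mul]
    exact tendsto_neg_atTop_atBot.comp (tendsto_id.atTop_mul_const hx)
  have h4 : ‖F x‖ ≤ K * 0 := ge_of_tendsto h3 (eventually_atTop.2 ⟨1, fun B hB => h2 B (by linarith)⟩)
  simpa using h4

/-- The zeros of `s` are simple and `h` vanishes there, so the singularities of `h / s` are
removable with value `h' / s'`. Near a zero the quotient is that of the two `dslope`s. -/
lemma differentiableAt_ite_deriv_div {h s : ℂ → ℂ} {U : Set ℂ} (hU : IsOpen U)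
    (hh : DifferentiableOn ℂ h U) (hs : DifferentiableOn ℂ s U) {z₀ : ℂ} (hz : z₀ ∈ U)
    (h0 : s z₀ = 0 → h z₀ = 0 ∧ deriv s z₀ ≠ 0) :
    DifferentiableAt ℂ (fun z => if s z = 0 then deriv h z / deriv s z else h z / s z) z₀ := by
  have hUn := hU.mem_nhds hz
  by_cases hz0 : s z₀ = 0
  · obtain ⟨hhz, hds⟩ := h0 hz0
    have d1 := (((Complex.differentiableOn_dslope hUn).2 hh).differentiableAt hUn)
    have d2 := (((Complex.differentiableOn_dslope hUn).2 hs).differentiableAt hUn)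
    have hne : dslope s z₀ z₀ ≠ 0 := by rwa [dslope_same]
    refine (d1.div d2 hne).congr_of_eventuallyEq ?_
    filter_upwards [d2.continuousAt.eventually_ne hne] with z hz'
    rcases eq_or_ne z z₀ with rfl | hzz
    · simp [hz0]
    · have e1 : s z = (z - z₀) * dslope s z₀ z := by
        simpa [hz0] using (sub_smul_dslope s z₀ z).symm
      have e2 : h z = (z - z₀) * dslope h z₀ z := by
        simpa [hhz] using (sub_smul_dslope h z₀ z).symm
      have hzz' : z - z₀ ≠ 0 := sub_ne_zero.2 hzz
      rw [if_neg (by rw [e1]; exact mul_ne_zero hzz' hz'), e1, e2, mul_div_mul_left _ _ hzz']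
      rfl
  · refine ((hh.differentiableAt hUn).div (hs.differentiableAt hUn) hz0).congr_of_eventuallyEq ?_
    filter_upwards [(hs.differentiableAt hUn).continuousAt.eventually_ne hz0] with z hz'
    rw [if_neg hz']
    rfl

/-! ### Lower bounds for `sin (π z)`. -/

lemma norm_sin_sq (z : ℂ) : ‖Complex.sin z‖ ^ 2 = Real.sin z.re ^ 2 + Real.sinh z.im ^ 2 := by
  rw [Complex.sin_eq, ← ofReal_sin, ← ofReal_cos, ← ofReal_cosh, ← ofReal_sinh, ← ofReal_mul,
    ← ofReal_mul, Complex.sq_norm, normSq_add_mul_I]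
  have h1 := Real.cosh_sq z.im
  have h2 := Real.sin_sq_add_cos_sq z.re
  linear_combination Real.sin z.re ^ 2 * h1 + Real.sinh z.im ^ 2 * h2

lemma sin_pi_mul_half_sq (m : ℤ) : Real.sin (Real.pi * (m + 1 / 2)) ^ 2 = 1 := by
  have : Real.cos (Real.pi * (m + 1 / 2)) = 0 := by
    rw [Real.cos_eq_zero_iff]
    exact ⟨m, by ring⟩
  have h2 := Real.sin_sq_add_cos_sq (Real.pi * (m + 1 / 2))
  rw [this] at h2
  simpa using h2

lemma one_le_norm_sin_of_re {z : ℂ} {m : ℤ} (hz : z.re = m + 1 / 2) :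
    1 ≤ ‖Complex.sin (Real.pi * z)‖ := by
  have h := norm_sin_sq (Real.pi * z)
  rw [re_ofReal_mul, hz, sin_pi_mul_half_sq] at h
  nlinarith [norm_nonneg (Complex.sin (Real.pi * z)), sq_nonneg (Real.sinh ((Real.pi * z).im))]

lemma one_le_norm_sin_of_im {z : ℂ} (hz : 1 ≤ |z.im|) : 1 ≤ ‖Complex.sin (Real.pi * z)‖ := by
  have h := norm_sin_sq (Real.pi * z)
  have h1 : 1 ≤ |Real.sinh ((Real.pi * z).im)| := by
    rw [Real.abs_sinh, im_ofReal_mul, abs_mul, abs_of_pos Real.pi_pos]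
    have : (1 : ℝ) ≤ Real.pi * |z.im| := by nlinarith [Real.pi_gt_three]
    exact this.trans (Real.self_le_sinh_iff.2 (by linarith))
  have h2 : 1 ≤ Real.sinh ((Real.pi * z).im) ^ 2 := by
    rw [← sq_abs]; nlinarith
  nlinarith [norm_nonneg (Complex.sin (Real.pi * z)), sq_nonneg (Real.sin ((Real.pi * z).re))]

/-- On the line `re = 3/2` the modulus of the sine is exactly `cosh (π y)`. -/
lemma exp_le_two_mul_norm_sin {y : ℝ} :
    Real.exp (Real.pi * |y|) ≤ 2 * ‖Complex.sin (Real.pi * (y * I + 3 / 2))‖ := by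
  have h := norm_sin_sq (Real.pi * (y * I + 3 / 2))
  have e1 : ((Real.pi : ℂ) * (y * I + 3 / 2)).re = Real.pi * ((1 : ℤ) + 1 / 2) := by
    rw [re_ofReal_mul]; norm_num
  have e2 : ((Real.pi : ℂ) * (y * I + 3 / 2)).im = Real.pi * y := by
    rw [im_ofReal_mul]; norm_num
  rw [e1, e2, sin_pi_mul_half_sq, add_comm 1, ← Real.cosh_sq] at h
  have h1 : ‖Complex.sin (Real.pi * (y * I + 3 / 2))‖ = Real.cosh (Real.pi * y) :=
    (sq_eq_sq₀ (norm_nonneg _) (Real.cosh_pos _).le).1 h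
  rw [h1, ← Real.cosh_abs, abs_mul, abs_of_pos Real.pi_pos, Real.cosh_eq]
  have := Real.exp_pos (-(Real.pi * |y|))
  linarith

/-- **Carlson's theorem** on the half-plane `1 < re z`. -/
theorem eq_zero_of_exponential_type_lt_pi {h : ℂ → ℂ} (hd : DifferentiableOn ℂ h {z | 1 < z.re})
    {K τ : ℝ} (hτ : 0 ≤ τ) (hτπ : τ < Real.pi)
    (hb : ∀ z : ℂ, 1 < z.re → ‖h z‖ ≤ K * Real.exp (τ * ‖z‖))
    (hn : ∀ n : ℕ, 2 ≤ n → h n = 0) : ∀ z : ℂ, 1 < z.re → h z = 0 := by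
  have hU : IsOpen {z : ℂ | 1 < z.re} := isOpen_lt continuous_const continuous_re
  have hK : 0 ≤ K := by
    have := (norm_nonneg _).trans (hb 2 (by norm_num))
    exact nonneg_of_mul_nonneg_left this (Real.exp_pos _)
  set s : ℂ → ℂ := fun z => Complex.sin (Real.pi * z) with hs
  have hsd : Differentiable ℂ s := by fun_prop
  have hds : ∀ z, deriv s z = Real.pi * Complex.cos (Real.pi * z) := by
    intro z
    have : HasDerivAt s (Complex.cos (Real.pi * z) * (Real.pi * 1)) z :=
      (Complex.hasDerivAt_sin _).comp z ((hasDerivAt_id z).const_mul (Real.pi : ℂ))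
    rw [this.deriv]; ring
  have hsz0 : ∀ z : ℂ, 1 < z.re → s z = 0 → h z = 0 := by
    intro z hz h0
    obtain ⟨k, hk⟩ := Complex.sin_eq_zero_iff.1 h0
    have hzk : z = k := by
      have hpi : (Real.pi : ℂ) ≠ 0 := by exact_mod_cast Real.pi_ne_zero
      apply mul_left_cancel₀ hpi
      rw [hk]; ring
    have hk1 : (1 : ℝ) < k := by rw [hzk] at hz; simpa using hz
    have hk2 : 1 < k := by exact_mod_cast hk1
    have := hn k.toNat (by omega)
    have e : ((k.toNat : ℕ) : ℂ) = (k : ℂ) := by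
      have : ((k.toNat : ℕ) : ℤ) = k := Int.toNat_of_nonneg (by omega)
      exact_mod_cast congrArg (Int.cast : ℤ → ℂ) this
    rw [hzk, ← e, this]
  -- The quotient of `h` by `sin (π z)`. In the half-plane the sine vanishes only at integers `≥ 2`,
  -- where `h` vanishes too.
  set D : ℂ → ℂ := fun z => if s z = 0 then deriv h z / deriv s z else h z / s z with hD
  have hDd : ∀ z : ℂ, 1 < z.re → DifferentiableAt ℂ D z := by
    intro z hz
    refine differentiableAt_ite_deriv_div hU hd hsd.differentiableOn hz fun h0 => ?_
    constructor
    · exact hsz0 z hz h0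
    · rw [hds]
      refine mul_ne_zero (by exact_mod_cast Real.pi_ne_zero) fun hc => ?_
      have := Complex.sin_sq_add_cos_sq (Real.pi * z)
      simp only [hs] at h0
      rw [h0, hc] at this
      simp at this
  have hDle : ∀ z : ℂ, 1 < z.re → 1 ≤ ‖s z‖ → ‖D z‖ ≤ K * Real.exp (τ * ‖z‖) := by
    intro z hz hsz
    have hne : s z ≠ 0 := fun h0 => by rw [h0] at hsz; norm_num at hsz
    simp only [hD, if_neg hne, norm_div]
    exact (div_le_self (norm_nonneg _) hsz).trans (hb z hz)
  have hDb : ∀ z : ℂ, 3 / 2 ≤ z.re → ‖D z‖ ≤ K * Real.exp (τ * (‖z‖ + 3)) := by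
    intro z hz
    rcases le_or_gt 1 |z.im| with hi | hi
    · refine (hDle z (by linarith) (one_le_norm_sin_of_im hi)).trans ?_
      gcongr
      linarith
    · set m : ℤ := ⌊z.re - 1 / 2⌋ with hm
      have hm1 : (1 : ℝ) ≤ m := by
        have : (1 : ℤ) ≤ m := Int.le_floor.2 (by push_cast; linarith)
        exact_mod_cast this
      have hm2 := Int.floor_le (z.re - 1 / 2)
      have hm3 := Int.lt_floor_add_one (z.re - 1 / 2)
      rw [← hm] at hm2 hm3
      have hi' := abs_lt.1 hi
      set U : Set ℂ := Set.Ioo (m + 1 / 2 : ℝ) (m + 3 / 2) ×ℂ Set.Ioo (-1 : ℝ) 1 with hUdef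
      have hclU : closure U = Set.Icc (m + 1 / 2 : ℝ) (m + 3 / 2) ×ℂ Set.Icc (-1 : ℝ) 1 := by
        rw [hUdef, closure_reProdIm, closure_Ioo (by linarith), closure_Ioo (by norm_num)]
      refine Complex.norm_le_of_forall_mem_frontier_norm_le (U := U) ?_ ?_ ?_ ?_
      · exact (Metric.isBounded_Ioo _ _).reProdIm (Metric.isBounded_Ioo _ _)
      · refine ⟨fun w hw => (hDd w ?_).differentiableWithinAt,
          fun w hw => (hDd w ?_).continuousAt.continuousWithinAt⟩
        · have := hw.1.1; linarith
        · rw [hclU] at hw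
          have := hw.1.1; linarith
      · intro w hw
        have hwc := frontier_subset_closure hw
        rw [hclU] at hwc
        obtain ⟨⟨a1, a2⟩, ⟨b1, b2⟩⟩ := hwc
        refine (hDle w (by linarith) ?_).trans ?_
        · rw [hUdef, frontier_reProdIm, frontier_Ioo (by norm_num), frontier_Ioo (by linarith)] at hw
          rcases hw with ⟨-, hw | hw⟩ | ⟨hw | hw, -⟩
          · exact one_le_norm_sin_of_im (by rw [hw]; norm_num)
          · rw [Set.mem_singleton_iff] at hw
            exact one_le_norm_sin_of_im (by rw [hw]; norm_num)
          · exact one_le_norm_sin_of_re hw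
          · rw [Set.mem_singleton_iff] at hw
            exact one_le_norm_sin_of_re (m := m + 1) (by rw [hw]; push_cast; ring)
        · gcongr
          have h1 : ‖w‖ ≤ ‖z‖ + ‖w - z‖ := by
            simpa using norm_add_le z (w - z)
          have h2 : ‖w - z‖ ≤ |(w - z).re| + |(w - z).im| := Complex.norm_le_abs_re_add_abs_im _
          have h3 : |(w - z).re| ≤ 1 := by
            rw [sub_re, abs_le]; constructor <;> linarith
          have h4 : |(w - z).im| ≤ 2 := by
            rw [sub_im, abs_le]; constructor <;> linarith
          linarith
      · rw [hclU]
        exact ⟨⟨by linarith, by linarith⟩, ⟨hi'.1.le, hi'.2.le⟩⟩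
  -- The boundary line of the half-plane is moved to `re = 3/2`, where dividing by the sine turns
  -- growth `exp (τ |y|)` into decay at rate `π - τ > 0`. The constant 5 covers the shift `3/2` and
  -- the box distance 3; the factor 2 comes from `exp_le_two_mul_norm_sin`.
  have hzero : ∀ x : ℝ, 0 < x → D (x + 3 / 2) = 0 := by
    intro x hx
    refine eq_zero_of_exp_decay_imaginary (F := fun w => D (w + 3 / 2)) (τ := τ) (δ := Real.pi - τ)
      (K := 2 * (K * Real.exp (τ * 5))) hτ (by linarith) (by positivity) ?_ ?_ ?_ hx
    · intro z hz
      refine DifferentiableAt.comp z (hDd _ ?_) (by fun_prop)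
      norm_num
      linarith
    · intro z hz
      refine (hDb _ ?_).trans ?_
      · norm_num
        linarith
      · have : ‖z + 3 / 2‖ ≤ ‖z‖ + 3 / 2 := by
          refine (norm_add_le _ _).trans ?_
          norm_num
        calc K * Real.exp (τ * (‖z + 3 / 2‖ + 3)) ≤ K * Real.exp (τ * 5 + τ * ‖z‖) := by
              gcongr
              nlinarith
          _ = K * Real.exp (τ * 5) * Real.exp (τ * ‖z‖) := by rw [Real.exp_add]; ring
          _ ≤ _ := by
            have : 0 ≤ K * Real.exp (τ * 5) := by positivity
            exact mul_le_mul_of_nonneg_right (by linarith) (Real.exp_pos _).le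
    · intro y
      have h1 : 1 ≤ ‖s (y * I + 3 / 2)‖ := one_le_norm_sin_of_re (m := 1) (by norm_num)
      have hne : s (y * I + 3 / 2) ≠ 0 := fun h0 => by rw [h0] at h1; norm_num at h1
      have h2 := exp_le_two_mul_norm_sin (y := y)
      have h3 := hb (y * I + 3 / 2) (by norm_num)
      have h4 : ‖(y * I + 3 / 2 : ℂ)‖ ≤ |y| + 3 / 2 := by
        refine (norm_add_le _ _).trans ?_
        norm_num
      simp only [hD, if_neg hne, norm_div]
      rw [div_le_iff₀ (by linarith)]
      have h5 : 0 ≤ K * Real.exp (τ * 5) * Real.exp (-(Real.pi - τ) * |y|) := by positivity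
      calc ‖h (y * I + 3 / 2)‖ ≤ K * Real.exp (τ * (|y| + 3 / 2)) := by
            refine h3.trans ?_
            gcongr
        _ ≤ K * Real.exp (τ * 5 + -(Real.pi - τ) * |y| + Real.pi * |y|) := by
            gcongr
            nlinarith
        _ = K * Real.exp (τ * 5) * Real.exp (-(Real.pi - τ) * |y|) * Real.exp (Real.pi * |y|) := by
            rw [Real.exp_add, Real.exp_add]; ring
        _ ≤ K * Real.exp (τ * 5) * Real.exp (-(Real.pi - τ) * |y|) *
            (2 * ‖s (y * I + 3 / 2)‖) := by gcongr
        _ = _ := by ring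
  have hD0 : Set.EqOn D 0 {z | 1 < z.re} := by
    have han : AnalyticOnNhd ℂ D {z | 1 < z.re} :=
      DifferentiableOn.analyticOnNhd (fun z hz => (hDd z hz).differentiableWithinAt) hU
    refine han.eqOn_zero_of_preconnected_of_frequently_eq_zero
      (convex_halfSpace_re_gt 1).isPreconnected (z₀ := 2) (by norm_num) ?_
    have ht : Tendsto (fun k : ℕ => ((1 / ((k : ℝ) + 1) : ℝ) : ℂ) + 2) atTop (𝓝[≠] 2) := by
      refine tendsto_nhdsWithin_iff.2 ⟨?_, Eventually.of_forall fun k => ?_⟩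
      · have h1 : Tendsto (fun k : ℕ => ((1 / ((k : ℝ) + 1) : ℝ) : ℂ)) atTop (𝓝 ((0 : ℝ) : ℂ)) :=
          (continuous_ofReal.tendsto 0).comp tendsto_one_div_add_atTop_nhds_zero_nat
        simpa using h1.add_const 2
      · have : (1 / ((k : ℝ) + 1) : ℝ) ≠ 0 := by positivity
        simpa using (by exact_mod_cast this : ((1 / ((k : ℝ) + 1) : ℝ) : ℂ) ≠ 0)
    refine ht.frequently (Frequently.of_forall fun k => ?_)
    have := hzero (1 / ((k : ℝ) + 1) + 1 / 2) (by positivity)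
    convert this using 2
    push_cast
    ring
  intro z hz
  by_cases hsz : s z = 0
  · exact hsz0 z hz hsz
  · have := hD0 hz
    simp only [hD, if_neg hsz, Pi.zero_apply, div_eq_zero_iff, hsz, or_false] at this
    exact this

end Carlson

end

noncomputable section

/-! ### Lagrangian subspaces of coloured symplectic spaces over `𝔽₂` -/

/-- Pauli operators up to phase: the entry `(x, z)` at a qubit stands for `Xˣ Zᶻ`. -/
abbrev PauliVec (ι : Type*) := ι → ZMod 2 × ZMod 2

section Symplectic

set_option linter.unusedSectionVars false
set_option linter.unusedDecidableInType false
set_option linter.unusedFintypeInType false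

variable {ι : Type*} [Fintype ι] [DecidableEq ι]

/-- The symplectic form; it vanishes on the pairs of commuting Pauli operators. -/
def symp : LinearMap.BilinForm (ZMod 2) (PauliVec ι) :=
  LinearMap.mk₂ (ZMod 2) (fun v w => ∑ i, ((v i).1 * (w i).2 + (v i).2 * (w i).1))
    (fun u v w => by
      simp only [Pi.add_apply, Prod.fst_add, Prod.snd_add, ← Finset.sum_add_distrib]
      exact Finset.sum_congr rfl fun i _ => by ring)
    (fun c v w => by
      simp only [Pi.smul_apply, Prod.smul_fst, Prod.smul_snd, smul_eq_mul, Finset.mul_sum]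
      exact Finset.sum_congr rfl fun i _ => by ring)
    (fun u v w => by
      simp only [Pi.add_apply, Prod.fst_add, Prod.snd_add, ← Finset.sum_add_distrib]
      exact Finset.sum_congr rfl fun i _ => by ring)
    (fun c v w => by
      simp only [Pi.smul_apply, Prod.smul_fst, Prod.smul_snd, smul_eq_mul, Finset.mul_sum]
      exact Finset.sum_congr rfl fun i _ => by ring)

lemma symp_apply (v w : PauliVec ι) :
    symp v w = ∑ i, ((v i).1 * (w i).2 + (v i).2 * (w i).1) := rfl

lemma symp_comm (v w : PauliVec ι) : symp v w = symp w v := by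
  simp only [symp_apply]
  exact Finset.sum_congr rfl fun i _ => by ring

lemma symp_self (v : PauliVec ι) : symp v v = 0 := by
  rw [symp_apply]
  refine Finset.sum_eq_zero fun i _ => ?_
  rw [mul_comm (v i).2]
  exact CharTwo.add_self_eq_zero _

lemma eq_zero_of_symp_eq_zero {v : PauliVec ι} (h : ∀ w, symp v w = 0) : v = 0 := by
  funext i
  have h1 := h (Pi.single i (0, 1))
  have h2 := h (Pi.single i (1, 0))
  rw [symp_apply, Finset.sum_eq_single i] at h1 h2
  · ext
    · simpa using h1
    · simpa using h2
  all_goals simp +contextual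

lemma symp_isRefl : (symp (ι := ι)).IsRefl := fun v w h => by rwa [symp_comm]

lemma symp_nondegenerate : (symp (ι := ι)).Nondegenerate := by
  refine ⟨fun v h => eq_zero_of_symp_eq_zero h, fun v h => eq_zero_of_symp_eq_zero fun w => ?_⟩
  rw [symp_comm]
  exact h w

lemma mem_symp_orthogonal {W : Submodule (ZMod 2) (PauliVec ι)} {v : PauliVec ι} :
    v ∈ symp.orthogonal W ↔ ∀ w ∈ W, symp v w = 0 := by
  rw [LinearMap.BilinForm.mem_orthogonal_iff]
  refine forall₂_congr fun w _ => ?_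
  rw [symp_comm]

lemma zmod_two_eq_one {c : ZMod 2} (h : c ≠ 0) : c = 1 := by
  revert c; decide

variable (col : ι → Fin 3)

/-- The part of a vector on the qubits of colour `a`. -/
def part (a : Fin 3) : PauliVec ι →ₗ[ZMod 2] PauliVec ι where
  toFun v i := if col i = a then v i else 0
  map_add' v w := by ext i <;> by_cases h : col i = a <;> simp [h]
  map_smul' c v := by ext i <;> by_cases h : col i = a <;> simp [h]

lemma part_apply (a : Fin 3) (v : PauliVec ι) (i : ι) :
    part col a v i = if col i = a then v i else 0 := rfl

lemma part_part (a b : Fin 3) (v : PauliVec ι) :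
    part col a (part col b v) = if a = b then part col a v else 0 := by
  funext i
  by_cases hab : a = b
  · subst hab
    simp only [part_apply, if_true]
    split_ifs <;> rfl
  · simp only [part_apply, if_neg hab, Pi.zero_apply]
    split_ifs with h1 h2
    · exact absurd (h1.symm.trans h2) hab
    · rfl
    · rfl

lemma part_part_self (a : Fin 3) (v : PauliVec ι) : part col a (part col a v) = part col a v := by
  simp [part_part]

lemma part_part_of_ne {a b : Fin 3} (h : a ≠ b) (v : PauliVec ι) :
    part col a (part col b v) = 0 := by
  simp [part_part, h]

lemma sum_part (v : PauliVec ι) : ∑ a, part col a v = v := by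
  funext i
  simp [Finset.sum_apply, part_apply]

lemma symp_part_left (a : Fin 3) (v w : PauliVec ι) :
    symp (part col a v) w = symp v (part col a w) := by
  simp only [symp_apply, part_apply]
  refine Finset.sum_congr rfl fun i _ => ?_
  split_ifs <;> simp

lemma symp_part_part (a b : Fin 3) (v w : PauliVec ι) :
    symp (part col a v) (part col b w) = if a = b then symp (part col a v) w else 0 := by
  rw [symp_part_left, part_part]
  split_ifs with h
  · rw [symp_part_left]
  · simp

lemma symp_eq_sum_part (v w : PauliVec ι) : symp v w = ∑ a, symp (part col a v) w := by
  conv_lhs => rw [← sum_part col v]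
  simp

/-- A subspace that is equal to its symplectic complement. -/
structure IsLagrangian (G : Submodule (ZMod 2) (PauliVec ι)) : Prop where
  isotropic : ∀ v ∈ G, ∀ w ∈ G, symp v w = 0
  maximal : ∀ v, (∀ w ∈ G, symp v w = 0) → v ∈ G

/-- A family of pairwise orthogonal blocks: the block `t` consists of a hyperbolic pair
`(x t, z t)` in each of the colours `κ t`, such that `G` contains the stabilizers of the state
`∑ₛ |s ⋯ s⟩` of these pairs. -/
structure IsBlockSystem (G : Submodule (ZMod 2) (PauliVec ι)) {T : Type} [DecidableEq T]
    (κ : T → Finset (Fin 3)) (x z : T → PauliVec ι) : Prop where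
  nonempty : ∀ t, (κ t).Nonempty
  part_x : ∀ t, ∀ a ∉ κ t, part col a (x t) = 0
  part_z : ∀ t, ∀ a ∉ κ t, part col a (z t) = 0
  xx : ∀ t t' a, symp (part col a (x t)) (x t') = 0
  zz : ∀ t t' a, symp (part col a (z t)) (z t') = 0
  zx : ∀ t t' a, symp (part col a (z t)) (x t') = if t = t' ∧ a ∈ κ t then 1 else 0
  x_mem : ∀ t, x t ∈ G
  z_mem : ∀ t, ∀ a ∈ κ t, ∀ b ∈ κ t, part col a (z t) + part col b (z t) ∈ G

/-- The vectors orthogonal to all parts of all blocks. -/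
def blockComplement {T : Type} (x z : T → PauliVec ι) : Submodule (ZMod 2) (PauliVec ι) where
  carrier := {v | ∀ t a, symp (part col a (x t)) v = 0 ∧ symp (part col a (z t)) v = 0}
  zero_mem' := by simp
  add_mem' := by
    intro v w hv hw t a
    simp [(hv t a).1, (hv t a).2, (hw t a).1, (hw t a).2]
  smul_mem' := by
    intro c v hv t a
    simp [(hv t a).1, (hv t a).2]

/-- The component of a vector in the block `t`. -/
def blockComponent {T : Type} (x z : T → PauliVec ι) (t : T) :
    PauliVec ι →ₗ[ZMod 2] PauliVec ι :=
  ∑ a, ((symp (part col a (z t))).smulRight (part col a (x t)) +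
    (symp (part col a (x t))).smulRight (part col a (z t)))

/-- The orthogonal projection to the complement of the blocks. -/
def blockProj {T : Type} [Fintype T] (x z : T → PauliVec ι) :
    PauliVec ι →ₗ[ZMod 2] PauliVec ι :=
  LinearMap.id + ∑ t, blockComponent col x z t

/-! ### Projections along block systems and the construction of a complete system. -/

section System

variable {col} {G : Submodule (ZMod 2) (PauliVec ι)} {T : Type} [Fintype T] [DecidableEq T]
  {κ : T → Finset (Fin 3)} {x z : T → PauliVec ι}

lemma blockComponent_apply (t : T) (v : PauliVec ι) : blockComponent col x z t v =
    ∑ a, (symp (part col a (z t)) v • part col a (x t) +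
      symp (part col a (x t)) v • part col a (z t)) := by
  simp [blockComponent]

lemma blockProj_apply (v : PauliVec ι) :
    blockProj col x z v = v + ∑ t, blockComponent col x z t v := by
  simp [blockProj]

lemma part_mem_blockComplement {v : PauliVec ι} (hv : v ∈ blockComplement col x z) (a : Fin 3) :
    part col a v ∈ blockComplement col x z := by
  intro t b
  rw [symp_part_part, symp_part_part]
  split_ifs
  · exact hv t b
  · simp

lemma part_blockComponent (t : T) (v : PauliVec ι) (b : Fin 3) :
    part col b (blockComponent col x z t v) = blockComponent col x z t (part col b v) := by
  simp only [blockComponent_apply, map_sum, map_add, map_smul]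
  refine Finset.sum_congr rfl fun a _ => ?_
  rw [symp_part_part, symp_part_part, part_part, part_part]
  by_cases h : a = b
  · subst h; simp
  · simp [h, Ne.symm h]

lemma part_blockProj (v : PauliVec ι) (b : Fin 3) :
    part col b (blockProj col x z v) = blockProj col x z (part col b v) := by
  simp only [blockProj_apply, map_add, map_sum, part_blockComponent]

lemma symp_blockProj {c : PauliVec ι} (hc : c ∈ blockComplement col x z) (v : PauliVec ι) :
    symp c (blockProj col x z v) = symp c v := by
  rw [blockProj_apply, map_add, map_sum, Finset.sum_eq_zero, add_zero]
  intro t _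
  rw [blockComponent_apply, map_sum]
  refine Finset.sum_eq_zero fun a _ => ?_
  rw [map_add, map_smul, map_smul, symp_comm c, symp_comm c, (hc t a).1, (hc t a).2]
  simp

lemma blockProj_eq_self {c : PauliVec ι} (hc : c ∈ blockComplement col x z) :
    blockProj col x z c = c := by
  rw [blockProj_apply, Finset.sum_eq_zero, add_zero]
  intro t _
  rw [blockComponent_apply]
  refine Finset.sum_eq_zero fun a _ => ?_
  rw [(hc t a).1, (hc t a).2]
  simp

/-- The blocks consist of mutually orthogonal hyperbolic pairs, so the component in the block `t`
has the same pairings with the parts of `x t` and `z t` as `v`. In characteristic two they cancel.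
-/
lemma IsBlockSystem.blockProj_mem (hS : IsBlockSystem col G κ x z) (v : PauliVec ι) :
    blockProj col x z v ∈ blockComplement col x z := by
  have hxz : ∀ t t' b, symp (part col b (x t)) (z t') = if t = t' ∧ b ∈ κ t then 1 else 0 := by
    intro t t' b
    rw [symp_part_left, symp_comm, hS.zx]
    by_cases h : t = t'
    · subst h; rfl
    · simp [h, Ne.symm h]
  intro t b
  constructor
  · rw [blockProj_apply, map_add, map_sum, Finset.sum_eq_single t]
    · rw [blockComponent_apply, map_sum, Finset.sum_eq_single b]
      · simp only [map_add, map_smul, symp_part_part, if_true, hS.xx, hxz, true_and]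
        by_cases hb : b ∈ κ t
        · simpa [hb] using CharTwo.add_self_eq_zero _
        · simp [hb, hS.part_x t b hb]
      · intro a _ hab
        simp [symp_part_part, Ne.symm hab]
      · simp
    · intro t' _ ht
      rw [blockComponent_apply, map_sum]
      refine Finset.sum_eq_zero fun a _ => ?_
      simp only [map_add, map_smul, symp_part_part, hS.xx, hxz]
      simp [Ne.symm ht]
    · simp
  · rw [blockProj_apply, map_add, map_sum, Finset.sum_eq_single t]
    · rw [blockComponent_apply, map_sum, Finset.sum_eq_single b]
      · simp only [map_add, map_smul, symp_part_part, if_true, hS.zz, hS.zx, true_and]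
        by_cases hb : b ∈ κ t
        · simpa [hb] using CharTwo.add_self_eq_zero _
        · simp [hb, hS.part_z t b hb]
      · intro a _ hab
        simp [symp_part_part, Ne.symm hab]
      · simp
    · intro t' _ ht
      rw [blockComponent_apply, map_sum]
      refine Finset.sum_eq_zero fun a _ => ?_
      simp only [map_add, map_smul, symp_part_part, hS.zz, hS.zx]
      simp [Ne.symm ht]
    · simp

/-- The sum of two parts of `z t` belongs to `G`, hence is orthogonal to `v`. -/
lemma IsBlockSystem.symp_z_eq (hG : IsLagrangian G) (hS : IsBlockSystem col G κ x z)
    {v : PauliVec ι} (hv : v ∈ G) (t : T) {a b : Fin 3} (ha : a ∈ κ t) (hb : b ∈ κ t) :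
    symp (part col a (z t)) v = symp (part col b (z t)) v := by
  have := hG.isotropic _ (hS.z_mem t a ha b hb) v hv
  rw [map_add, LinearMap.add_apply] at this
  exact CharTwo.add_eq_zero.1 this

/-- The coefficients of the parts of `x t` are equal, so these terms form a multiple of `x t`. The
coefficients of the parts of `z t` add up to `symp (x t) v = 0`, so those terms are a combination of
sums of two parts. Hence `G` is compatible with the splitting into blocks. -/
lemma IsBlockSystem.blockComponent_mem (hG : IsLagrangian G) (hS : IsBlockSystem col G κ x z)
    {v : PauliVec ι} (hv : v ∈ G) (t : T) : blockComponent col x z t v ∈ G := by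
  obtain ⟨a₀, ha₀⟩ := hS.nonempty t
  rw [blockComponent_apply, Finset.sum_add_distrib]
  refine add_mem ?_ ?_
  · have : ∀ a, symp (part col a (z t)) v • part col a (x t) =
        symp (part col a₀ (z t)) v • part col a (x t) := by
      intro a
      by_cases ha : a ∈ κ t
      · rw [hS.symp_z_eq hG hv t ha ha₀]
      · simp [hS.part_x t a ha]
    rw [Finset.sum_congr rfl fun a _ => this a, ← Finset.smul_sum, sum_part]
    exact G.smul_mem _ (hS.x_mem t)
  · have : ∀ a, symp (part col a (x t)) v • part col a (z t) =
        symp (part col a (x t)) v • (part col a (z t) + part col a₀ (z t)) +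
          symp (part col a (x t)) v • part col a₀ (z t) := by
      intro a
      rw [← smul_add, add_assoc, ZModModule.add_self, add_zero]
    rw [Finset.sum_congr rfl fun a _ => this a, Finset.sum_add_distrib, ← Finset.sum_smul,
      ← symp_eq_sum_part, hG.isotropic _ (hS.x_mem t) v hv, zero_smul, add_zero]
    refine sum_mem fun a _ => ?_
    by_cases ha : a ∈ κ t
    · exact G.smul_mem _ (hS.z_mem t a ha a₀ ha₀)
    · simp [hS.part_x t a ha]

lemma IsBlockSystem.blockProj_mem_of_mem (hG : IsLagrangian G) (hS : IsBlockSystem col G κ x z)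
    {v : PauliVec ι} (hv : v ∈ G) : blockProj col x z v ∈ G := by
  rw [blockProj_apply]
  exact add_mem hv (sum_mem fun t _ => hS.blockComponent_mem hG hv t)

/-- Duality in the complement of the blocks: if no element of `G` on the colours `a`, `b` detects
`c`, then `c` can be completed by a vector of colour `d` to an element of `G`. -/
lemma IsBlockSystem.exists_pairing (hG : IsLagrangian G) (hS : IsBlockSystem col G κ x z)
    {c : PauliVec ι} (hc : c ∈ blockComplement col x z) {a b d : Fin 3} (hab : a ≠ b) (had : a ≠ d)
    (hbd : b ≠ d) (hca : part col a c = c) :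
    (∃ v ∈ G, v ∈ blockComplement col x z ∧ part col d v = 0 ∧ symp c v = 1) ∨
      ∃ g ∈ G, g ∈ blockComplement col x z ∧ part col b g = 0 ∧ part col a g = c := by
  by_contra! hcon
  obtain ⟨h1, h2⟩ := hcon
  set K : Submodule (ZMod 2) (PauliVec ι) := blockComplement col x z ⊓ LinearMap.ker (part col d)
    with hK
  have horth : ∀ W : Submodule (ZMod 2) (PauliVec ι), symp.orthogonal (symp.orthogonal W) = W :=
    fun W => LinearMap.BilinForm.orthogonal_orthogonal symp_nondegenerate symp_isRefl W
  -- The complement of an intersection is the sum of the complements, and `G` is its own complement.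
  have hsup : symp.orthogonal (G ⊓ K) = G ⊔ symp.orthogonal K := by
    rw [← horth (G ⊔ symp.orthogonal K)]
    congr 1
    ext v
    rw [mem_symp_orthogonal]
    constructor
    · intro hv w hw
      obtain ⟨g, hg, u, hu, rfl⟩ := Submodule.mem_sup.1 hw
      have e1 := hG.isotropic g hg v hv.1
      have e2 := mem_symp_orthogonal.1 hu v hv.2
      rw [map_add, symp_comm v, symp_comm v, e1, e2, add_zero]
    · intro hv
      refine ⟨hG.maximal v fun w hw => hv w (Submodule.mem_sup_left hw), ?_⟩
      change v ∈ K
      rw [← horth K, mem_symp_orthogonal]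
      exact fun w hw => hv w (Submodule.mem_sup_right hw)
  have hcm : c ∈ symp.orthogonal (G ⊓ K) := by
    rw [mem_symp_orthogonal]
    intro v hv
    by_contra hne
    exact h1 v hv.1 hv.2.1 hv.2.2 (zmod_two_eq_one hne)
  rw [hsup] at hcm
  obtain ⟨g, hg, u, hu, hgu⟩ := Submodule.mem_sup.1 hcm
  have hπ : blockProj col x z g + blockProj col x z u = c := by
    rw [← map_add, hgu, blockProj_eq_self hc]
  -- The projection of `u` has only colour `d`: it is orthogonal to all vectors of the complement
  -- without `d`-part, since these form `K`.
  have hpu : ∀ e, e ≠ d → part col e (blockProj col x z u) = 0 := by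
    intro e he
    refine eq_zero_of_symp_eq_zero fun w => ?_
    have hk : blockProj col x z (part col e w) ∈ K := by
      refine ⟨hS.blockProj_mem _, ?_⟩
      change part col d _ = 0
      rw [part_blockProj, part_part_of_ne col he.symm, map_zero]
    rw [symp_part_left, ← symp_blockProj (hS.blockProj_mem u), symp_comm, symp_blockProj hk.1,
      symp_comm]
    exact mem_symp_orthogonal.1 hu _ hk
  refine h2 _ (hS.blockProj_mem_of_mem hG hg) (hS.blockProj_mem g) ?_ ?_
  · have := congrArg (part col b) hπ
    rwa [map_add, hpu b hbd, add_zero, ← hca, part_part_of_ne col hab.symm] at this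
  · have := congrArg (part col a) hπ
    rwa [map_add, hpu a had, add_zero, hca] at this

lemma IsBlockSystem.extend {n : ℕ} {κ : Fin n → Finset (Fin 3)} {x z : Fin n → PauliVec ι}
    (hS : IsBlockSystem col G κ x z) {κ₀ : Finset (Fin 3)} {x₀ z₀ : PauliVec ι}
    (hx₀ : x₀ ∈ blockComplement col x z) (hz₀ : z₀ ∈ blockComplement col x z)
    (hne : κ₀.Nonempty) (hpx : ∀ a ∉ κ₀, part col a x₀ = 0) (hpz : ∀ a ∉ κ₀, part col a z₀ = 0)
    (hzx : ∀ a ∈ κ₀, symp (part col a z₀) x₀ = 1) (hxG : x₀ ∈ G)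
    (hzG : ∀ a ∈ κ₀, ∀ b ∈ κ₀, part col a z₀ + part col b z₀ ∈ G) :
    IsBlockSystem col G (Fin.cons κ₀ κ : Fin (n + 1) → _) (Fin.cons x₀ x) (Fin.cons z₀ z) := by
  have hself : ∀ (v : PauliVec ι) a, symp (part col a v) v = 0 := by
    intro v a
    rw [← part_part_self, symp_part_left, symp_self]
  have hflip : ∀ (v w : PauliVec ι) a, symp (part col a v) w = symp (part col a w) v := by
    intro v w a
    rw [symp_part_left, symp_comm]
  constructor
  · rw [Fin.forall_fin_succ]
    exact ⟨hne, hS.nonempty⟩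
  · rw [Fin.forall_fin_succ]
    exact ⟨hpx, hS.part_x⟩
  · rw [Fin.forall_fin_succ]
    exact ⟨hpz, hS.part_z⟩
  · simp only [Fin.forall_fin_succ (n := n), Fin.cons_zero, Fin.cons_succ]
    refine ⟨⟨hself x₀, fun t a => ?_⟩, fun t => ⟨fun a => (hx₀ t a).1, hS.xx t⟩⟩
    rw [hflip, (hx₀ t a).1]
  · simp only [Fin.forall_fin_succ (n := n), Fin.cons_zero, Fin.cons_succ]
    refine ⟨⟨hself z₀, fun t a => ?_⟩, fun t => ⟨fun a => (hz₀ t a).2, hS.zz t⟩⟩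
    rw [hflip, (hz₀ t a).2]
  · simp only [Fin.forall_fin_succ (n := n), Fin.cons_zero, Fin.cons_succ, true_and, Fin.succ_inj,
      Fin.succ_ne_zero, (Fin.succ_ne_zero _).symm, false_and, if_false]
    refine ⟨⟨fun a => ?_, fun t a => ?_⟩, fun t => ⟨fun a => (hx₀ t a).2, hS.zx t⟩⟩
    · split_ifs with ha
      · exact hzx a ha
      · simp [hpz a ha]
    · rw [hflip, (hz₀ t a).1]
  · rw [Fin.forall_fin_succ]
    exact ⟨hxG, hS.x_mem⟩
  · rw [Fin.forall_fin_succ]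
    exact ⟨hzG, hS.z_mem⟩

/-- A system that leaves out a part of the space can be extended by a block. -/
lemma IsBlockSystem.exists_extension {n : ℕ} {κ : Fin n → Finset (Fin 3)}
    {x z : Fin n → PauliVec ι} (hG : IsLagrangian G) (hS : IsBlockSystem col G κ x z)
    {c : PauliVec ι} (hc : c ∈ blockComplement col x z) (hc0 : c ≠ 0) :
    ∃ (κ' : Fin (n + 1) → Finset (Fin 3)) (x' z' : Fin (n + 1) → PauliVec ι),
      IsBlockSystem col G κ' x' z' := by
  suffices h : ∃ (κ₀ : Finset (Fin 3)) (x₀ z₀ : PauliVec ι), x₀ ∈ blockComplement col x z ∧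
      z₀ ∈ blockComplement col x z ∧ κ₀.Nonempty ∧ (∀ a ∉ κ₀, part col a x₀ = 0) ∧
      (∀ a ∉ κ₀, part col a z₀ = 0) ∧ (∀ a ∈ κ₀, symp (part col a z₀) x₀ = 1) ∧ x₀ ∈ G ∧
      ∀ a ∈ κ₀, ∀ b ∈ κ₀, part col a z₀ + part col b z₀ ∈ G by
    obtain ⟨κ₀, x₀, z₀, h1, h2, h3, h4, h5, h6, h7, h8⟩ := h
    exact ⟨_, _, _, hS.extend h1 h2 h3 h4 h5 h6 h7 h8⟩
  -- A stabilizer of a single party in the complement gives a block of this party; any vector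
  -- pairing nontrivially with it, projected and restricted, serves as `z`.
  by_cases hloc : ∃ v ∈ G, v ∈ blockComplement col x z ∧ v ≠ 0 ∧ ∃ a, part col a v = v
  · obtain ⟨v, hvG, hvC, hv0, a, hva⟩ := hloc
    obtain ⟨u, hu⟩ : ∃ u, symp v u ≠ 0 := by
      by_contra! h
      exact hv0 (eq_zero_of_symp_eq_zero h)
    refine ⟨{a}, v, part col a (blockProj col x z u), hvC,
      part_mem_blockComplement (hS.blockProj_mem u) a, by simp, ?_, ?_, ?_, hvG, ?_⟩
    · intro b hb
      rw [← hva, part_part_of_ne col (by simpa using hb)]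
    · intro b hb
      rw [part_part_of_ne col (by simpa using hb)]
    · intro b hb
      obtain rfl : b = a := by simpa using hb
      rw [part_part_self, symp_part_left, hva, symp_comm, symp_blockProj hvC]
      exact zmod_two_eq_one hu
    · intro b hb b' hb'
      obtain rfl : b = a := by simpa using hb
      obtain rfl : b' = b := by simpa using hb'
      rw [ZModModule.add_self]
      exact G.zero_mem
  -- Two stabilizers on the colours `a`, `b` whose `a`-parts anticommute give a Bell pair. Their
  -- `b`-parts anticommute too, since the stabilizers themselves commute.
  by_cases hpair : ∃ g ∈ G, g ∈ blockComplement col x z ∧ ∃ h ∈ G, h ∈ blockComplement col x z ∧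
      ∃ a b : Fin 3, a ≠ b ∧ (∀ d, d ≠ a → d ≠ b → part col d g = 0 ∧ part col d h = 0) ∧
        symp (part col a g) h = 1
  · obtain ⟨g, hgG, hgC, h, hhG, hhC, a, b, hab, hd, hgh⟩ := hpair
    have hgh' : symp (part col b g) h = 1 := by
      have h0 := hG.isotropic g hgG h hhG
      rw [symp_eq_sum_part col, ← Finset.sum_subset (Finset.subset_univ {a, b}),
        Finset.sum_pair hab, hgh] at h0
      · revert h0
        generalize symp (part col b g) h = c
        revert c
        decide
      · intro d _ hdd
        have hdd' : d ≠ a ∧ d ≠ b := by simpa using hdd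
        rw [(hd d hdd'.1 hdd'.2).1]
        simp
    have hsum : ∀ v : PauliVec ι, (∀ d, d ≠ a → d ≠ b → part col d v = 0) →
        part col a v + part col b v = v := by
      intro v hv
      conv_rhs => rw [← sum_part col v]
      rw [← Finset.sum_subset (Finset.subset_univ {a, b}), Finset.sum_pair hab]
      intro d _ hdd
      have hdd' : d ≠ a ∧ d ≠ b := by simpa using hdd
      exact hv d hdd'.1 hdd'.2
    refine ⟨{a, b}, h, g, hhC, hgC, by simp, ?_, ?_, ?_, hhG, ?_⟩
    · intro d hdd
      have hdd' : d ≠ a ∧ d ≠ b := by simpa using hdd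
      exact (hd d hdd'.1 hdd'.2).2
    · intro d hdd
      have hdd' : d ≠ a ∧ d ≠ b := by simpa using hdd
      exact (hd d hdd'.1 hdd'.2).1
    · intro d hdd
      rcases Finset.mem_insert.1 hdd with rfl | hdd
      · exact hgh
      · rw [Finset.mem_singleton.1 hdd]
        exact hgh'
    · have hgsum := hsum g fun d h1 h2 => (hd d h1 h2).1
      intro e he e' he'
      have he1 : e = a ∨ e = b := by simpa using he
      have he2 : e' = a ∨ e' = b := by simpa using he'
      rcases he1 with h1 | h1 <;> rcases he2 with h2 | h2 <;> rw [h1, h2]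
      · rw [ZModModule.add_self]; exact G.zero_mem
      · rw [hgsum]; exact hgG
      · rw [add_comm, hgsum]; exact hgG
      · rw [ZModModule.add_self]; exact G.zero_mem
  -- What is left yields a GHZ block.
  push Not at hloc hpair
  obtain ⟨a, ha⟩ : ∃ a, part col a c ≠ 0 := by
    by_contra! h
    exact hc0 (by rw [← sum_part col c]; simp [h])
  obtain ⟨b, d, hab, had, hbd, huniv⟩ : ∃ b d : Fin 3, a ≠ b ∧ a ≠ d ∧ b ≠ d ∧
      ∀ e, e = a ∨ e = b ∨ e = d := by
    clear ha; revert a; decide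
  -- No anticommuting pairs exist, so the first alternative of `exists_pairing` fails for the
  -- `a`-part of a stabilizer on `a`, `b`. This part is therefore also the `a`-part of a stabilizer
  -- on `a`, `d`.
  have hiso : ∀ b d : Fin 3, a ≠ b → a ≠ d → b ≠ d → (∀ e, e = a ∨ e = b ∨ e = d) →
      ∀ g ∈ G, g ∈ blockComplement col x z → part col d g = 0 → part col a g ≠ 0 →
      ∃ h ∈ G, h ∈ blockComplement col x z ∧ part col b h = 0 ∧ part col a h = part col a g := by
    intro b d hab had hbd huniv g hgG hgC hgd hg0
    rcases hS.exists_pairing hG (part_mem_blockComplement hgC a) hab had hbd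
      (part_part_self col a g) with ⟨v, hvG, hvC, hvd, hv1⟩ | h
    · refine absurd hv1 (hpair g hgG hgC v hvG hvC a b hab fun e he1 he2 => ?_)
      rcases huniv e with rfl | rfl | rfl
      · exact absurd rfl he1
      · exact absurd rfl he2
      · exact ⟨hgd, hvd⟩
    · exact h
  have hunivs : ∀ e, e = a ∨ e = d ∨ e = b := fun e => by
    rcases huniv e with h | h | h <;> simp [h]
  obtain ⟨g, hgG, hgC, hgd, h, hhG, hhC, hhb, hgh, hg0⟩ : ∃ g ∈ G, g ∈ blockComplement col x z ∧
      part col d g = 0 ∧ ∃ h ∈ G, h ∈ blockComplement col x z ∧ part col b h = 0 ∧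
        part col a h = part col a g ∧ part col a g ≠ 0 := by
    rcases hS.exists_pairing hG (part_mem_blockComplement hc a) hab had hbd
      (part_part_self col a c) with ⟨g, hgG, hgC, hgd, hv1⟩ | ⟨h, hhG, hhC, hhb, hha⟩
    · have hg0 : part col a g ≠ 0 := by
        intro h0
        rw [symp_part_left, h0] at hv1
        simp at hv1
      obtain ⟨h, hhG, hhC, hhb, hha⟩ := hiso b d hab had hbd huniv g hgG hgC hgd hg0
      exact ⟨g, hgG, hgC, hgd, h, hhG, hhC, hhb, hha, hg0⟩
    · have hh0 : part col a h ≠ 0 := by rwa [hha]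
      obtain ⟨g, hgG, hgC, hgd, hga⟩ := hiso d b had hab hbd.symm hunivs h hhG hhC hhb hh0
      exact ⟨g, hgG, hgC, hgd, h, hhG, hhC, hhb, hga.symm, by rwa [hga]⟩
  -- The common `a`-part is not itself in `G`, because there are no one-party stabilizers. By
  -- maximality of `G` some `u` in `G` anticommutes with it; its projection becomes the `x` of the
  -- block.
  have hzG : part col a g ∉ G := fun hmem =>
    hloc _ hmem (part_mem_blockComplement hgC a) hg0 a (part_part_self col a g)
  obtain ⟨u, huG, hu⟩ : ∃ u ∈ G, symp (part col a g) u ≠ 0 := by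
    by_contra! hcon
    exact hzG (hG.maximal _ hcon)
  have hu1 : symp (part col a g) (blockProj col x z u) = 1 := by
    rw [symp_blockProj (part_mem_blockComplement hgC a)]
    exact zmod_two_eq_one hu
  have hpu := hS.blockProj_mem_of_mem hG huG
  have hgsum : part col a g + part col b g = g := by
    conv_rhs => rw [← sum_part col g]
    rw [← Finset.sum_subset (Finset.subset_univ {a, b}), Finset.sum_pair hab]
    intro e _ he
    have he' : e ≠ a ∧ e ≠ b := by simpa using he
    rcases huniv e with rfl | rfl | rfl
    · exact absurd rfl he'.1
    · exact absurd rfl he'.2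
    · exact hgd
  have hhsum : part col a g + part col d h = h := by
    conv_rhs => rw [← sum_part col h]
    rw [← Finset.sum_subset (Finset.subset_univ {a, d}), Finset.sum_pair had, hgh]
    intro e _ he
    have he' : e ≠ a ∧ e ≠ d := by simpa using he
    rcases huniv e with rfl | rfl | rfl
    · exact absurd rfl he'.1
    · exact hhb
    · exact absurd rfl he'.2
  have hpa : part col a (part col a g + part col b g + part col d h) = part col a g := by
    simp [part_part, hab, had]
  have hpb : part col b (part col a g + part col b g + part col d h) = part col b g := by
    simp [part_part, hab.symm, hbd]
  have hpd : part col d (part col a g + part col b g + part col d h) = part col d h := by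
    simp [part_part, had.symm, hbd.symm]
  have hb1 : symp (part col b g) (blockProj col x z u) = 1 := by
    have h0 := hG.isotropic g hgG _ hpu
    rw [← hgsum, map_add, LinearMap.add_apply, hu1] at h0
    revert h0
    generalize symp (part col b g) (blockProj col x z u) = c
    revert c
    decide
  have hd1 : symp (part col d h) (blockProj col x z u) = 1 := by
    have h0 := hG.isotropic h hhG _ hpu
    rw [← hhsum, map_add, LinearMap.add_apply, hu1] at h0
    revert h0
    generalize symp (part col d h) (blockProj col x z u) = c
    revert c
    decide
  -- The vector `z` collects the three parts of `g` and `h`. Their pairwise sums are `g`, `h` and `g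
  -- + h`, and the pairings with `x` are equal because `g` and `h` are orthogonal to it.
  refine ⟨Finset.univ, blockProj col x z u, part col a g + part col b g + part col d h,
    hS.blockProj_mem u, add_mem (add_mem (part_mem_blockComplement hgC a)
      (part_mem_blockComplement hgC b)) (part_mem_blockComplement hhC d), by simp, by simp,
      by simp, ?_, hpu, ?_⟩
  · intro e _
    rcases huniv e with rfl | rfl | rfl
    · rw [hpa, hu1]
    · rw [hpb, hb1]
    · rw [hpd, hd1]
  · have hbdG : part col b g + part col d h ∈ G := by
      have h0 := add_mem hgG hhG
      rw [← hgsum, ← hhsum, add_comm (part col a g) (part col b g), add_assoc, ← add_assoc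
        (part col a g) (part col a g), ZModModule.add_self, zero_add] at h0
      exact h0
    intro e _ e' _
    rcases huniv e with rfl | rfl | rfl <;> rcases huniv e' with rfl | rfl | rfl <;>
      simp only [hpa, hpb, hpd, ZModModule.add_self, G.zero_mem]
    · rwa [hgsum]
    · rwa [hhsum]
    · rwa [add_comm, hgsum]
    · exact hbdG
    · rwa [add_comm, hhsum]
    · rwa [add_comm]

/-- Every Lagrangian subspace is described by a complete system of blocks. -/
theorem exists_complete_blockSystem (hG : IsLagrangian G) :
    ∃ (n : ℕ) (κ : Fin n → Finset (Fin 3)) (x z : Fin n → PauliVec ι),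
      IsBlockSystem col G κ x z ∧ blockComplement col x z = ⊥ := by
  classical
  set P : ℕ → Prop := fun n => ∃ (κ : Fin n → Finset (Fin 3)) (x z : Fin n → PauliVec ι),
    IsBlockSystem col G κ x z with hP
  have h0 : P 0 := ⟨fun _ => ∅, 0, 0, by constructor <;> intro t <;> exact t.elim0⟩
  -- The vectors `x t` are distinct elements of a finite space, so a system with the largest number
  -- of blocks exists. By `exists_extension` its complement is zero.
  have hbound : ∀ n, P n → n ≤ Fintype.card (PauliVec ι) := by
    rintro n ⟨κ, x, z, hS⟩
    have hinj : Function.Injective x := by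
      intro t t' htt
      obtain ⟨a, ha⟩ := hS.nonempty t
      have h1 := hS.zx t t a
      rw [htt, hS.zx t t' a] at h1
      by_contra hne
      simp [hne, ha] at h1
    simpa using Fintype.card_le_of_injective x hinj
  set n := Nat.findGreatest P (Fintype.card (PauliVec ι)) with hn
  obtain ⟨κ, x, z, hS⟩ : P n := Nat.findGreatest_spec (Nat.zero_le _) h0
  refine ⟨n, κ, x, z, hS, ?_⟩
  by_contra hne
  obtain ⟨c, hc, hc0⟩ := Submodule.exists_mem_ne_zero_of_ne_bot hne
  have hP1 : P (n + 1) := hS.exists_extension hG hc hc0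
  have := Nat.le_findGreatest (hbound _ hP1) hP1
  omega

/-- The pairings with the blocks are coordinates on the vectors of colour `a`: faithful because the
complement is zero, arbitrary because the pairs are hyperbolic. Hence `4 ^ #qubits = 4 ^ #blocks`.
-/
lemma IsBlockSystem.card_color (hS : IsBlockSystem col G κ x z)
    (hcompl : blockComplement col x z = ⊥) (a : Fin 3) :
    Fintype.card {i // col i = a} = Fintype.card {t // a ∈ κ t} := by
  classical
  set ext : ({i // col i = a} → ZMod 2 × ZMod 2) → PauliVec ι :=
    fun u i => if h : col i = a then u ⟨i, h⟩ else 0 with hext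
  have hpext : ∀ u, part col a (ext u) = ext u := by
    intro u
    funext i
    simp only [part_apply, hext]
    split_ifs <;> rfl
  have hsub : ∀ u v, ext (u - v) = ext u - ext v := by
    intro u v
    funext i
    simp only [hext, Pi.sub_apply]
    split_ifs <;> simp
  have hxz : ∀ t t' b, symp (part col b (x t)) (z t') = if t = t' ∧ b ∈ κ t then 1 else 0 := by
    intro t t' b
    rw [symp_part_left, symp_comm, hS.zx]
    by_cases h : t = t'
    · subst h; rfl
    · simp [h, Ne.symm h]
  set f : ({i // col i = a} → ZMod 2 × ZMod 2) → ({t // a ∈ κ t} → ZMod 2 × ZMod 2) :=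
    fun u t => (symp (part col a (z t)) (ext u), symp (part col a (x t)) (ext u)) with hf
  have hinj : Function.Injective f := by
    intro u v huv
    have hmem : ext (u - v) ∈ blockComplement col x z := by
      intro t b
      rw [← hpext, symp_part_part, symp_part_part]
      by_cases hb : b = a
      · subst hb
        rw [if_pos rfl, if_pos rfl]
        by_cases ht : b ∈ κ t
        · have := congrFun huv ⟨t, ht⟩
          simp only [hf, Prod.mk.injEq] at this
          rw [hsub, map_sub, map_sub, this.1, this.2]
          simp
        · simp [hS.part_x t b ht, hS.part_z t b ht]
      · simp [hb]
    rw [hcompl, Submodule.mem_bot] at hmem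
    funext i
    have := congrFun hmem i.1
    simp only [hext, i.2, dif_pos, Pi.zero_apply, Pi.sub_apply] at this
    exact sub_eq_zero.1 this
  have hsurj : Function.Surjective f := by
    intro w
    set v : PauliVec ι := ∑ t : {t // a ∈ κ t},
      ((w t).1 • part col a (x t) + (w t).2 • part col a (z t)) with hv
    have hpv : ext (fun i => v i) = v := by
      funext i
      simp only [hext]
      split_ifs with h
      · rfl
      · simp [hv, Finset.sum_apply, part_apply, h]
    refine ⟨fun i => v i, ?_⟩
    funext t
    simp only [hf, hpv]
    refine Prod.ext ?_ ?_
    · change symp (part col a (z t)) v = _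
      rw [hv, map_sum, Finset.sum_eq_single t]
      · simp [symp_part_part, hS.zx, hS.zz, t.2]
      · intro t' _ ht
        have : (t : T) ≠ t' := fun h => ht (Subtype.ext h.symm)
        simp [symp_part_part, hS.zx, hS.zz, this]
      · simp
    · change symp (part col a (x t)) v = _
      rw [hv, map_sum, Finset.sum_eq_single t]
      · simp [symp_part_part, hxz, hS.xx, t.2]
      · intro t' _ ht
        have : (t : T) ≠ t' := fun h => ht (Subtype.ext h.symm)
        simp [symp_part_part, hxz, hS.xx, this]
      · simp
  have hcard := Fintype.card_of_bijective ⟨hinj, hsurj⟩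
  simp only [Fintype.card_fun, Fintype.card_prod, ZMod.card] at hcard
  exact Nat.pow_right_injective (by norm_num : 2 ≤ 2 * 2) hcard

lemma part_blockComponent_eq_zero {t : T} {a : Fin 3} (hx : part col a (x t) = 0)
    (hz : part col a (z t) = 0) (v : PauliVec ι) :
    part col a (blockComponent col x z t v) = 0 := by
  rw [part_blockComponent, blockComponent_apply]
  refine Finset.sum_eq_zero fun b _ => ?_
  rw [symp_part_part, symp_part_part]
  by_cases h : b = a
  · subst h; simp [hx, hz]
  · simp [h]

/-- `G` is the sum of its subspaces of vectors vanishing on one colour, if and only if no block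
involves all three colours. -/
theorem IsBlockSystem.forall_exists_sum_iff (hG : IsLagrangian G)
    (hS : IsBlockSystem col G κ x z) (hcompl : blockComplement col x z = ⊥) :
    (∀ v ∈ G, ∃ u : Fin 3 → PauliVec ι, (∀ a, u a ∈ G ∧ part col a (u a) = 0) ∧ v = ∑ a, u a) ↔
      ∀ t, κ t ≠ Finset.univ := by
  constructor
  · intro h t ht
    obtain ⟨u, hu, hsum⟩ := h (x t) (hS.x_mem t)
    -- On `G` the pairing with a part of `z t` does not depend on the colour, and for the colour
    -- missing in `u a` it is zero. But `x t` has pairing 1, so it is not such a sum.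
    have key : ∀ a, symp (part col 0 (z t)) (u a) = 0 := by
      intro a
      rw [hS.symp_z_eq hG (hu a).1 t (b := a) (by simp [ht]) (by simp [ht]), symp_part_left,
        (hu a).2, map_zero]
    have h1 := hS.zx t t 0
    rw [hsum, map_sum, Finset.sum_eq_zero fun a _ => key a] at h1
    simp [ht] at h1
  · intro h v hv
    have hmiss : ∀ t, ∃ a, a ∉ κ t := by
      intro t
      by_contra! hcon
      exact h t (Finset.eq_univ_iff_forall.2 hcon)
    choose m hm using hmiss
    -- Each block component of `v` is assigned to one colour that its block avoids.
    refine ⟨fun a => ∑ t with m t = a, blockComponent col x z t v, fun a => ⟨?_, ?_⟩, ?_⟩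
    · exact sum_mem fun t _ => hS.blockComponent_mem hG hv t
    · rw [map_sum]
      refine Finset.sum_eq_zero fun t ht => ?_
      have hta := (Finset.mem_filter.1 ht).2
      subst hta
      exact part_blockComponent_eq_zero (hS.part_x t _ (hm t)) (hS.part_z t _ (hm t)) v
    · rw [Finset.sum_fiberwise]
      have h0 := hS.blockProj_mem v
      rw [hcompl, Submodule.mem_bot, blockProj_apply] at h0
      have h2 := congrArg (· + ∑ t, blockComponent col x z t v) h0
      simpa [add_assoc, ZModModule.add_self] using h2

end System

end Symplectic

end

noncomputable section

/-! ### Pauli operators as a projective representation of the symplectic space -/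

/-- The Pauli matrix with given exponents of `X` and `Z`. -/
def pauliLabel (p : ZMod 2 × ZMod 2) : Pauli :=
  if p.1 = 0 then (if p.2 = 0 then .I else .Z) else (if p.2 = 0 then .X else .Y)

/-- The exponents of `X` and `Z` in a Pauli matrix. -/
def Pauli.exponents : Pauli → ZMod 2 × ZMod 2
  | .I => (0, 0)
  | .X => (1, 0)
  | .Y => (1, 1)
  | .Z => (0, 1)

lemma pauliLabel_exponents (P : Pauli) : pauliLabel P.exponents = P := by
  cases P <;> simp [pauliLabel, Pauli.exponents]

lemma pauliLabel_zero : pauliLabel 0 = .I := by simp [pauliLabel]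

lemma zmod_two_cases (c : ZMod 2) : c = 0 ∨ c = 1 := by
  revert c; decide

lemma forall_zmod_two_prod {p : ZMod 2 × ZMod 2 → Prop} (h00 : p (0, 0)) (h01 : p (0, 1))
    (h10 : p (1, 0)) (h11 : p (1, 1)) (q : ZMod 2 × ZMod 2) : p q := by
  obtain ⟨a, b⟩ := q
  rcases zmod_two_cases a with rfl | rfl <;> rcases zmod_two_cases b with rfl | rfl <;> assumption

/-- The sign `(-1) ^ c`. -/
def sgn (c : ZMod 2) : ℂ := if c = 0 then 1 else -1

lemma sgn_zero : sgn 0 = 1 := by simp [sgn]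

lemma sgn_one : sgn 1 = -1 := by simp [sgn]

lemma sgn_add (a b : ZMod 2) : sgn (a + b) = sgn a * sgn b := by
  have h : (1 + 1 : ZMod 2) = 0 := rfl
  rcases zmod_two_cases a with rfl | rfl <;> rcases zmod_two_cases b with rfl | rfl <;>
    simp [sgn, h]

lemma sgn_sum {ι : Type*} (s : Finset ι) (f : ι → ZMod 2) :
    sgn (∑ i ∈ s, f i) = ∏ i ∈ s, sgn (f i) := by
  classical
  induction s using Finset.induction_on with
  | empty => simp [sgn_zero]
  | insert i s hi ih => rw [Finset.sum_insert hi, Finset.prod_insert hi, sgn_add, ih]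

lemma sgn_injective : Function.Injective sgn := by
  intro a b h
  rcases zmod_two_cases a with rfl | rfl <;> rcases zmod_two_cases b with rfl | rfl <;>
    first | rfl | (exfalso; norm_num [sgn] at h)

lemma pauliLabel_mat_mul (p q : ZMod 2 × ZMod 2) : ∃ k : ℕ,
    (pauliLabel p).mat * (pauliLabel q).mat = Complex.I ^ k • (pauliLabel (p + q)).mat := by
  have h : (1 + 1 : ZMod 2) = 0 := rfl
  have h3 : Complex.I ^ 3 = -Complex.I := by rw [pow_succ, Complex.I_sq]; ring
  revert p q
  refine forall_zmod_two_prod ?_ ?_ ?_ ?_ <;> refine forall_zmod_two_prod ?_ ?_ ?_ ?_ <;>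
    simp only [pauliLabel, Pauli.mat, Prod.mk_add_mk, add_zero, zero_add, h, if_true, if_false,
      one_ne_zero, one_mul, mul_one] <;>
    -- Products of two Hermitian Pauli matrices carry only the phases `1`, `i` and `-i = i³`.
    first
    | (refine ⟨0, ?_⟩; ext i j; fin_cases i <;> fin_cases j <;>
        simp [Matrix.mul_apply, Fin.sum_univ_two] <;> done)
    | (refine ⟨1, ?_⟩; ext i j; fin_cases i <;> fin_cases j <;>
        simp [Matrix.mul_apply, Fin.sum_univ_two] <;> done)
    | (refine ⟨3, ?_⟩; ext i j; fin_cases i <;> fin_cases j <;>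
        simp [Matrix.mul_apply, Fin.sum_univ_two, h3])

lemma pauliLabel_mat_comm (p q : ZMod 2 × ZMod 2) :
    (pauliLabel p).mat * (pauliLabel q).mat =
      sgn (p.1 * q.2 + p.2 * q.1) • ((pauliLabel q).mat * (pauliLabel p).mat) := by
  have h : (1 + 1 : ZMod 2) = 0 := rfl
  revert p q
  refine forall_zmod_two_prod ?_ ?_ ?_ ?_ <;> refine forall_zmod_two_prod ?_ ?_ ?_ ?_ <;>
    simp only [pauliLabel, Pauli.mat, add_zero, zero_add, h, if_true, if_false,
      one_ne_zero, one_mul, mul_one, mul_zero, sgn_zero, sgn_one, one_smul] <;>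
    (ext i j; fin_cases i <;> fin_cases j <;> simp [Matrix.mul_apply, Fin.sum_univ_two])

lemma Pauli.mat_mul_self (P : Pauli) : P.mat * P.mat = 1 := by
  cases P <;> ext i j <;> fin_cases i <;> fin_cases j <;>
    simp [Pauli.mat, Matrix.mul_apply, Fin.sum_univ_two]

lemma Pauli.mat_conjTranspose (P : Pauli) : P.matᴴ = P.mat := by
  cases P <;> ext i j <;> fin_cases i <;> fin_cases j <;> simp [Pauli.mat]

section Operators

variable {ι : Type*} [Fintype ι] [DecidableEq ι]

set_option linter.unusedSectionVars false
set_option linter.unusedDecidableInType false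
set_option linter.unusedFintypeInType false

lemma pauliString_mul (P Q : ι → Pauli) : pauliString P * pauliString Q =
    Matrix.of fun x y => ∏ i, ((P i).mat * (Q i).mat) (x i) (y i) := by
  ext x y
  simp only [pauliString, Matrix.mul_apply, Matrix.of_apply, ← Finset.prod_mul_distrib]
  rw [Finset.prod_univ_sum, Fintype.piFinset_univ]

lemma pauliString_I : pauliString (fun _ : ι => Pauli.I) = 1 := by
  ext x y
  simp only [pauliString, Matrix.of_apply, Pauli.mat, Matrix.one_apply]
  by_cases h : x = y
  · simp [h]
  · obtain ⟨i, hi⟩ := Function.ne_iff.1 h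
    rw [if_neg h]
    exact Finset.prod_eq_zero (Finset.mem_univ i) (by simp [hi])

/-- The Hermitian Pauli operator with given exponents. -/
def pauliOp (v : PauliVec ι) : Matrix (ι → Fin 2) (ι → Fin 2) ℂ :=
  pauliString fun i => pauliLabel (v i)

lemma pauliOp_zero : pauliOp (0 : PauliVec ι) = 1 := by
  simp only [pauliOp, Pi.zero_apply, pauliLabel_zero, pauliString_I]

lemma pauliOp_mul (v w : PauliVec ι) : ∃ k : ℕ,
    pauliOp v * pauliOp w = Complex.I ^ k • pauliOp (v + w) := by
  choose k hk using fun i => pauliLabel_mat_mul (v i) (w i)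
  refine ⟨∑ i, k i, ?_⟩
  rw [pauliOp, pauliOp, pauliString_mul]
  ext x y
  simp only [hk, Matrix.of_apply, pauliOp, pauliString, Matrix.smul_apply, smul_eq_mul,
    Finset.prod_mul_distrib, Finset.prod_pow_eq_pow_sum, Pi.add_apply]

lemma pauliOp_mul_of_disjoint {v w : PauliVec ι} (h : ∀ i, v i = 0 ∨ w i = 0) :
    pauliOp v * pauliOp w = pauliOp (v + w) := by
  rw [pauliOp, pauliOp, pauliString_mul, pauliOp, pauliString]
  ext x y
  simp only [Matrix.of_apply]
  refine Finset.prod_congr rfl fun i _ => ?_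
  rcases h i with h | h <;> simp [h, pauliLabel_zero, Pauli.mat]

lemma pauliOp_comm (v w : PauliVec ι) :
    pauliOp v * pauliOp w = sgn (symp v w) • (pauliOp w * pauliOp v) := by
  rw [pauliOp, pauliOp, pauliString_mul, pauliString_mul, symp_apply, sgn_sum]
  ext x y
  simp only [Matrix.of_apply, Matrix.smul_apply, smul_eq_mul, ← Finset.prod_mul_distrib]
  refine Finset.prod_congr rfl fun i _ => ?_
  rw [pauliLabel_mat_comm, Matrix.smul_apply, smul_eq_mul]

lemma pauliOp_mul_self (v : PauliVec ι) : pauliOp v * pauliOp v = 1 := by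
  rw [pauliOp, pauliString_mul]
  simp only [Pauli.mat_mul_self]
  exact pauliString_I

lemma pauliOp_conjTranspose (v : PauliVec ι) : (pauliOp v)ᴴ = pauliOp v := by
  ext x y
  simp only [pauliOp, pauliString, Matrix.conjTranspose_apply, Matrix.of_apply, star_prod]
  refine Finset.prod_congr rfl fun i _ => ?_
  rw [← Matrix.conjTranspose_apply, Pauli.mat_conjTranspose]

lemma pauliOp_ne_zero (v : PauliVec ι) : pauliOp v ≠ 0 := by
  intro h
  have := pauliOp_mul_self v
  rw [h, mul_zero] at this
  exact zero_ne_one this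

/-- Proportional operators have the same commutation sign with every Pauli operator, and the
symplectic form is nondegenerate. -/
lemma eq_of_pauliOp_eq_smul {v w : PauliVec ι} {c : ℂ} (h : pauliOp v = c • pauliOp w) :
    v = w := by
  have hc : c ≠ 0 := by
    rintro rfl
    exact pauliOp_ne_zero v (by rw [h, zero_smul])
  have key : ∀ u, symp v u = symp w u := by
    intro u
    have h1 := pauliOp_comm v u
    rw [h, Matrix.smul_mul, Matrix.mul_smul, pauliOp_comm w u, smul_comm c] at h1
    have hne : c • (pauliOp u * pauliOp w) ≠ 0 := by
      refine smul_ne_zero hc fun h0 => pauliOp_ne_zero w ?_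
      rw [← one_mul (pauliOp w), ← pauliOp_mul_self u, mul_assoc, h0, mul_zero]
    exact (sgn_injective (smul_left_injective ℂ hne h1)).symm
  have : v - w = 0 := eq_zero_of_symp_eq_zero fun u => by
    rw [map_sub, LinearMap.sub_apply, key, sub_self]
  exact sub_eq_zero.1 this

/-! ### The stabilizer group -/

/-- `u` is, up to a power of `i`, the Pauli operator with exponents `v`. -/
def HasExponents (u : QubitOp ι) (v : PauliVec ι) : Prop :=
  ∃ k : ℕ, (u : Matrix (ι → Fin 2) (ι → Fin 2) ℂ) = Complex.I ^ k • pauliOp v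

lemma HasExponents.unique {u : QubitOp ι} {v w : PauliVec ι} (hv : HasExponents u v)
    (hw : HasExponents u w) : v = w := by
  obtain ⟨k, hk⟩ := hv
  obtain ⟨l, hl⟩ := hw
  have hI : Complex.I ^ k ≠ 0 := pow_ne_zero _ Complex.I_ne_zero
  refine eq_of_pauliOp_eq_smul (c := (Complex.I ^ k)⁻¹ * Complex.I ^ l) ?_
  rw [mul_smul, ← hl, hk, smul_smul, inv_mul_cancel₀ hI, one_smul]

lemma HasExponents.mul {u u' : QubitOp ι} {v v' : PauliVec ι} (h : HasExponents u v)
    (h' : HasExponents u' v') : HasExponents (u * u') (v + v') := by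
  obtain ⟨k, hk⟩ := h
  obtain ⟨l, hl⟩ := h'
  obtain ⟨m, hm⟩ := pauliOp_mul v v'
  refine ⟨k + l + m, ?_⟩
  rw [Submonoid.coe_mul, hk, hl, Matrix.smul_mul, Matrix.mul_smul, hm, smul_smul, smul_smul,
    pow_add, pow_add, mul_assoc]

lemma HasExponents.one : HasExponents (1 : QubitOp ι) 0 :=
  ⟨0, by rw [pauliOp_zero]; simp⟩

lemma HasExponents.inv {u : QubitOp ι} {v : PauliVec ι} (h : HasExponents u v) :
    HasExponents u⁻¹ v := by
  obtain ⟨k, hk⟩ := h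
  -- The phase of the inverse is the conjugate of `iᵏ`, that is `(i³)ᵏ`.
  refine ⟨3 * k, ?_⟩
  have h3 : Complex.I ^ 3 = star Complex.I := by
    rw [pow_succ, Complex.I_sq]; simp
  rw [Matrix.UnitaryGroup.inv_val, hk, star_smul, Matrix.star_eq_conjTranspose,
    pauliOp_conjTranspose, pow_mul, h3, star_pow]

lemma isPauliTrivialOn_iff {S : Set ι} {u : QubitOp ι} :
    IsPauliTrivialOn S u ↔ ∃ v, HasExponents u v ∧ ∀ i ∈ S, v i = 0 := by
  constructor
  · rintro ⟨k, P, hP, hS⟩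
    refine ⟨fun i => (P i).exponents, ⟨k, ?_⟩, fun i hi => ?_⟩
    · rw [hP, pauliOp]
      simp only [pauliLabel_exponents]
    · simp [hS i hi, Pauli.exponents]
  · rintro ⟨v, ⟨k, hk⟩, hS⟩
    refine ⟨⟨k % 4, Nat.mod_lt _ (by norm_num)⟩, fun i => pauliLabel (v i), ?_, fun i hi => ?_⟩
    · rw [hk, pauliOp, Complex.I_pow_eq_pow_mod]
    · simp only [hS i hi, pauliLabel_zero]

/-- The Pauli operators that have `ψ` as an eigenvector. -/
def stabilizerSpace (ψ : (ι → Fin 2) → ℂ) : Submodule (ZMod 2) (PauliVec ι) where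
  carrier := {v | ∃ c : ℂ, pauliOp v *ᵥ ψ = c • ψ}
  zero_mem' := ⟨1, by simp [pauliOp_zero]⟩
  add_mem' := by
    rintro v w ⟨c, hc⟩ ⟨d, hd⟩
    obtain ⟨k, hk⟩ := pauliOp_mul v w
    have hI : Complex.I ^ k ≠ 0 := pow_ne_zero _ Complex.I_ne_zero
    refine ⟨(Complex.I ^ k)⁻¹ * (d * c), ?_⟩
    have : pauliOp (v + w) = (Complex.I ^ k)⁻¹ • (pauliOp v * pauliOp w) := by
      rw [hk, smul_smul, inv_mul_cancel₀ hI, one_smul]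
    rw [this, Matrix.smul_mulVec, ← Matrix.mulVec_mulVec, hd, Matrix.mulVec_smul, hc, smul_smul,
      smul_smul, mul_assoc]
  smul_mem' := by
    rintro c v hv
    rcases zmod_two_cases c with rfl | rfl
    · rw [zero_smul]
      exact ⟨1, by simp [pauliOp_zero]⟩
    · rwa [one_smul]

lemma mem_stabilizerSpace {ψ : (ι → Fin 2) → ℂ} {v : PauliVec ι} :
    v ∈ stabilizerSpace ψ ↔ ∃ c : ℂ, pauliOp v *ᵥ ψ = c • ψ := Iff.rfl

lemma pauliOp_eigenvalue {ψ : (ι → Fin 2) → ℂ} (hψ : ψ ≠ 0) {v : PauliVec ι} {c : ℂ}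
    (h : pauliOp v *ᵥ ψ = c • ψ) : c = 1 ∨ c = -1 := by
  have h1 : pauliOp v *ᵥ (pauliOp v *ᵥ ψ) = ψ := by
    rw [Matrix.mulVec_mulVec, pauliOp_mul_self, Matrix.one_mulVec]
  rw [h, Matrix.mulVec_smul, h, smul_smul] at h1
  have h2 : c * c = 1 := by
    apply smul_left_injective ℂ hψ
    simpa using h1
  exact mul_self_eq_one_iff.1 h2

/-! ### The stabilizer group modulo phases as a Lagrangian subspace. -/

section State

variable {g : Fin (Fintype.card ι) → QubitOp ι} {ψ : (ι → Fin 2) → ℂ}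

lemma IsStabilizerState.ne_zero (h : IsStabilizerState g ψ) : ψ ≠ 0 := by
  rintro rfl
  simpa using h.norm_one

lemma IsStabilizerState.stabilizes_group (h : IsStabilizerState g ψ) {u : QubitOp ι}
    (hu : u ∈ stabilizerGroup g) : (u : Matrix (ι → Fin 2) (ι → Fin 2) ℂ) *ᵥ ψ = ψ := by
  induction hu using Subgroup.closure_induction with
  | mem x hx => obtain ⟨i, rfl⟩ := hx; exact h.stabilizes i
  | one => simp
  | mul x y _ _ hx hy => rw [Submonoid.coe_mul, ← Matrix.mulVec_mulVec, hy, hx]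
  | inv x _ hx =>
    conv_lhs => rw [← hx]
    rw [Matrix.mulVec_mulVec, ← Submonoid.coe_mul, inv_mul_cancel]
    simp

lemma HasExponents.mem_stabilizerSpace {u : QubitOp ι} {v : PauliVec ι} (hv : HasExponents u v)
    (hu : (u : Matrix (ι → Fin 2) (ι → Fin 2) ℂ) *ᵥ ψ = ψ) : v ∈ stabilizerSpace ψ := by
  obtain ⟨k, hk⟩ := hv
  have hI : Complex.I ^ k ≠ 0 := pow_ne_zero _ Complex.I_ne_zero
  refine ⟨(Complex.I ^ k)⁻¹, ?_⟩
  conv_rhs => rw [← hu, hk, Matrix.smul_mulVec, smul_smul, inv_mul_cancel₀ hI, one_smul]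

lemma IsStabilizerState.exists_exponents (h : IsStabilizerState g ψ) (i : Fin (Fintype.card ι)) :
    ∃ v, HasExponents (g i) v := by
  obtain ⟨v, hv, -⟩ := isPauliTrivialOn_iff.1 (h.pauli i)
  exact ⟨v, hv⟩

/-- A Pauli operator commuting with all generators maps `ψ` to a vector fixed by them, which is a
multiple of `ψ` by uniqueness. -/
lemma IsStabilizerState.mem_of_orthogonal (h : IsStabilizerState g ψ)
    {w : Fin (Fintype.card ι) → PauliVec ι} (hw : ∀ i, HasExponents (g i) (w i))
    {v : PauliVec ι} (hv : ∀ i, symp v (w i) = 0) : v ∈ stabilizerSpace ψ := by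
  refine h.unique _ fun i => ?_
  obtain ⟨k, hk⟩ := hw i
  have hcomm : (g i : Matrix (ι → Fin 2) (ι → Fin 2) ℂ) * pauliOp v =
      pauliOp v * (g i : Matrix (ι → Fin 2) (ι → Fin 2) ℂ) := by
    rw [hk, Matrix.mul_smul, Matrix.smul_mul, pauliOp_comm v, hv i, sgn_zero, one_smul]
  rw [Matrix.mulVec_mulVec, hcomm, ← Matrix.mulVec_mulVec, h.stabilizes]

/-- Two operators with the common eigenvector `ψ` and nonzero eigenvalues cannot anticommute.
Maximality is the uniqueness of `ψ`. -/
theorem IsStabilizerState.isLagrangian (h : IsStabilizerState g ψ) :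
    IsLagrangian (stabilizerSpace ψ) := by
  constructor
  · rintro v ⟨c, hc⟩ w ⟨d, hd⟩
    have hψ := h.ne_zero
    have hc1 := pauliOp_eigenvalue hψ hc
    have hd1 := pauliOp_eigenvalue hψ hd
    have h1 : (pauliOp v * pauliOp w) *ᵥ ψ = (d * c) • ψ := by
      rw [← Matrix.mulVec_mulVec, hd, Matrix.mulVec_smul, hc, smul_smul]
    have h2 : (pauliOp w * pauliOp v) *ᵥ ψ = (d * c) • ψ := by
      rw [← Matrix.mulVec_mulVec, hc, Matrix.mulVec_smul, hd, smul_smul, mul_comm]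
    rw [pauliOp_comm, Matrix.smul_mulVec, h2, smul_smul] at h1
    have h3 := smul_left_injective ℂ hψ h1
    have hcd : d * c ≠ 0 := by
      rcases hc1 with rfl | rfl <;> rcases hd1 with rfl | rfl <;> norm_num
    apply sgn_injective
    rw [sgn_zero]
    exact mul_right_cancel₀ hcd (by simpa using h3)
  · intro v hv
    choose w hw using h.exists_exponents
    exact h.mem_of_orthogonal hw fun i => hv _ ((hw i).mem_stabilizerSpace (h.stabilizes i))

theorem IsStabilizerState.stabilizerSpace_eq_span (h : IsStabilizerState g ψ)
    {w : Fin (Fintype.card ι) → PauliVec ι} (hw : ∀ i, HasExponents (g i) (w i)) :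
    stabilizerSpace ψ = Submodule.span (ZMod 2) (Set.range w) := by
  refine le_antisymm ?_ (Submodule.span_le.2 ?_)
  · rw [← LinearMap.BilinForm.orthogonal_orthogonal symp_nondegenerate symp_isRefl
      (Submodule.span (ZMod 2) (Set.range w))]
    intro v hv
    rw [mem_symp_orthogonal]
    intro u hu
    refine h.isLagrangian.isotropic v hv u (h.mem_of_orthogonal hw fun i => ?_)
    exact mem_symp_orthogonal.1 hu _ (Submodule.subset_span ⟨i, rfl⟩)
  · rintro _ ⟨i, rfl⟩
    exact (hw i).mem_stabilizerSpace (h.stabilizes i)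

theorem IsStabilizerState.exists_mem_space (h : IsStabilizerState g ψ) {u : QubitOp ι}
    (hu : u ∈ stabilizerGroup g) : ∃ v ∈ stabilizerSpace ψ, HasExponents u v := by
  suffices hv : ∃ v, HasExponents u v by
    obtain ⟨v, hv⟩ := hv
    exact ⟨v, hv.mem_stabilizerSpace (h.stabilizes_group hu), hv⟩
  induction hu using Subgroup.closure_induction with
  | mem x hx => obtain ⟨i, rfl⟩ := hx; exact h.exists_exponents i
  | one => exact ⟨0, .one⟩
  | mul x y _ _ hx hy =>
    obtain ⟨v, hv⟩ := hx
    obtain ⟨w, hw⟩ := hy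
    exact ⟨_, hv.mul hw⟩
  | inv x _ hx =>
    obtain ⟨v, hv⟩ := hx
    exact ⟨_, hv.inv⟩

theorem IsStabilizerState.exists_mem_group (h : IsStabilizerState g ψ) {v : PauliVec ι}
    (hv : v ∈ stabilizerSpace ψ) : ∃ u ∈ stabilizerGroup g, HasExponents u v := by
  choose w hw using h.exists_exponents
  rw [h.stabilizerSpace_eq_span hw] at hv
  induction hv using Submodule.span_induction with
  | mem x hx =>
    obtain ⟨i, rfl⟩ := hx
    exact ⟨g i, Subgroup.subset_closure ⟨i, rfl⟩, hw i⟩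
  | zero => exact ⟨1, one_mem _, .one⟩
  | add x y _ _ hx hy =>
    obtain ⟨u, hu, hux⟩ := hx
    obtain ⟨u', hu', huy⟩ := hy
    exact ⟨u * u', mul_mem hu hu', hux.mul huy⟩
  | smul c x _ hx =>
    rcases zmod_two_cases c with rfl | rfl
    · exact ⟨1, one_mem _, by rw [zero_smul]; exact .one⟩
    · rwa [one_smul]

/-- The phase is fixed by the condition to stabilize `ψ ≠ 0`. Together with the two preceding
theorems this identifies the stabilizer group with `stabilizerSpace ψ`. -/
theorem IsStabilizerState.eq_of_exponents (h : IsStabilizerState g ψ) {u u' : QubitOp ι}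
    (hu : u ∈ stabilizerGroup g) (hu' : u' ∈ stabilizerGroup g) {v : PauliVec ι}
    (hv : HasExponents u v) (hv' : HasExponents u' v) : u = u' := by
  have h1 := h.stabilizes_group hu
  have h2 := h.stabilizes_group hu'
  obtain ⟨k, hk⟩ := hv
  obtain ⟨l, hl⟩ := hv'
  rw [hk, Matrix.smul_mulVec] at h1
  rw [hl, Matrix.smul_mulVec] at h2
  have hne : pauliOp v *ᵥ ψ ≠ 0 := by
    intro h0
    rw [h0, smul_zero] at h1
    exact h.ne_zero h1.symm
  have h3 := smul_left_injective ℂ hne (h1.trans h2.symm)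
  apply Subtype.ext
  rw [hk, hl, h3]

theorem IsStabilizerState.finite_group (h : IsStabilizerState g ψ) :
    (stabilizerGroup g : Set (QubitOp ι)).Finite := by
  choose! f hf using fun u (hu : u ∈ stabilizerGroup g) => h.exists_mem_space hu
  refine Set.Finite.of_injOn (f := f) (t := Set.univ) (fun _ _ => Set.mem_univ _) ?_
    Set.finite_univ
  intro u hu u' hu' huu
  exact h.eq_of_exponents hu hu' (hf u hu).2 (by rw [huu]; exact (hf u' hu').2)

end State

end Operators

/-! ### The subgroups supported on two parties. -/

section Parties

variable {A B C : Type*} [Fintype A] [Fintype B] [Fintype C]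
  [DecidableEq A] [DecidableEq B] [DecidableEq C]

/-- The party of a qubit. -/
def party : A ⊕ B ⊕ C → Fin 3 := Sum.elim (fun _ => 0) (Sum.elim (fun _ => 1) fun _ => 2)

lemma part_eq_zero_iff {ι : Type*} [Fintype ι] [DecidableEq ι] {col : ι → Fin 3} {a : Fin 3} {v : PauliVec ι} :
    part col a v = 0 ↔ ∀ i, col i = a → v i = 0 := by
  rw [funext_iff]
  refine forall_congr' fun i => ?_
  rw [part_apply]
  by_cases h : col i = a <;> simp [h]

lemma isPauliTrivialOn_iff_part {ι : Type*} [Fintype ι] [DecidableEq ι] {col : ι → Fin 3}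
    {a : Fin 3} {S : Set ι} (hS : ∀ i, i ∈ S ↔ col i = a) {u : QubitOp ι} :
    IsPauliTrivialOn S u ↔ ∃ v, HasExponents u v ∧ part col a v = 0 := by
  rw [isPauliTrivialOn_iff]
  simp only [part_eq_zero_iff, hS]

lemma mem_groupAB {G : Subgroup (QubitOp (A ⊕ B ⊕ C))} {u : QubitOp (A ⊕ B ⊕ C)} :
    u ∈ groupAB G ↔ u ∈ G ∧ ∃ v, HasExponents u v ∧ part party 2 v = 0 := by
  rw [groupAB, Set.mem_ofPred_eq, isPauliTrivialOn_iff_part]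
  rintro (a | b | c) <;> simp [party]

lemma mem_groupBC {G : Subgroup (QubitOp (A ⊕ B ⊕ C))} {u : QubitOp (A ⊕ B ⊕ C)} :
    u ∈ groupBC G ↔ u ∈ G ∧ ∃ v, HasExponents u v ∧ part party 0 v = 0 := by
  rw [groupBC, Set.mem_ofPred_eq, isPauliTrivialOn_iff_part]
  rintro (a | b | c) <;> simp [party]

lemma mem_groupAC {G : Subgroup (QubitOp (A ⊕ B ⊕ C))} {u : QubitOp (A ⊕ B ⊕ C)} :
    u ∈ groupAC G ↔ u ∈ G ∧ ∃ v, HasExponents u v ∧ part party 1 v = 0 := by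
  rw [groupAC, Set.mem_ofPred_eq, isPauliTrivialOn_iff_part]
  rintro (a | b | c) <;> simp [party]

lemma groupProd_subset (G : Subgroup (QubitOp (A ⊕ B ⊕ C))) : groupProd G ⊆ G := by
  rintro _ ⟨_, ⟨f, hf, k, hk, rfl⟩, l, hl, rfl⟩
  exact mul_mem (mul_mem hf.1 hk.1) hl.1

variable {g : Fin (Fintype.card (A ⊕ B ⊕ C)) → QubitOp (A ⊕ B ⊕ C)}
  {Ψ : (A ⊕ B ⊕ C → Fin 2) → ℂ}

/-- Translates the product of subgroups into a sum of subspaces; `u a` corresponds to the factor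
acting trivially on the party `a`. -/
theorem IsStabilizerState.groupProd_eq_iff (h : IsStabilizerState g Ψ) :
    groupProd (stabilizerGroup g) = (stabilizerGroup g : Set (QubitOp (A ⊕ B ⊕ C))) ↔
      ∀ v ∈ stabilizerSpace Ψ, ∃ u : Fin 3 → PauliVec (A ⊕ B ⊕ C),
        (∀ a, u a ∈ stabilizerSpace Ψ ∧ part party a (u a) = 0) ∧ v = ∑ a, u a := by
  constructor
  · intro heq v hv
    obtain ⟨u, hu, huv⟩ := h.exists_mem_group hv
    rw [← SetLike.mem_coe, ← heq] at hu
    obtain ⟨_, ⟨f, hf, k, hk, rfl⟩, l, hl, rfl⟩ := hu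
    obtain ⟨hfG, w2, hf2, hw2⟩ := mem_groupAB.1 hf
    obtain ⟨hkG, w0, hk0, hw0⟩ := mem_groupBC.1 hk
    obtain ⟨hlG, w1, hl1, hw1⟩ := mem_groupAC.1 hl
    refine ⟨![w0, w1, w2], ?_, ?_⟩
    · intro a
      fin_cases a
      · exact ⟨hk0.mem_stabilizerSpace (h.stabilizes_group hkG), hw0⟩
      · exact ⟨hl1.mem_stabilizerSpace (h.stabilizes_group hlG), hw1⟩
      · exact ⟨hf2.mem_stabilizerSpace (h.stabilizes_group hfG), hw2⟩
    · rw [huv.unique ((hf2.mul hk0).mul hl1), Fin.sum_univ_three]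
      simp only [Matrix.cons_val_zero, Matrix.cons_val_one, Matrix.cons_val]
      abel
  · intro hsum
    refine Set.Subset.antisymm (groupProd_subset _) fun u hu => ?_
    obtain ⟨v, hv, huv⟩ := h.exists_mem_space hu
    obtain ⟨w, hw, rfl⟩ := hsum v hv
    choose k hkG hk using fun a => h.exists_mem_group (hw a).1
    have hprod : u = k 2 * k 0 * k 1 := by
      refine h.eq_of_exponents hu (mul_mem (mul_mem (hkG 2) (hkG 0)) (hkG 1)) huv ?_
      have := ((hk 2).mul (hk 0)).mul (hk 1)
      rw [Fin.sum_univ_three]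
      convert this using 1
      abel
    rw [hprod]
    exact Set.mul_mem_mul (Set.mul_mem_mul (mem_groupAB.2 ⟨hkG 2, _, hk 2, (hw 2).2⟩)
      (mem_groupBC.2 ⟨hkG 0, _, hk 0, (hw 0).2⟩)) (mem_groupAC.2 ⟨hkG 1, _, hk 1, (hw 1).2⟩)

theorem IsStabilizerState.card_le_iff (h : IsStabilizerState g Ψ) :
    Nat.card (stabilizerGroup g) ≤ Nat.card (groupProd (stabilizerGroup g)) ↔
      groupProd (stabilizerGroup g) = (stabilizerGroup g : Set (QubitOp (A ⊕ B ⊕ C))) := by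
  constructor
  · intro hle
    refine Set.eq_of_subset_of_ncard_le (groupProd_subset _) ?_ h.finite_group
    exact hle
  · intro heq
    rw [heq]
    exact le_rfl

end Parties

end

noncomputable section

/-! ### Simultaneous diagonalization of a symplectic family of operators -/

section Clifford

variable {K N : Type*} [Fintype K] [DecidableEq K] [Fintype N] [DecidableEq N]

/-- The homomorphism from the group with two elements given by an involution. -/
def involutionHom {M : Type*} [Monoid M] (u : M) (h : u * u = 1) : Multiplicative (ZMod 2) →* M where
  toFun c := if c.toAdd = 0 then 1 else u
  map_one' := by simp
  map_mul' := by
    have h2 : (1 + 1 : ZMod 2) = 0 := rfl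
    intro c d
    rw [toAdd_mul]
    rcases zmod_two_cases c.toAdd with hc | hc <;> rcases zmod_two_cases d.toAdd with hd | hd <;>
      simp [hc, hd, h, h2]

/-- Add one `Z l` at a time. The vector `v + Z l v` is fixed by `Z l`, unless it vanishes; then `Z
l` acts on `v` by `-1`, and `X l` repairs the sign without disturbing the other `Z k`. -/
lemma exists_common_fixed_vector [Nonempty N] {X Z : K → Matrix N N ℂ}
    (hX2 : ∀ k, X k * X k = 1) (hZ2 : ∀ k, Z k * Z k = 1)
    (hZZ : ∀ k l, Z k * Z l = Z l * Z k)
    (hZX : ∀ k l, Z k * X l = if k = l then -(X l * Z k) else X l * Z k) :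
    ∃ v : N → ℂ, v ≠ 0 ∧ ∀ k, Z k *ᵥ v = v := by
  suffices h : ∀ s : Finset K, ∃ v : N → ℂ, v ≠ 0 ∧ ∀ k ∈ s, Z k *ᵥ v = v by
    obtain ⟨v, hv, hk⟩ := h Finset.univ
    exact ⟨v, hv, fun k => hk k (Finset.mem_univ k)⟩
  intro s
  induction s using Finset.induction_on with
  | empty => exact ⟨fun _ => 1, fun h => one_ne_zero (congrFun h (Classical.arbitrary N)), by simp⟩
  | insert l s hl ih =>
    obtain ⟨v, hv, hs⟩ := ih
    by_cases h0 : v + Z l *ᵥ v = 0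
    · refine ⟨X l *ᵥ v, fun h => hv ?_, fun k hk => ?_⟩
      · rw [← Matrix.one_mulVec v, ← hX2 l, ← Matrix.mulVec_mulVec, h, Matrix.mulVec_zero]
      · rw [Matrix.mulVec_mulVec, hZX]
        rcases Finset.mem_insert.1 hk with rfl | hk
        · rw [if_pos rfl, Matrix.neg_mulVec, ← Matrix.mulVec_mulVec,
            ← neg_eq_of_add_eq_zero_right h0, Matrix.mulVec_neg, neg_neg]
        · have hne : k ≠ l := fun h => hl (h ▸ hk)
          rw [if_neg hne, ← Matrix.mulVec_mulVec, hs k hk]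
    · refine ⟨v + Z l *ᵥ v, h0, fun k hk => ?_⟩
      rw [Matrix.mulVec_add, Matrix.mulVec_mulVec]
      rcases Finset.mem_insert.1 hk with rfl | hk
      · rw [hZ2, Matrix.one_mulVec, add_comm]
      · rw [hZZ, ← Matrix.mulVec_mulVec, hs k hk]

/-- Operators satisfying the relations of the Pauli matrices of `K` qubits act as these matrices
in a suitable orthonormal family. -/
theorem exists_symplectic_eigenbasis [Nonempty N] {X Z : K → Matrix N N ℂ}
    (hXh : ∀ k, (X k)ᴴ = X k) (hZh : ∀ k, (Z k)ᴴ = Z k)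
    (hX2 : ∀ k, X k * X k = 1) (hZ2 : ∀ k, Z k * Z k = 1)
    (hXX : ∀ k l, X k * X l = X l * X k) (hZZ : ∀ k l, Z k * Z l = Z l * Z k)
    (hZX : ∀ k l, Z k * X l = if k = l then -(X l * Z k) else X l * Z k) :
    ∃ E : (K → ZMod 2) → N → ℂ, (∀ s s', star (E s) ⬝ᵥ E s' = if s = s' then 1 else 0) ∧
      (∀ k s, Z k *ᵥ E s = sgn (s k) • E s) ∧ ∀ k s, X k *ᵥ E s = E (s + Pi.single k 1) := by
  obtain ⟨v, hv, hZv⟩ := exists_common_fixed_vector hX2 hZ2 hZZ hZX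
  have hXu : ∀ k, X k ∈ Matrix.unitaryGroup N ℂ := by
    intro k
    rw [Matrix.mem_unitaryGroup_iff, Matrix.star_eq_conjTranspose, hXh, hX2]
  set U : K → Matrix.unitaryGroup N ℂ := fun k => ⟨X k, hXu k⟩ with hU
  have hU2 : ∀ k, U k * U k = 1 := fun k => Subtype.ext (hX2 k)
  have hcomm : Pairwise fun i j => ∀ x y, Commute (involutionHom (U i) (hU2 i) x)
      (involutionHom (U j) (hU2 j) y) := by
    intro i j _ x y
    have hij : Commute (U i) (U j) := Subtype.ext (hXX i j)
    simp only [involutionHom, MonoidHom.coe_mk, OneHom.coe_mk]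
    split_ifs <;> simp [hij]
  -- The commuting involutions `X k` form a representation of `(ℤ/2)^K`; applied to a normalized
  -- common fixed vector of the `Z k`, it produces the whole family.
  set R : (K → Multiplicative (ZMod 2)) →* Matrix.unitaryGroup N ℂ :=
    MonoidHom.noncommPiCoprod (fun k => involutionHom (U k) (hU2 k)) hcomm with hR
  have hRs : ∀ k, R (Pi.mulSingle k (Multiplicative.ofAdd 1)) = U k := by
    intro k
    rw [hR, MonoidHom.noncommPiCoprod_mulSingle]
    simp [involutionHom]
  set r : (K → ZMod 2) → Matrix N N ℂ := fun s => (R fun k => Multiplicative.ofAdd (s k)).1 with hr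
  have hr0 : r 0 = 1 := by
    have : (fun k : K => Multiplicative.ofAdd ((0 : K → ZMod 2) k)) = 1 := rfl
    simp only [hr, this, map_one]
    rfl
  have hradd : ∀ s s', r (s + s') = r s * r s' := by
    intro s s'
    have : (fun k : K => Multiplicative.ofAdd ((s + s') k)) =
      (fun k => Multiplicative.ofAdd (s k)) * fun k => Multiplicative.ofAdd (s' k) := rfl
    simp only [hr, this, map_mul]
    rfl
  have hrsingle : ∀ k, r (Pi.single k 1) = X k := by
    intro k
    have : (fun l : K => Multiplicative.ofAdd ((Pi.single k 1 : K → ZMod 2) l)) =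
        Pi.mulSingle k (Multiplicative.ofAdd 1) := by
      funext l
      by_cases h : l = k
      · subst h; simp
      · simp [h]
    simp only [hr, this, hRs]
    rfl
  have hrU : ∀ s, (r s)ᴴ * r s = 1 := by
    intro s
    exact Matrix.mem_unitaryGroup_iff'.1 (R fun k => Multiplicative.ofAdd (s k)).2
  have hZr : ∀ s k, Z k * r s = sgn (s k) • (r s * Z k) := by
    intro s
    rw [← Finset.univ_sum_single s]
    refine Finset.sum_induction _ (fun s => ∀ k, Z k * r s = sgn (s k) • (r s * Z k)) ?_ ?_ ?_
    · intro s s' hs hs' k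
      rw [hradd, ← mul_assoc, hs, Matrix.smul_mul, mul_assoc, hs', Matrix.mul_smul, smul_smul,
        Pi.add_apply, sgn_add, mul_assoc]
    · intro k
      simp [hr0, sgn_zero]
    · intro l _ k
      rcases zmod_two_cases (s l) with h | h
      · simp [h, hr0, sgn_zero]
      · rw [h, hrsingle, hZX]
        by_cases hkl : k = l
        · subst hkl
          simp [sgn_one]
        · simp [hkl, sgn_zero]
  have hpos : 0 < (star v ⬝ᵥ v).re := by
    have h1 : (star v ⬝ᵥ v).re = ∑ i, ‖v i‖ ^ 2 := by
      simp only [dotProduct, Pi.star_apply, Complex.re_sum]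
      refine Finset.sum_congr rfl fun i _ => ?_
      rw [Complex.star_def, ← Complex.normSq_eq_conj_mul_self, Complex.ofReal_re,
        Complex.normSq_eq_norm_sq]
    obtain ⟨i, hi⟩ := Function.ne_iff.1 hv
    rw [h1]
    refine Finset.sum_pos' (fun _ _ => by positivity) ⟨i, Finset.mem_univ i, ?_⟩
    have : 0 < ‖v i‖ := norm_pos_iff.2 hi
    positivity
  have hreal : star v ⬝ᵥ v = ((star v ⬝ᵥ v).re : ℂ) := by
    refine (Complex.conj_eq_iff_re.1 ?_).symm
    exact (Matrix.star_dotProduct v v).symm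
  set c : ℝ := (Real.sqrt (star v ⬝ᵥ v).re)⁻¹ with hc
  set w : N → ℂ := (c : ℂ) • v with hw
  have hw1 : star w ⬝ᵥ w = 1 := by
    rw [hw, star_smul, smul_dotProduct, dotProduct_smul, hreal, smul_eq_mul, smul_eq_mul,
      Complex.star_def, Complex.conj_ofReal, ← Complex.ofReal_mul, ← Complex.ofReal_mul, hc]
    have h1 := Real.mul_self_sqrt hpos.le
    have h2 : Real.sqrt (star v ⬝ᵥ v).re ≠ 0 := (Real.sqrt_pos.2 hpos).ne'
    rw [← Complex.ofReal_one]
    congr 1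
    field_simp
    nlinarith
  have hZw : ∀ k, Z k *ᵥ w = w := fun k => by rw [hw, Matrix.mulVec_smul, hZv]
  refine ⟨fun s => r s *ᵥ w, ?_, ?_, ?_⟩
  · intro s s'
    split_ifs with hss
    · subst hss
      rw [Matrix.star_mulVec, ← Matrix.dotProduct_mulVec, Matrix.mulVec_mulVec, hrU,
        Matrix.one_mulVec, hw1]
    · obtain ⟨k, hk⟩ := Function.ne_iff.1 hss
      have hZe : ∀ s, Z k *ᵥ (r s *ᵥ w) = sgn (s k) • (r s *ᵥ w) := by
        intro s
        rw [Matrix.mulVec_mulVec, hZr, Matrix.smul_mulVec, ← Matrix.mulVec_mulVec, hZw]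
      have h1 : star (Z k *ᵥ (r s *ᵥ w)) ⬝ᵥ (Z k *ᵥ (r s' *ᵥ w)) =
          star (r s *ᵥ w) ⬝ᵥ (r s' *ᵥ w) := by
        rw [Matrix.star_mulVec, ← Matrix.dotProduct_mulVec, Matrix.mulVec_mulVec, hZh, hZ2,
          Matrix.one_mulVec]
      rw [hZe, hZe, star_smul, smul_dotProduct, dotProduct_smul, smul_smul] at h1
      have h2 : star (sgn (s k)) * sgn (s' k) = -1 := by
        rcases zmod_two_cases (s k) with h | h <;> rcases zmod_two_cases (s' k) with h' | h'
        · exact absurd (h.trans h'.symm) hk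
        · simp [h, h', sgn_zero, sgn_one]
        · simp [h, h', sgn_zero, sgn_one]
        · exact absurd (h.trans h'.symm) hk
      rw [h2, smul_eq_mul, neg_one_mul] at h1
      exact self_eq_neg.1 h1.symm
  · intro k s
    rw [Matrix.mulVec_mulVec, hZr, Matrix.smul_mulVec, ← Matrix.mulVec_mulVec, hZw]
  · intro k s
    simp only [add_comm s, hradd, hrsingle, Matrix.mulVec_mulVec]

/-- The sign `(-1) ^ b` of a bit. -/
def bitSign (b : Fin 2) : ℂ := if b = 0 then 1 else -1

/-- With as many pairs as qubits, the orthonormal family has `2 ^ |K|` members and is a basis. The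
rows of `U` are its conjugates, so after `U` the `Z k` read a bit and the `X k` flip it. -/
theorem exists_diagonalizing_unitary {X Z : K → Matrix (K → Fin 2) (K → Fin 2) ℂ}
    (hXh : ∀ k, (X k)ᴴ = X k) (hZh : ∀ k, (Z k)ᴴ = Z k)
    (hX2 : ∀ k, X k * X k = 1) (hZ2 : ∀ k, Z k * Z k = 1)
    (hXX : ∀ k l, X k * X l = X l * X k) (hZZ : ∀ k l, Z k * Z l = Z l * Z k)
    (hZX : ∀ k l, Z k * X l = if k = l then -(X l * Z k) else X l * Z k) :
    ∃ U : Matrix.unitaryGroup (K → Fin 2) ℂ,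
      (∀ k y x, (U.1 * Z k) y x = bitSign (y k) * U.1 y x) ∧
      ∀ k y x, (U.1 * X k) y x = U.1 (y + Pi.single k 1) x := by
  obtain ⟨E₀, hE₀, hZE₀, hXE₀⟩ := exists_symplectic_eigenbasis hXh hZh hX2 hZ2 hXX hZZ hZX
  set bits : (K → Fin 2) → (K → ZMod 2) := fun y k => if y k = 0 then 0 else 1 with hbits
  have hbit : ∀ b b' : Fin 2, (if b = 0 then (0 : ZMod 2) else 1) = (if b' = 0 then 0 else 1) →
      b = b' := by decide
  have hbit1 : ∀ b : Fin 2, (if b + 1 = 0 then (0 : ZMod 2) else 1) =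
      (if b = 0 then 0 else 1) + 1 := by decide
  have hinj : Function.Injective bits := fun y y' h => funext fun k => hbit _ _ (congrFun h k)
  set E : (K → Fin 2) → (K → Fin 2) → ℂ := fun y => E₀ (bits y) with hEdef
  have hE : ∀ y y', star (E y) ⬝ᵥ E y' = if y = y' then 1 else 0 := by
    intro y y'
    simp only [hEdef, hE₀, hinj.eq_iff]
  have hZE : ∀ k y, Z k *ᵥ E y = bitSign (y k) • E y := by
    intro k y
    simp only [hEdef, hZE₀, hbits, bitSign]
    split_ifs <;> simp [sgn_zero, sgn_one]
  have hXE : ∀ (k : K) (y : K → Fin 2), X k *ᵥ E y = E (y + Pi.single k 1) := by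
    intro k y
    simp only [hEdef, hXE₀]
    congr 1
    funext l
    by_cases h : l = k
    · subst h
      simp only [hbits, Pi.add_apply, Pi.single_eq_same, hbit1]
    · simp only [hbits, Pi.add_apply, Pi.single_eq_of_ne h, add_zero]
  set U : Matrix (K → Fin 2) (K → Fin 2) ℂ := Matrix.of fun y x => star (E y x) with hU
  have hUm : U ∈ Matrix.unitaryGroup (K → Fin 2) ℂ := by
    rw [Matrix.mem_unitaryGroup_iff]
    ext y y'
    have := hE y y'
    simp only [Matrix.mul_apply, Matrix.star_apply, hU, Matrix.of_apply, star_star]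
    exact this
  have hmul : ∀ (M : Matrix (K → Fin 2) (K → Fin 2) ℂ), Mᴴ = M → ∀ y x,
      (U * M) y x = star ((M *ᵥ E y) x) := by
    intro M hM y x
    simp only [Matrix.mul_apply, hU, Matrix.of_apply, Matrix.mulVec, dotProduct, star_sum, star_mul']
    refine Finset.sum_congr rfl fun z _ => ?_
    rw [← Matrix.conjTranspose_apply, hM, mul_comm]
  refine ⟨⟨U, hUm⟩, fun k y x => ?_, fun k y x => ?_⟩
  · change (U * Z k) y x = _ * U y x
    rw [hmul _ (hZh k), hZE]
    have : star (bitSign (y k)) = bitSign (y k) := by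
      rw [bitSign]
      split_ifs <;> simp
    rw [Pi.smul_apply, smul_eq_mul, star_mul', this]
    rfl
  · change (U * X k) y x = U _ x
    rw [hmul _ (hXh k), hXE]
    rfl

end Clifford

/-! ### Local operators -/

section Local

variable {α β γ α' β' γ' α'' β'' γ'' : Type*}

/-- The action of an operator on the first party. -/
def actA [Fintype α] (M : Matrix α' α ℂ) (ψ : α → β → γ → ℂ) : α' → β → γ → ℂ :=
  fun a b c => ∑ x, M a x * ψ x b c

/-- The action of an operator on the second party. -/
def actB [Fintype β] (M : Matrix β' β ℂ) (ψ : α → β → γ → ℂ) : α → β' → γ → ℂ :=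
  fun a b c => ∑ x, M b x * ψ a x c

/-- The action of an operator on the third party. -/
def actC [Fintype γ] (M : Matrix γ' γ ℂ) (ψ : α → β → γ → ℂ) : α → β → γ' → ℂ :=
  fun a b c => ∑ x, M c x * ψ a b x

lemma actA_actA [Fintype α] [Fintype α'] (M : Matrix α'' α' ℂ) (N : Matrix α' α ℂ) (ψ : α → β → γ → ℂ) :
    actA M (actA N ψ) = actA (M * N) ψ := by
  funext a b c
  simp only [actA, Matrix.mul_apply, Finset.mul_sum, Finset.sum_mul, mul_assoc]
  exact Finset.sum_comm

lemma actB_actB [Fintype β] [Fintype β'] (M : Matrix β'' β' ℂ) (N : Matrix β' β ℂ) (ψ : α → β → γ → ℂ) :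
    actB M (actB N ψ) = actB (M * N) ψ := by
  funext a b c
  simp only [actB, Matrix.mul_apply, Finset.mul_sum, Finset.sum_mul, mul_assoc]
  exact Finset.sum_comm

lemma actC_actC [Fintype γ] [Fintype γ'] (M : Matrix γ'' γ' ℂ) (N : Matrix γ' γ ℂ) (ψ : α → β → γ → ℂ) :
    actC M (actC N ψ) = actC (M * N) ψ := by
  funext a b c
  simp only [actC, Matrix.mul_apply, Finset.mul_sum, Finset.sum_mul, mul_assoc]
  exact Finset.sum_comm

lemma actA_actB [Fintype α] [Fintype β] (M : Matrix α' α ℂ) (N : Matrix β' β ℂ) (ψ : α → β → γ → ℂ) :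
    actA M (actB N ψ) = actB N (actA M ψ) := by
  funext a b c
  simp only [actA, actB, Finset.mul_sum]
  rw [Finset.sum_comm]
  simp only [mul_left_comm]

lemma actA_actC [Fintype α] [Fintype γ] (M : Matrix α' α ℂ) (N : Matrix γ' γ ℂ) (ψ : α → β → γ → ℂ) :
    actA M (actC N ψ) = actC N (actA M ψ) := by
  funext a b c
  simp only [actA, actC, Finset.mul_sum]
  rw [Finset.sum_comm]
  simp only [mul_left_comm]

lemma actB_actC [Fintype β] [Fintype γ] (M : Matrix β' β ℂ) (N : Matrix γ' γ ℂ) (ψ : α → β → γ → ℂ) :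
    actB M (actC N ψ) = actC N (actB M ψ) := by
  funext a b c
  simp only [actB, actC, Finset.mul_sum]
  rw [Finset.sum_comm]
  simp only [mul_left_comm]

lemma actA_one [Fintype α] [DecidableEq α] (ψ : α → β → γ → ℂ) : actA 1 ψ = ψ := by
  funext a b c
  simp [actA, Matrix.one_apply]

lemma actB_one [Fintype β] [DecidableEq β] (ψ : α → β → γ → ℂ) : actB 1 ψ = ψ := by
  funext a b c
  simp [actB, Matrix.one_apply]

lemma actC_one [Fintype γ] [DecidableEq γ] (ψ : α → β → γ → ℂ) : actC 1 ψ = ψ := by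
  funext a b c
  simp [actC, Matrix.one_apply]

lemma actA_smul [Fintype α] (d : ℂ) (M : Matrix α' α ℂ) (ψ : α → β → γ → ℂ) :
    actA (d • M) ψ = d • actA M ψ := by
  funext a b c
  simp [actA, Finset.mul_sum, mul_assoc]

lemma actB_smul [Fintype β] (d : ℂ) (M : Matrix β' β ℂ) (ψ : α → β → γ → ℂ) :
    actB (d • M) ψ = d • actB M ψ := by
  funext a b c
  simp [actB, Finset.mul_sum, mul_assoc]

lemma actC_smul [Fintype γ] (d : ℂ) (M : Matrix γ' γ ℂ) (ψ : α → β → γ → ℂ) :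
    actC (d • M) ψ = d • actC M ψ := by
  funext a b c
  simp [actC, Finset.mul_sum, mul_assoc]

/-- Operators of different parties commute, so local operators compose party by party. -/
lemma act_act_mul [Fintype α] [Fintype β] [Fintype γ] [Fintype α'] [Fintype β'] [Fintype γ']
    (U : Matrix α'' α' ℂ) (V : Matrix β'' β' ℂ) (W : Matrix γ'' γ' ℂ)
    (X : Matrix α' α ℂ) (Y : Matrix β' β ℂ) (Z : Matrix γ' γ ℂ) (ψ : α → β → γ → ℂ) :
    actA U (actB V (actC W (actA X (actB Y (actC Z ψ))))) =
      actA (U * X) (actB (V * Y) (actC (W * Z) ψ)) := by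
  rw [← actA_actA, ← actB_actB, ← actC_actC, actA_actB X V, actB_actC Y W, actA_actC X W]

lemma localUnitaryEquiv_iff [Fintype α] [Fintype β] [Fintype γ] [DecidableEq α] [DecidableEq β] [DecidableEq γ]
    {ψ φ : α → β → γ → ℂ} : LocalUnitaryEquiv ψ φ ↔
      ∃ (U : Matrix.unitaryGroup α ℂ) (V : Matrix.unitaryGroup β ℂ) (W : Matrix.unitaryGroup γ ℂ),
        φ = actA U.1 (actB V.1 (actC W.1 ψ)) := by
  refine exists_congr fun U => exists_congr fun V => exists_congr fun W => ?_
  simp only [funext_iff, actA, actB, actC, Finset.mul_sum, mul_assoc]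

end Local

end

noncomputable section

/-! ### The canonical form of a tripartite stabilizer state -/

section Canonical

set_option linter.unusedSectionVars false
set_option linter.unusedDecidableInType false
set_option linter.unusedFintypeInType false

variable {A B C : Type*} [Fintype A] [Fintype B] [Fintype C]
  [DecidableEq A] [DecidableEq B] [DecidableEq C]

lemma components_pauliOp_mulVec (v : PauliVec (A ⊕ B ⊕ C)) (Φ : (A ⊕ B ⊕ C → Fin 2) → ℂ) :
    components (pauliOp v *ᵥ Φ) = actA (pauliOp fun a => v (.inl a))
      (actB (pauliOp fun b => v (.inr (.inl b)))
        (actC (pauliOp fun c => v (.inr (.inr c))) (components Φ))) := by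
  funext a b c
  simp only [components, Matrix.mulVec, dotProduct, actA, actB, actC]
  rw [← (Equiv.sumArrowEquivProdArrow A (B ⊕ C) (Fin 2)).symm.sum_comp, Fintype.sum_prod_type]
  refine Finset.sum_congr rfl fun a' _ => ?_
  rw [← (Equiv.sumArrowEquivProdArrow B C (Fin 2)).symm.sum_comp, Fintype.sum_prod_type,
    Finset.mul_sum]
  refine Finset.sum_congr rfl fun b' _ => ?_
  rw [Finset.mul_sum, Finset.mul_sum]
  refine Finset.sum_congr rfl fun c' _ => ?_
  simp only [pauliOp, pauliString, Matrix.of_apply, Fintype.prod_sum_type,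
    Equiv.sumArrowEquivProdArrow, Equiv.coe_fn_symm_mk, Sum.elim_inl, Sum.elim_inr, mul_assoc]

lemma components_smul (d : ℂ) (Φ : (A ⊕ B ⊕ C → Fin 2) → ℂ) :
    components (d • Φ) = d • components Φ := rfl

lemma components_part_zero (d : ℂ) (v : PauliVec (A ⊕ B ⊕ C)) (Φ : (A ⊕ B ⊕ C → Fin 2) → ℂ) :
    components ((d • pauliOp (part party 0 v)) *ᵥ Φ) =
      actA (d • pauliOp fun a => v (.inl a)) (components Φ) := by
  have h1 : (fun a : A => part party 0 v (.inl a)) = fun a => v (.inl a) := by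
    funext a; simp [part_apply, party]
  have h2 : (fun b : B => part party 0 v (.inr (.inl b))) = 0 := by
    funext b; simp [part_apply, party]
  have h3 : (fun c : C => part party 0 v (.inr (.inr c))) = 0 := by
    funext c; simp [part_apply, party]
  rw [Matrix.smul_mulVec, components_smul, components_pauliOp_mulVec, h1, h2, h3, pauliOp_zero,
    pauliOp_zero, actB_one, actC_one, actA_smul]

lemma components_part_one (d : ℂ) (v : PauliVec (A ⊕ B ⊕ C)) (Φ : (A ⊕ B ⊕ C → Fin 2) → ℂ) :
    components ((d • pauliOp (part party 1 v)) *ᵥ Φ) =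
      actB (d • pauliOp fun b => v (.inr (.inl b))) (components Φ) := by
  have h1 : (fun a : A => part party 1 v (.inl a)) = 0 := by
    funext a; simp [part_apply, party]
  have h2 : (fun b : B => part party 1 v (.inr (.inl b))) = fun b => v (.inr (.inl b)) := by
    funext b; simp [part_apply, party]
  have h3 : (fun c : C => part party 1 v (.inr (.inr c))) = 0 := by
    funext c; simp [part_apply, party]
  rw [Matrix.smul_mulVec, components_smul, components_pauliOp_mulVec, h1, h2, h3, pauliOp_zero,
    pauliOp_zero, actA_one, actC_one, actB_smul]

lemma components_part_two (d : ℂ) (v : PauliVec (A ⊕ B ⊕ C)) (Φ : (A ⊕ B ⊕ C → Fin 2) → ℂ) :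
    components ((d • pauliOp (part party 2 v)) *ᵥ Φ) =
      actC (d • pauliOp fun c => v (.inr (.inr c))) (components Φ) := by
  have h1 : (fun a : A => part party 2 v (.inl a)) = 0 := by
    funext a; simp [part_apply, party]
  have h2 : (fun b : B => part party 2 v (.inr (.inl b))) = 0 := by
    funext b; simp [part_apply, party]
  have h3 : (fun c : C => part party 2 v (.inr (.inr c))) = fun c => v (.inr (.inr c)) := by
    funext c; simp [part_apply, party]
  rw [Matrix.smul_mulVec, components_smul, components_pauliOp_mulVec, h1, h2, h3, pauliOp_zero,
    pauliOp_zero, actA_one, actB_one, actC_smul]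

/-- The components of the state `∑ₛ |s ⋯ s⟩` of one qubit for each party in `κ`; the indices of
the other parties are `0`. -/
def blockTensor (κ : Finset (Fin 3)) (i j k : Fin 2) : ℤ :=
  if (0 ∉ κ → i = 0) ∧ (1 ∉ κ → j = 0) ∧ (2 ∉ κ → k = 0) ∧ (0 ∈ κ → 1 ∈ κ → i = j) ∧
    (0 ∈ κ → 2 ∈ κ → i = k) ∧ (1 ∈ κ → 2 ∈ κ → j = k) then 1 else 0

/-- The bits of a party's qubits, as a function of the block; `0` at blocks without the party. -/
def extendBits {K T : Type*} {κ : T → Finset (Fin 3)} {a : Fin 3} (e : K ≃ {t // a ∈ κ t})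
    (y : K → Fin 2) (t : T) : Fin 2 :=
  if h : a ∈ κ t then y (e.symm ⟨t, h⟩) else 0

lemma extendBits_apply {K T : Type*} {κ : T → Finset (Fin 3)} {a : Fin 3}
    (e : K ≃ {t // a ∈ κ t}) (y : K → Fin 2) (k : K) : extendBits e y (e k) = y k := by
  simp [extendBits, (e k).2]

/-- The signs `±1`. -/
def IsSign (c : ℂ) : Prop := c = 1 ∨ c = -1

lemma IsSign.mul_self {c : ℂ} (h : IsSign c) : c * c = 1 := by
  rcases h with rfl | rfl <;> norm_num

lemma IsSign.star_eq {c : ℂ} (h : IsSign c) : star c = c := by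
  rcases h with rfl | rfl <;> simp

/-- The unitary that brings the operators of one party to standard form. -/
lemma IsBlockSystem.exists_party_unitary {ι K : Type*} [Fintype ι] [DecidableEq ι] [Fintype K]
    [DecidableEq K] {T : Type} [Fintype T] [DecidableEq T] {col : ι → Fin 3}
    {G : Submodule (ZMod 2) (PauliVec ι)} {κ : T → Finset (Fin 3)} {x z : T → PauliVec ι}
    (hS : IsBlockSystem col G κ x z) {a : Fin 3} (e : K ≃ {t // a ∈ κ t}) {j : K → ι}
    (hj : ∀ v w : PauliVec ι, symp (fun k => v (j k)) (fun k => w (j k)) = symp (part col a v) w)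
    (hj0 : ∀ v : PauliVec ι, part col a v = 0 → (fun k => v (j k)) = 0)
    {ξ μ : T → ℂ} (hξ : ∀ t, IsSign (ξ t)) (hμ : ∀ t, IsSign (μ t))
    (hξ0 : ∀ t, a ∉ κ t → ξ t = 1) :
    ∃ U : Matrix.unitaryGroup (K → Fin 2) ℂ,
      (∀ k y w, (U.1 * (μ (e k) • pauliOp fun k' => z (e k) (j k'))) y w =
        bitSign (y k) * U.1 y w) ∧
      ∀ t y w, (U.1 * (ξ t • pauliOp fun k' => x t (j k'))) y w =
        U.1 (y + fun k => if (e k : T) = t then 1 else 0) w := by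
  have hh : ∀ (c : ℂ) (v : PauliVec K), IsSign c → (c • pauliOp v)ᴴ = c • pauliOp v := by
    intro c v hc
    rw [Matrix.conjTranspose_smul, pauliOp_conjTranspose, hc.star_eq]
  have h2 : ∀ (c : ℂ) (v : PauliVec K), IsSign c → (c • pauliOp v) * (c • pauliOp v) = 1 := by
    intro c v hc
    rw [Matrix.smul_mul, Matrix.mul_smul, pauliOp_mul_self, smul_smul, hc.mul_self, one_smul]
  have hcomm : ∀ (c d : ℂ) (v w : PauliVec K), (c • pauliOp v) * (d • pauliOp w) =
      sgn (symp v w) • ((d • pauliOp w) * (c • pauliOp v)) := by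
    intro c d v w
    simp only [Matrix.smul_mul, Matrix.mul_smul, smul_smul]
    rw [pauliOp_comm v w, smul_smul]
    congr 1
    ring
  obtain ⟨U, hUZ, hUX⟩ := exists_diagonalizing_unitary
    (X := fun k => ξ (e k) • pauliOp fun k' => x (e k) (j k'))
    (Z := fun k => μ (e k) • pauliOp fun k' => z (e k) (j k'))
    (fun k => hh _ _ (hξ _)) (fun k => hh _ _ (hμ _)) (fun k => h2 _ _ (hξ _))
    (fun k => h2 _ _ (hμ _))
    (fun k l => by rw [hcomm, hj, hS.xx, sgn_zero, one_smul])
    (fun k l => by rw [hcomm, hj, hS.zz, sgn_zero, one_smul])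
    (fun k l => by
      rw [hcomm, hj, hS.zx]
      by_cases hkl : k = l
      · subst hkl
        simp [(e k).2, sgn_one]
      · have : (e k : T) ≠ e l := fun h => hkl (e.injective (Subtype.ext h))
        simp [hkl, this, sgn_zero])
  refine ⟨U, hUZ, fun t y w => ?_⟩
  by_cases ht : a ∈ κ t
  · obtain ⟨k, hk⟩ := e.surjective ⟨t, ht⟩
    have hkt : (e k : T) = t := by rw [hk]
    have := hUX k y w
    simp only [hkt] at this
    have hsingle : (Pi.single k 1 : K → Fin 2) = fun k => if (e k : T) = t then 1 else 0 := by
      funext l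
      by_cases hl : l = k
      · subst hl; simp [hkt]
      · have : (e l : T) ≠ t := fun h => hl (e.injective (Subtype.ext (h.trans hkt.symm)))
        simp [hl, this]
    rw [this, hsingle]
  -- A block without the party: its operator here is the identity with sign 1, and no bit is
  -- flipped.
  · have h1 : (fun k : K => if (e k : T) = t then (1 : Fin 2) else 0) = 0 := by
      funext k
      have : (e k : T) ≠ t := fun h => ht (h ▸ (e k).2)
      simp [this]
    rw [h1, add_zero, hξ0 t ht, hj0 _ (hS.part_x t a ht), pauliOp_zero, one_smul, mul_one]

/-- The bits of the qubits of a party, given by the bits of the blocks. -/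
def restrictBits {K T : Type*} {κ : T → Finset (Fin 3)} {a : Fin 3} (e : K ≃ {t // a ∈ κ t})
    (s : T → Fin 2) (k : K) : Fin 2 := s (e k)

/-- The `Z`-relations kill every component whose bits disagree within a block. The `X`-relations
make `φ` invariant under flipping all bits of a block. Hence the support is contained in the orbit
of `0`, on which `φ` is constant. -/
lemma eq_prod_blockTensor {T : Type} [Fintype T] [DecidableEq T] {κ : T → Finset (Fin 3)}
    (eA : A ≃ {t // 0 ∈ κ t}) (eB : B ≃ {t // 1 ∈ κ t}) (eC : C ≃ {t // 2 ∈ κ t})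
    {φ : (A → Fin 2) → (B → Fin 2) → (C → Fin 2) → ℂ}
    (hX : ∀ t y y' y'', φ (y + fun k => if (eA k : T) = t then 1 else 0)
      (y' + fun k => if (eB k : T) = t then 1 else 0)
      (y'' + fun k => if (eC k : T) = t then 1 else 0) = φ y y' y'')
    (hAB : ∀ a b, (eA a : T) = eB b → ∀ y y' y'', y a ≠ y' b → φ y y' y'' = 0)
    (hAC : ∀ a c, (eA a : T) = eC c → ∀ y y' y'', y a ≠ y'' c → φ y y' y'' = 0)
    (hBC : ∀ b c, (eB b : T) = eC c → ∀ y y' y'', y' b ≠ y'' c → φ y y' y'' = 0)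
    (y : A → Fin 2) (y' : B → Fin 2) (y'' : C → Fin 2) :
    φ y y' y'' = φ 0 0 0 *
      ∏ t, (blockTensor (κ t) (extendBits eA y t) (extendBits eB y' t) (extendBits eC y'' t) : ℂ) := by
  have htrans : ∀ (s : T → Fin 2) y y' y'', φ (y + restrictBits eA s) (y' + restrictBits eB s)
      (y'' + restrictBits eC s) = φ y y' y'' := by
    intro s
    rw [← Finset.univ_sum_single s]
    refine Finset.sum_induction _ (fun s => ∀ y y' y'', φ (y + restrictBits eA s)
      (y' + restrictBits eB s) (y'' + restrictBits eC s) = φ y y' y'') ?_ ?_ ?_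
    · intro s s' hs hs' y y' y''
      have hA : y + restrictBits eA (s + s') = (y + restrictBits eA s) + restrictBits eA s' := by
        rw [add_assoc]; rfl
      have hB : y' + restrictBits eB (s + s') = (y' + restrictBits eB s) + restrictBits eB s' := by
        rw [add_assoc]; rfl
      have hC : y'' + restrictBits eC (s + s') = (y'' + restrictBits eC s) + restrictBits eC s' := by
        rw [add_assoc]; rfl
      rw [hA, hB, hC, hs', hs]
    · intro y y' y''
      have hA : y + restrictBits eA (0 : T → Fin 2) = y := add_zero y
      have hB : y' + restrictBits eB (0 : T → Fin 2) = y' := add_zero y'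
      have hC : y'' + restrictBits eC (0 : T → Fin 2) = y'' := add_zero y''
      rw [hA, hB, hC]
    · intro t _ y y' y''
      have h01 : ∀ b : Fin 2, b = 0 ∨ b = 1 := by decide
      rcases h01 (s t) with h | h
      · rw [h, Pi.single_zero]
        have hA : y + restrictBits eA (0 : T → Fin 2) = y := add_zero y
        have hB : y' + restrictBits eB (0 : T → Fin 2) = y' := add_zero y'
        have hC : y'' + restrictBits eC (0 : T → Fin 2) = y'' := add_zero y''
        rw [hA, hB, hC]
      · rw [h, ← hX t y y' y'']
        have hA : restrictBits eA (Pi.single t 1) = fun k => if (eA k : T) = t then 1 else 0 := by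
          funext k; simp [restrictBits, Pi.single_apply]
        have hB : restrictBits eB (Pi.single t 1) = fun k => if (eB k : T) = t then 1 else 0 := by
          funext k; simp [restrictBits, Pi.single_apply]
        have hC : restrictBits eC (Pi.single t 1) = fun k => if (eC k : T) = t then 1 else 0 := by
          funext k; simp [restrictBits, Pi.single_apply]
        rw [hA, hB, hC]
  by_cases hall : ∀ t, (0 ∈ κ t → 1 ∈ κ t → extendBits eA y t = extendBits eB y' t) ∧
      (0 ∈ κ t → 2 ∈ κ t → extendBits eA y t = extendBits eC y'' t) ∧
      (1 ∈ κ t → 2 ∈ κ t → extendBits eB y' t = extendBits eC y'' t)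
  · rw [Finset.prod_eq_one, mul_one]
    -- The common bit of each block, read off from some party in it; flipping by `s` carries `0` to
    -- the given bits.
    · set s : T → Fin 2 := fun t => if 0 ∈ κ t then extendBits eA y t else
        if 1 ∈ κ t then extendBits eB y' t else extendBits eC y'' t with hs
      have hA : restrictBits eA s = y := by
        funext a
        simp only [restrictBits, hs]
        rw [if_pos (eA a).2, extendBits_apply]
      have hB : restrictBits eB s = y' := by
        funext b
        simp only [restrictBits, hs]
        split_ifs with h0 h1
        · rw [(hall _).1 h0 (eB b).2, extendBits_apply]
        · rw [extendBits_apply]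
        · exact absurd (eB b).2 h1
      have hC : restrictBits eC s = y'' := by
        funext c
        simp only [restrictBits, hs]
        split_ifs with h0 h1
        · rw [(hall _).2.1 h0 (eC c).2, extendBits_apply]
        · rw [(hall _).2.2 h1 (eC c).2, extendBits_apply]
        · rw [extendBits_apply]
      have := htrans s 0 0 0
      rw [hA, hB, hC, zero_add, zero_add, zero_add] at this
      exact this
    · intro t _
      rw [blockTensor, if_pos, Int.cast_one]
      refine ⟨fun h => ?_, fun h => ?_, fun h => ?_, (hall t).1, (hall t).2.1, (hall t).2.2⟩ <;>
        simp [extendBits, h]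
  · push Not at hall
    obtain ⟨t, ht⟩ := hall
    have hprod : (blockTensor (κ t) (extendBits eA y t) (extendBits eB y' t)
        (extendBits eC y'' t) : ℂ) = 0 := by
      rw [blockTensor, if_neg, Int.cast_zero]
      rintro ⟨-, -, -, h1, h2, h3⟩
      exact (ht h1 h2).2.2 (h3 (ht h1 h2).1 (ht h1 h2).2.1)
    rw [Finset.prod_eq_zero (Finset.mem_univ t) hprod, mul_zero]
    by_cases h1 : 0 ∈ κ t → 1 ∈ κ t → extendBits eA y t = extendBits eB y' t
    · by_cases h2 : 0 ∈ κ t → 2 ∈ κ t → extendBits eA y t = extendBits eC y'' t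
      · obtain ⟨hb, hc, hne⟩ := ht h1 h2
        simp only [extendBits, hb, hc, dif_pos] at hne
        exact hBC (eB.symm ⟨t, hb⟩) (eC.symm ⟨t, hc⟩) (by simp) _ _ _ hne
      · push Not at h2
        obtain ⟨ha, hc, hne⟩ := h2
        simp only [extendBits, ha, hc, dif_pos] at hne
        exact hAC (eA.symm ⟨t, ha⟩) (eC.symm ⟨t, hc⟩) (by simp) _ _ _ hne
    · push Not at h1
      obtain ⟨ha, hb, hne⟩ := h1
      simp only [extendBits, ha, hb, dif_pos] at hne
      exact hAB (eA.symm ⟨t, ha⟩) (eB.symm ⟨t, hb⟩) (by simp) _ _ _ hne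

variable {g : Fin (Fintype.card (A ⊕ B ⊕ C)) → QubitOp (A ⊕ B ⊕ C)}
  {Ψ : (A ⊕ B ⊕ C → Fin 2) → ℂ}

/-- Signs that turn the operators of a block system into stabilizers. -/
lemma IsBlockSystem.exists_signs {ι : Type*} [Fintype ι] [DecidableEq ι] {ψ : (ι → Fin 2) → ℂ}
    (hψ : ψ ≠ 0) {T : Type} [DecidableEq T] {col : ι → Fin 3} {κ : T → Finset (Fin 3)}
    {x z : T → PauliVec ι} (hS : IsBlockSystem col (stabilizerSpace ψ) κ x z) :
    ∃ ξ μ : Fin 3 → T → ℂ, (∀ a t, IsSign (ξ a t)) ∧ (∀ a t, IsSign (μ a t)) ∧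
      (∀ a t, a ∉ κ t → ξ a t = 1) ∧
      (∀ t, (ξ 0 t • pauliOp (part col 0 (x t))) *ᵥ ((ξ 1 t • pauliOp (part col 1 (x t))) *ᵥ
        ((ξ 2 t • pauliOp (part col 2 (x t))) *ᵥ ψ)) = ψ) ∧
      ∀ t, ∀ a ∈ κ t, ∀ b ∈ κ t, (μ a t • pauliOp (part col a (z t))) *ᵥ
        ((μ b t • pauliOp (part col b (z t))) *ᵥ ψ) = ψ := by
  -- Each block gets a reference party. It carries the whole sign of the stabilizer `x t`, and the
  -- signs of the parts of `z t` are chosen relative to it.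
  choose r hr using hS.nonempty
  choose ε hε using fun t => mem_stabilizerSpace.1 (hS.x_mem t)
  have hεs : ∀ t, IsSign (ε t) := fun t => pauliOp_eigenvalue hψ (hε t)
  have hμ : ∀ a t, ∃ μ : ℂ, IsSign μ ∧ (a ∈ κ t →
      pauliOp (part col (r t) (z t) + part col a (z t)) *ᵥ ψ = μ • ψ) := by
    intro a t
    by_cases ha : a ∈ κ t
    · obtain ⟨c, hc⟩ := mem_stabilizerSpace.1 (hS.z_mem t (r t) (hr t) a ha)
      exact ⟨c, pauliOp_eigenvalue hψ hc, fun _ => hc⟩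
    · exact ⟨1, Or.inl rfl, fun h => absurd h ha⟩
  choose μ hμs hμ using hμ
  have hdisj : ∀ {a b : Fin 3}, a ≠ b → ∀ v w : PauliVec ι, ∀ i,
      part col a v i = 0 ∨ part col b w i = 0 := by
    intro a b hab v w i
    by_cases h : col i = a
    · right
      rw [part_apply, if_neg (fun h' => hab (h.symm.trans h'))]
    · left
      rw [part_apply, if_neg h]
  refine ⟨fun a t => if a = r t then ε t else 1, μ, ?_, hμs, ?_, ?_, ?_⟩
  · intro a t
    dsimp only
    split_ifs
    · exact hεs t
    · exact Or.inl rfl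
  · intro a t ha
    exact if_neg fun h : a = r t => ha (h ▸ hr t)
  · intro t
    have hx : pauliOp (x t) = pauliOp (part col 0 (x t)) * (pauliOp (part col 1 (x t)) *
        pauliOp (part col 2 (x t))) := by
      rw [pauliOp_mul_of_disjoint (hdisj (by decide) _ _), pauliOp_mul_of_disjoint]
      · rw [← add_assoc, ← Fin.sum_univ_three (fun a => part col a (x t)), sum_part]
      · intro i
        rcases hdisj (a := 0) (b := 1) (by decide) (x t) (x t) i with h | h
        · exact Or.inl h
        · rcases hdisj (a := 0) (b := 2) (by decide) (x t) (x t) i with h' | h'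
          · exact Or.inl h'
          · right
            rw [Pi.add_apply, h, h', add_zero]
    have hprod : (if (0 : Fin 3) = r t then ε t else 1) * ((if (1 : Fin 3) = r t then ε t else 1) *
        (if (2 : Fin 3) = r t then ε t else 1)) = ε t := by
      generalize r t = q
      fin_cases q <;> simp
    have hall : ∀ c₀ c₁ c₂ : ℂ, ∀ M₀ M₁ M₂ : Matrix (ι → Fin 2) (ι → Fin 2) ℂ,
        (c₀ • M₀) *ᵥ ((c₁ • M₁) *ᵥ ((c₂ • M₂) *ᵥ ψ)) = (c₀ * (c₁ * c₂)) • ((M₀ * (M₁ * M₂)) *ᵥ ψ) := by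
      intro c₀ c₁ c₂ M₀ M₁ M₂
      simp only [Matrix.smul_mulVec, Matrix.mulVec_smul, smul_smul, ← Matrix.mulVec_mulVec]
      congr 1
      ring
    rw [hall, ← hx, hε, hprod, smul_smul, (hεs t).mul_self, one_smul]
  · intro t
    set Z : Fin 3 → Matrix (ι → Fin 2) (ι → Fin 2) ℂ := fun a => μ a t • pauliOp (part col a (z t))
      with hZ
    have hZ2 : ∀ a, Z a * Z a = 1 := by
      intro a
      rw [hZ, Matrix.smul_mul, Matrix.mul_smul, pauliOp_mul_self, smul_smul, (hμs a t).mul_self,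
        one_smul]
    have hZc : ∀ a b, Z a * Z b = Z b * Z a := by
      intro a b
      by_cases hab : a = b
      · rw [hab]
      · simp only [hZ, Matrix.smul_mul, Matrix.mul_smul]
        rw [pauliOp_comm, symp_part_part, if_neg hab, sgn_zero, one_smul, smul_comm]
    have hμr : μ (r t) t = 1 := by
      have := hμ (r t) t (hr t)
      rw [ZModModule.add_self, pauliOp_zero, Matrix.one_mulVec] at this
      apply smul_left_injective ℂ hψ
      simpa using this.symm
    have hZr : ∀ a ∈ κ t, Z (r t) *ᵥ (Z a *ᵥ ψ) = ψ := by
      intro a ha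
      by_cases har : r t = a
      · rw [har, Matrix.mulVec_mulVec, hZ2, Matrix.one_mulVec]
      · simp only [hZ, Matrix.mulVec_mulVec, Matrix.smul_mul, Matrix.mul_smul]
        rw [pauliOp_mul_of_disjoint (hdisj har _ _), hμr, one_smul, Matrix.smul_mulVec, hμ a t ha,
          smul_smul, (hμs a t).mul_self, one_smul]
    intro a ha b hb
    change Z a *ᵥ (Z b *ᵥ ψ) = ψ
    -- Since the reference operator times `Z b` stabilizes `ψ` and `Z b` is an involution, all `Z b`
    -- act on `ψ` alike.
    have h1 : Z b *ᵥ ψ = Z (r t) *ᵥ ψ := by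
      conv_rhs => rw [← hZr b hb]
      rw [Matrix.mulVec_mulVec, Matrix.mulVec_mulVec, hZ2]
      simp
    rw [h1, Matrix.mulVec_mulVec, hZc, ← Matrix.mulVec_mulVec, hZr a ha]

lemma symp_inl (v w : PauliVec (A ⊕ B ⊕ C)) :
    symp (fun a : A => v (.inl a)) (fun a => w (.inl a)) = symp (part party 0 v) w := by
  simp [symp_apply, part_apply, party, Fintype.sum_sum_type]

lemma symp_inr_inl (v w : PauliVec (A ⊕ B ⊕ C)) :
    symp (fun b : B => v (.inr (.inl b))) (fun b => w (.inr (.inl b))) =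
      symp (part party 1 v) w := by
  simp [symp_apply, part_apply, party, Fintype.sum_sum_type]

lemma symp_inr_inr (v w : PauliVec (A ⊕ B ⊕ C)) :
    symp (fun c : C => v (.inr (.inr c))) (fun c => w (.inr (.inr c))) =
      symp (part party 2 v) w := by
  simp [symp_apply, part_apply, party, Fintype.sum_sum_type]

lemma actA_scaled {α β γ α' : Type*} [Fintype α] {M U : Matrix α' α ℂ} {s : α' → ℂ}
    (h : ∀ y x, M y x = s y * U y x) (ψ : α → β → γ → ℂ) (a : α') (b : β) (c : γ) :
    actA M ψ a b c = s a * actA U ψ a b c := by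
  simp only [actA, h, mul_assoc, Finset.mul_sum]

lemma actB_scaled {α β γ β' : Type*} [Fintype β] {M U : Matrix β' β ℂ} {s : β' → ℂ}
    (h : ∀ y x, M y x = s y * U y x) (ψ : α → β → γ → ℂ) (a : α) (b : β') (c : γ) :
    actB M ψ a b c = s b * actB U ψ a b c := by
  simp only [actB, h, mul_assoc, Finset.mul_sum]

lemma actC_scaled {α β γ γ' : Type*} [Fintype γ] {M U : Matrix γ' γ ℂ} {s : γ' → ℂ}
    (h : ∀ y x, M y x = s y * U y x) (ψ : α → β → γ → ℂ) (a : α) (b : β) (c : γ') :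
    actC M ψ a b c = s c * actC U ψ a b c := by
  simp only [actC, h, mul_assoc, Finset.mul_sum]

lemma eq_zero_of_bitSign_mul {b b' : Fin 2} (hb : b ≠ b') {c : ℂ}
    (h : bitSign b * (bitSign b' * c) = c) : c = 0 := by
  have : bitSign b * bitSign b' = -1 := by
    fin_cases b <;> fin_cases b' <;> simp_all [bitSign]
  rw [← mul_assoc, this, neg_one_mul] at h
  exact self_eq_neg.1 h.symm

/-- Up to local unitaries, a tripartite stabilizer state is a product of states `∑ₛ |s ⋯ s⟩`, each
shared by one, two or three parties; the products of the stabilizers supported on two parties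
exhaust the stabilizer group if and only if no factor is shared by all three parties. -/
theorem IsStabilizerState.exists_canonicalForm (h : IsStabilizerState g Ψ) :
    ∃ (n : ℕ) (κ : Fin n → Finset (Fin 3)) (eA : A ≃ {t // 0 ∈ κ t}) (eB : B ≃ {t // 1 ∈ κ t})
      (eC : C ≃ {t // 2 ∈ κ t}) (U : QubitOp A) (V : QubitOp B) (W : QubitOp C) (c₀ : ℂ),
      (∀ t, (κ t).Nonempty) ∧
      (∀ a b c, actA U.1 (actB V.1 (actC W.1 (components Ψ))) a b c = c₀ *
        ∏ t, (blockTensor (κ t) (extendBits eA a t) (extendBits eB b t) (extendBits eC c t) : ℂ)) ∧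
      (groupProd (stabilizerGroup g) = (stabilizerGroup g : Set (QubitOp (A ⊕ B ⊕ C))) ↔
        ∀ t, κ t ≠ Finset.univ) := by
  obtain ⟨n, κ, x, z, hS, hcompl⟩ := exists_complete_blockSystem (col := party) h.isLagrangian
  have cardA : Fintype.card A = Fintype.card {t // 0 ∈ κ t} := by
    rw [← hS.card_color hcompl]
    refine Fintype.card_congr ⟨fun a => ⟨.inl a, rfl⟩, fun i => match i with
      | ⟨.inl a, _⟩ => a
      | ⟨.inr (.inl b), hb⟩ => absurd hb (by simp [party])
      | ⟨.inr (.inr c), hc⟩ => absurd hc (by simp [party]), fun a => rfl, ?_⟩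
    rintro ⟨a | b | c, hi⟩
    · rfl
    all_goals simp [party] at hi
  have cardB : Fintype.card B = Fintype.card {t // 1 ∈ κ t} := by
    rw [← hS.card_color hcompl]
    refine Fintype.card_congr ⟨fun b => ⟨.inr (.inl b), rfl⟩, fun i => match i with
      | ⟨.inl a, ha⟩ => absurd ha (by simp [party])
      | ⟨.inr (.inl b), _⟩ => b
      | ⟨.inr (.inr c), hc⟩ => absurd hc (by simp [party]), fun a => rfl, ?_⟩
    rintro ⟨a | b | c, hi⟩
    · simp [party] at hi
    · rfl
    · simp [party] at hi
  have cardC : Fintype.card C = Fintype.card {t // 2 ∈ κ t} := by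
    rw [← hS.card_color hcompl]
    refine Fintype.card_congr ⟨fun c => ⟨.inr (.inr c), rfl⟩, fun i => match i with
      | ⟨.inl a, ha⟩ => absurd ha (by simp [party])
      | ⟨.inr (.inl b), hb⟩ => absurd hb (by simp [party])
      | ⟨.inr (.inr c), _⟩ => c, fun a => rfl, ?_⟩
    rintro ⟨a | b | c, hi⟩
    · simp [party] at hi
    · simp [party] at hi
    · rfl
  obtain ⟨eA⟩ := Fintype.card_eq.1 cardA
  obtain ⟨eB⟩ := Fintype.card_eq.1 cardB
  obtain ⟨eC⟩ := Fintype.card_eq.1 cardC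
  obtain ⟨ξ, μ, hξ, hμ, hξ0, hX, hZ⟩ := hS.exists_signs h.ne_zero
  obtain ⟨U, hUZ, hUX⟩ := hS.exists_party_unitary eA (j := Sum.inl) symp_inl
    (fun v hv => funext fun a => part_eq_zero_iff.1 hv _ rfl) (hξ 0) (hμ 0) (hξ0 0)
  obtain ⟨V, hVZ, hVX⟩ := hS.exists_party_unitary eB (j := fun b => Sum.inr (Sum.inl b))
    symp_inr_inl (fun v hv => funext fun b => part_eq_zero_iff.1 hv _ rfl) (hξ 1) (hμ 1) (hξ0 1)
  obtain ⟨W, hWZ, hWX⟩ := hS.exists_party_unitary eC (j := fun c => Sum.inr (Sum.inr c))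
    symp_inr_inr (fun v hv => funext fun c => part_eq_zero_iff.1 hv _ rfl) (hξ 2) (hμ 2) (hξ0 2)
  set φ := actA U.1 (actB V.1 (actC W.1 (components Ψ))) with hφ
  refine ⟨n, κ, eA, eB, eC, U, V, W, φ 0 0 0, hS.nonempty, ?_, ?_⟩
  · refine eq_prod_blockTensor eA eB eC ?_ ?_ ?_ ?_
    · intro t y y' y''
      -- A stabilizer is inserted in front of the state and absorbed into the three unitaries, where
      -- it becomes a flip of the bits of the block.
      have h1 := congrArg components (hX t)
      rw [components_part_zero, components_part_one, components_part_two] at h1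
      have h2 := congrFun (congrFun (congrFun hφ y) y') y''
      rw [← h1, act_act_mul] at h2
      refine Eq.trans ?_ h2.symm
      simp only [actA, actB, actC, hUX, hVX, hWX]
    · intro a b hab y y' y'' hne
      -- In the same way the `Z`-stabilizer of two parties becomes the product of the signs of their
      -- bits, which is `-1` if they differ.
      have h1 := congrArg components (hZ (eA a) 0 (eA a).2 1 (by rw [hab]; exact (eB b).2))
      rw [components_part_zero, components_part_one, ← actC_one (components Ψ)] at h1
      have h2 := congrFun (congrFun (congrFun hφ y) y') y''
      rw [← actC_one (components Ψ), ← h1, act_act_mul, actA_scaled (hUZ a), mul_one] at h2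
      refine eq_zero_of_bitSign_mul hne (Eq.trans ?_ h2.symm)
      conv_rhs => rw [actA_actB, hab, actB_scaled (hVZ b), ← actA_actB]
    · intro a c hac y y' y'' hne
      have h1 := congrArg components (hZ (eA a) 0 (eA a).2 2 (by rw [hac]; exact (eC c).2))
      rw [components_part_zero, components_part_two, ← actB_one (actC _ _)] at h1
      have h2 := congrFun (congrFun (congrFun hφ y) y') y''
      rw [← h1, act_act_mul, actA_scaled (hUZ a), mul_one] at h2
      refine eq_zero_of_bitSign_mul hne (Eq.trans ?_ h2.symm)
      conv_rhs => rw [actB_actC, actA_actC, hac, actC_scaled (hWZ c), ← actA_actC, ← actB_actC]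
    · intro b c hbc y y' y'' hne
      have h1 := congrArg components (hZ (eB b) 1 (eB b).2 2 (by rw [hbc]; exact (eC c).2))
      rw [components_part_one, components_part_two, ← actA_one (actB _ _)] at h1
      have h2 := congrFun (congrFun (congrFun hφ y) y') y''
      rw [← h1, act_act_mul, actA_actB, actB_scaled (hVZ b), mul_one] at h2
      refine eq_zero_of_bitSign_mul hne (Eq.trans ?_ h2.symm)
      conv_rhs =>
        rw [← actA_actB, actB_actC, actA_actC, hbc, actC_scaled (hWZ c), ← actA_actC, ← actB_actC]
  · rw [h.groupProd_eq_iff]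
    exact hS.forall_exists_sum_iff h.isLagrangian hcompl

end Canonical

end

noncomputable section

open scoped Kronecker

/-! ### Entropies of states with flat entanglement spectrum -/

section Flat

variable {m : Type*} [Fintype m] [DecidableEq m]

/-- The functional calculus of a multiple of a projection. -/
lemma cfc_of_mul_self_eq_smul {ρ : Matrix m m ℂ} (hρ : ρ.IsHermitian) {l : ℝ} (hl : 0 < l)
    (h : ρ * ρ = (l : ℂ) • ρ) {f : ℝ → ℝ} (hf : f 0 = 0) :
    cfc f ρ = ((f l / l : ℝ) : ℂ) • ρ := by
  have hsa : IsSelfAdjoint ρ := hρ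
  -- The quadratic equation for `ρ` gives an explicit inverse of `x - ρ` for all other `x`. On `{0,
  -- l}` the function `f` agrees with a linear one, because `f 0 = 0`.
  have hspec : ∀ x ∈ spectrum ℝ ρ, x = 0 ∨ x = l := by
    intro x hx
    by_contra! hne
    refine hx ?_
    have hx0 : (x : ℂ) * (x - l) ≠ 0 := by
      have h1 := hne.1
      have h2 := sub_ne_zero.2 hne.2
      exact_mod_cast mul_ne_zero h1 h2
    refine IsUnit.of_mul_eq_one
      (b := ((x : ℂ) * (x - l))⁻¹ • (((x : ℂ) - l) • (1 : Matrix m m ℂ) + ρ)) ?_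
    have h1 : algebraMap ℝ (Matrix m m ℂ) x = (x : ℂ) • 1 := by
      rw [Algebra.algebraMap_eq_smul_one]; ext i j; simp
    rw [h1, Matrix.mul_smul, sub_mul, mul_add, mul_add, h]
    simp only [Matrix.smul_mul, Matrix.mul_smul, one_mul, mul_one]
    have : ((x : ℂ) - l) • (x : ℂ) • (1 : Matrix m m ℂ) + (x : ℂ) • ρ -
        (((x : ℂ) - l) • ρ + (l : ℂ) • ρ) = ((x : ℂ) * (x - l)) • 1 := by
      module
    rw [this, smul_smul, inv_mul_cancel₀ hx0, one_smul]
  have h1 : cfc f ρ = cfc (fun x => f l / l * x) ρ := by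
    refine cfc_congr fun x hx => ?_
    rcases hspec x hx with rfl | rfl
    · simp [hf]
    · field_simp
  rw [h1, cfc_const_mul _ _ _ (by fun_prop), cfc_id' ℝ ρ]
  ext i j
  simp

/-- The entropy of a normalized multiple of a projection. -/
theorem vonNeumannEntropy_of_mul_self_eq_smul {ρ : Matrix m m ℂ} (hρ : ρ.IsHermitian) {l : ℝ}
    (hl : 0 < l) (h : ρ * ρ = (l : ℂ) • ρ) (htr : ρ.trace = 1) :
    vonNeumannEntropy ρ = -Real.logb 2 l := by
  rw [vonNeumannEntropy, cfc_of_mul_self_eq_smul hρ hl h (by simp), Matrix.mul_smul, h, smul_smul,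
    Matrix.trace_smul, htr, ← Complex.ofReal_mul, div_mul_cancel₀ _ hl.ne']
  simp

end Flat

set_option linter.unusedSectionVars false

/-! ### Matrix identities under isometries. -/

section Isometry

variable {m m' k k' : Type*} [Fintype m] [Fintype m'] [Fintype k] [Fintype k']
  [DecidableEq m] [DecidableEq k]

lemma reducedDensity_eq_mul (f : m' → k → ℂ) :
    reducedDensity f = Matrix.of f * (Matrix.of f)ᴴ := by
  ext x y
  simp [reducedDensity, Matrix.mul_apply]

lemma reducedDensity_isHermitian (f : m' → k → ℂ) : (reducedDensity f).IsHermitian := by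
  rw [reducedDensity_eq_mul]
  exact Matrix.isHermitian_mul_conjTranspose_self _

/-- An isometry on the factor that is traced out has no effect. It appears transposed because it
acts on the column index. -/
lemma mul_conjTranspose_of_isometry {F : Matrix m k ℂ} {P : Matrix m' m ℂ} {Q : Matrix k' k ℂ}
    (hQ : Qᴴ * Q = 1) : (P * F * Qᵀ) * (P * F * Qᵀ)ᴴ = P * (F * Fᴴ) * Pᴴ := by
  have h1 : Qᵀ * Qᵀᴴ = 1 := by
    have := congrArg Matrix.transpose hQ
    rwa [Matrix.transpose_mul, Matrix.transpose_one] at this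
  rw [Matrix.conjTranspose_mul, Matrix.conjTranspose_mul, Matrix.mul_assoc (P * F),
    ← Matrix.mul_assoc Qᵀ, h1, Matrix.one_mul]
  simp only [Matrix.mul_assoc]

/-- Compression by `P` undoes the embedding, so flatness of the spectrum may be checked in the
larger space, where the indices factor over blocks. -/
lemma mul_self_eq_smul_of_isometry {ρ : Matrix m m ℂ} {P : Matrix m' m ℂ} (hP : Pᴴ * P = 1) {l : ℂ}
    (h : (P * ρ * Pᴴ) * (P * ρ * Pᴴ) = l • (P * ρ * Pᴴ)) : ρ * ρ = l • ρ := by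
  have key : ∀ X : Matrix m m ℂ, Pᴴ * (P * X * Pᴴ) * P = X := fun X => by
    rw [← Matrix.mul_assoc, ← Matrix.mul_assoc, hP, Matrix.one_mul, Matrix.mul_assoc, hP,
      Matrix.mul_one]
  have h1 : (P * ρ * Pᴴ) * (P * ρ * Pᴴ) = P * (ρ * ρ) * Pᴴ := by
    rw [Matrix.mul_assoc (P * ρ), ← Matrix.mul_assoc Pᴴ, ← Matrix.mul_assoc Pᴴ, hP, Matrix.one_mul]
    simp only [Matrix.mul_assoc]
  rw [h1] at h
  have h2 := congrArg (fun X => Pᴴ * X * P) h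
  simpa only [key, Matrix.mul_smul, Matrix.smul_mul] using h2

lemma kronecker_isometry {P : Matrix m' m ℂ} {Q : Matrix k' k ℂ} (hP : Pᴴ * P = 1)
    (hQ : Qᴴ * Q = 1) : (P ⊗ₖ Q)ᴴ * (P ⊗ₖ Q) = 1 := by
  rw [Matrix.conjTranspose_kronecker, ← Matrix.mul_kronecker_mul, hP, hQ,
    Matrix.one_kronecker_one]

lemma conj_isometry {P : Matrix m' m ℂ} (hP : Pᴴ * P = 1) :
    (P.map star)ᴴ * P.map star = 1 := by
  have := congrArg (fun X : Matrix m m ℂ => Xᵀ) hP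
  simp only [Matrix.transpose_mul, Matrix.transpose_one] at this
  rw [← Matrix.conjTranspose_conjTranspose (P.map star)]
  ext i j
  have h2 := congrFun (congrFun this i) j
  simp only [Matrix.mul_apply, Matrix.transpose_apply, Matrix.conjTranspose_apply, Matrix.map_apply,
    star_star] at h2 ⊢
  exact h2

end Isometry

/-! ### Entropies of a tripartite state from those of an isometric one. -/

section Tripartite

variable {α β γ α' β' γ' : Type*} [Fintype α] [Fintype β] [Fintype γ]
  [Fintype α'] [Fintype β'] [Fintype γ'] [DecidableEq α] [DecidableEq β] [DecidableEq γ]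

/-- `ρ_AB` with rows indexed by the two copies of `A` and columns by the two copies of `B`. -/
def realignedDensity (ψ : α' → β' → γ' → ℂ) : Matrix (α' × α') (β' × β') ℂ :=
  Matrix.of fun a b =>
    reducedDensity (fun (ab : α' × β') (c : γ') => ψ ab.1 ab.2 c) (a.1, b.1) (a.2, b.2)

variable {P : Matrix α' α ℂ} {Q : Matrix β' β ℂ} {R : Matrix γ' γ ℂ} (ψ : α → β → γ → ℂ)

lemma act_apply (a : α') (b : β') (c : γ') :
    actA P (actB Q (actC R ψ)) a b c = ∑ x, ∑ y, ∑ z, P a x * Q b y * R c z * ψ x y z := by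
  simp only [actA, actB, actC, Finset.mul_sum, mul_assoc]

lemma reducedDensityC_act (hP : Pᴴ * P = 1) (hQ : Qᴴ * Q = 1) :
    reducedDensity (fun (c : γ') (ab : α' × β') => actA P (actB Q (actC R ψ)) ab.1 ab.2 c) =
      R * reducedDensity (fun (c : γ) (ab : α × β) => ψ ab.1 ab.2 c) * Rᴴ := by
  classical
  have h : Matrix.of (fun (c : γ') (ab : α' × β') => actA P (actB Q (actC R ψ)) ab.1 ab.2 c) =
      R * Matrix.of (fun (c : γ) (ab : α × β) => ψ ab.1 ab.2 c) * (P ⊗ₖ Q)ᵀ := by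
    ext c ⟨a, b⟩
    simp only [Matrix.of_apply, act_apply, Matrix.mul_apply, Matrix.transpose_apply,
      Matrix.kronecker_apply, Fintype.sum_prod_type, Finset.sum_mul]
    refine Finset.sum_congr rfl fun x _ => Finset.sum_congr rfl fun y _ =>
      Finset.sum_congr rfl fun z _ => by ring
  rw [reducedDensity_eq_mul, reducedDensity_eq_mul, h,
    mul_conjTranspose_of_isometry (kronecker_isometry hP hQ)]

lemma reducedDensityAB_act (hR : Rᴴ * R = 1) :
    reducedDensity (fun (ab : α' × β') (c : γ') => actA P (actB Q (actC R ψ)) ab.1 ab.2 c) =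
      (P ⊗ₖ Q) * reducedDensity (fun (ab : α × β) (c : γ) => ψ ab.1 ab.2 c) * (P ⊗ₖ Q)ᴴ := by
  classical
  have h : Matrix.of (fun (ab : α' × β') (c : γ') => actA P (actB Q (actC R ψ)) ab.1 ab.2 c) =
      (P ⊗ₖ Q) * Matrix.of (fun (ab : α × β) (c : γ) => ψ ab.1 ab.2 c) * Rᵀ := by
    ext ⟨a, b⟩ c
    simp only [Matrix.of_apply, act_apply, Matrix.mul_apply, Matrix.transpose_apply,
      Matrix.kronecker_apply, Fintype.sum_prod_type, Finset.sum_mul]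
    rw [Finset.sum_comm_cycle]
    refine Finset.sum_congr rfl fun x _ => Finset.sum_congr rfl fun y _ =>
      Finset.sum_congr rfl fun z _ => by ring
  rw [reducedDensity_eq_mul, reducedDensity_eq_mul, h, mul_conjTranspose_of_isometry hR]

/-- The rows of `ρ_AB` transform with `P ⊗ Q` and the columns with its conjugate. Regrouping the
indices by party puts both actions of `A` on the left and both of `B` on the right. -/
lemma realignedDensity_act (hR : Rᴴ * R = 1) :
    realignedDensity (actA P (actB Q (actC R ψ))) =
      (P ⊗ₖ P.map star) * realignedDensity ψ * (Q ⊗ₖ Q.map star)ᵀ := by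
  ext ⟨a, a'⟩ ⟨b, b'⟩
  simp only [realignedDensity, Matrix.of_apply]
  rw [reducedDensityAB_act ψ hR]
  simp only [Matrix.mul_apply, Matrix.conjTranspose_apply, Matrix.transpose_apply,
    Matrix.kronecker_apply, Fintype.sum_prod_type, Finset.sum_mul, Matrix.map_apply, star_mul',
    Matrix.of_apply]
  trans ∑ x' : α, ∑ y' : β, ∑ x : α, ∑ y : β, P a x * Q b y * star (P a' x') * star (Q b' y') *
    reducedDensity (fun (ab : α × β) (c : γ) => ψ ab.1 ab.2 c) (x, y) (x', y')
  · refine Finset.sum_congr rfl fun x _ => Finset.sum_congr rfl fun y _ =>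
      Finset.sum_congr rfl fun z _ => Finset.sum_congr rfl fun w _ => by ring
  · trans ∑ y : β, ∑ y' : β, ∑ x : α, ∑ x' : α, P a x * Q b y * star (P a' x') * star (Q b' y') *
      reducedDensity (fun (ab : α × β) (c : γ) => ψ ab.1 ab.2 c) (x, y) (x', y')
    · rw [Finset.sum_congr rfl fun x' _ =>
        (Finset.sum_congr rfl fun y' _ => Finset.sum_comm).trans Finset.sum_comm, Finset.sum_comm]
      refine Finset.sum_congr rfl fun y _ => ?_
      rw [Finset.sum_comm]
      exact Finset.sum_congr rfl fun y' _ => Finset.sum_comm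
    · refine Finset.sum_congr rfl fun x _ => Finset.sum_congr rfl fun y _ =>
        Finset.sum_congr rfl fun z _ => Finset.sum_congr rfl fun w _ => by ring

variable {ψ}

lemma trace_reducedDensityC (h : ∑ a, ∑ b, ∑ c, ‖ψ a b c‖ ^ 2 = 1) :
    (reducedDensity (fun (c : γ) (ab : α × β) => ψ ab.1 ab.2 c)).trace = 1 := by
  have h1 : ((∑ a, ∑ b, ∑ c, ‖ψ a b c‖ ^ 2 : ℝ) : ℂ) = 1 := by rw [h]; simp
  rw [← h1]
  simp only [Matrix.trace, Matrix.diag_apply, reducedDensity, Matrix.of_apply,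
    Fintype.sum_prod_type, Complex.star_def, Complex.mul_conj']
  push_cast
  rw [Finset.sum_comm]
  exact Finset.sum_congr rfl fun x _ => Finset.sum_comm

lemma trace_reducedDensityAB (h : ∑ a, ∑ b, ∑ c, ‖ψ a b c‖ ^ 2 = 1) :
    (reducedDensity (fun (ab : α × β) (c : γ) => ψ ab.1 ab.2 c)).trace = 1 := by
  have h1 : ((∑ a, ∑ b, ∑ c, ‖ψ a b c‖ ^ 2 : ℝ) : ℂ) = 1 := by rw [h]; simp
  rw [← h1]
  simp only [Matrix.trace, Matrix.diag_apply, reducedDensity, Matrix.of_apply,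
    Fintype.sum_prod_type, Complex.star_def, Complex.mul_conj']
  push_cast
  rfl

/-- The entanglement entropy of a state with flat spectrum, from a state isometric to it. -/
theorem entropyC_eq (hP : Pᴴ * P = 1) (hQ : Qᴴ * Q = 1) (hR : Rᴴ * R = 1)
    (h1 : ∑ a, ∑ b, ∑ c, ‖ψ a b c‖ ^ 2 = 1) {φ : α' → β' → γ' → ℂ}
    (hφ : φ = actA P (actB Q (actC R ψ))) {l : ℝ} (hl : 0 < l)
    (h : reducedDensity (fun (c : γ') (ab : α' × β') => φ ab.1 ab.2 c) *
      reducedDensity (fun (c : γ') (ab : α' × β') => φ ab.1 ab.2 c) =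
      (l : ℂ) • reducedDensity (fun (c : γ') (ab : α' × β') => φ ab.1 ab.2 c)) :
    entropyC ψ = -Real.logb 2 l := by
  rw [hφ, reducedDensityC_act ψ hP hQ] at h
  exact vonNeumannEntropy_of_mul_self_eq_smul (reducedDensity_isHermitian _) hl
    (mul_self_eq_smul_of_isometry hR h) (trace_reducedDensityC h1)

/-- The reflected entropy of a state with flat spectra, from a state isometric to it. -/
theorem reflectedEntropy_eq (hP : Pᴴ * P = 1) (hQ : Qᴴ * Q = 1) (hR : Rᴴ * R = 1)
    (h1 : ∑ a, ∑ b, ∑ c, ‖ψ a b c‖ ^ 2 = 1) {φ : α' → β' → γ' → ℂ}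
    (hφ : φ = actA P (actB Q (actC R ψ))) {l u : ℝ} (hl : 0 < l) (hu : 0 < u)
    (h : reducedDensity (fun (ab : α' × β') (c : γ') => φ ab.1 ab.2 c) *
      reducedDensity (fun (ab : α' × β') (c : γ') => φ ab.1 ab.2 c) =
      (l : ℂ) • reducedDensity (fun (ab : α' × β') (c : γ') => φ ab.1 ab.2 c))
    (h' : (realignedDensity φ * (realignedDensity φ)ᴴ) *
      (realignedDensity φ * (realignedDensity φ)ᴴ) =
      (u : ℂ) • (realignedDensity φ * (realignedDensity φ)ᴴ)) :
    reflectedEntropy ψ = -Real.logb 2 (u / l) := by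
  classical
  set ρ := reducedDensity (fun (ab : α × β) (c : γ) => ψ ab.1 ab.2 c) with hρ
  have hherm : ρ.IsHermitian := reducedDensity_isHermitian _
  rw [hφ, reducedDensityAB_act ψ hR] at h
  rw [hφ, realignedDensity_act ψ hR,
    mul_conjTranspose_of_isometry (kronecker_isometry hQ (conj_isometry hQ))] at h'
  have hf := mul_self_eq_smul_of_isometry (kronecker_isometry hP hQ) h
  have hf' := mul_self_eq_smul_of_isometry (kronecker_isometry hP (conj_isometry hP)) h'
  -- The spectrum of `ρ_AB` is flat, so `√ρ` is `ρ / √l`, and the reduced state on `AA*` is `1 / l`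
  -- times the square of the realigned density.
  have hsq : sqrtDensityAB ψ = ((Real.sqrt l / l : ℝ) : ℂ) • ρ :=
    cfc_of_mul_self_eq_smul hherm hl hf Real.sqrt_zero
  have hl2 : (Real.sqrt l / l) * (Real.sqrt l / l) = 1 / l := by
    rw [div_mul_div_comm, Real.mul_self_sqrt hl.le]
    field_simp
  have hR' : reducedDensity (fun (a : α × α) (b : β × β) =>
      sqrtDensityAB ψ (a.1, b.1) (a.2, b.2)) =
      ((1 / l : ℝ) : ℂ) • (realignedDensity ψ * (realignedDensity ψ)ᴴ) := by
    have : Matrix.of (fun (a : α × α) (b : β × β) => sqrtDensityAB ψ (a.1, b.1) (a.2, b.2)) =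
        ((Real.sqrt l / l : ℝ) : ℂ) • realignedDensity ψ := by
      ext a b
      simp [hsq, realignedDensity, hρ]
    rw [reducedDensity_eq_mul, this, Matrix.conjTranspose_smul, Matrix.smul_mul, Matrix.mul_smul,
      smul_smul, ← hl2]
    simp
  -- Realignment only permutes entries, so this trace is `Tr ρ² = l`.
  have htr : (realignedDensity ψ * (realignedDensity ψ)ᴴ).trace = l := by
    have h2 : (ρ * ρ).trace = l := by
      rw [hf, Matrix.trace_smul, trace_reducedDensityAB h1, smul_eq_mul, mul_one]
    have h3 : (ρ * ρ).trace = (ρ * ρᴴ).trace := by rw [hherm.eq]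
    rw [← h2, h3]
    simp only [Matrix.trace, Matrix.diag_apply, Matrix.mul_apply, Matrix.conjTranspose_apply,
      Fintype.sum_prod_type, realignedDensity, Matrix.of_apply, ← hρ]
    exact Finset.sum_congr rfl fun x _ => Finset.sum_comm
  refine vonNeumannEntropy_of_mul_self_eq_smul (reducedDensity_isHermitian _) (by positivity) ?_ ?_
  · rw [hR', Matrix.smul_mul, Matrix.mul_smul, hf', smul_smul, smul_smul, smul_smul]
    congr 1
    push_cast
    field_simp
  · rw [hR', Matrix.trace_smul, htr, smul_eq_mul, ← Complex.ofReal_mul, one_div_mul_cancel hl.ne']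
    simp

end Tripartite

end

noncomputable section

/-! ### Entropies of products of blocks -/

set_option linter.unusedSectionVars false

section Blocks

variable {T : Type*} [Fintype T]

/-- The tensor product of the states of the blocks, with indices for the absent parties. -/
def productState (κ : T → Finset (Fin 3)) (x y z : T → Fin 2) : ℂ :=
  ∏ t, (blockTensor (κ t) (x t) (y t) (z t) : ℂ)

lemma sum_prod_apply [DecidableEq T] {K : Type*} [Fintype K] (f : T → K → ℂ) :
    ∑ y : T → K, ∏ t, f t (y t) = ∏ t, ∑ i, f t i := by
  rw [Finset.prod_univ_sum, Fintype.piFinset_univ]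

lemma sum_sum_prod_apply [DecidableEq T] {K : Type*} [Fintype K] (f : T → K → K → ℂ) :
    ∑ y : T → K, ∑ z : T → K, ∏ t, f t (y t) (z t) = ∏ t, ∑ i, ∑ j, f t i j := by
  rw [← sum_prod_apply]
  exact Finset.sum_congr rfl fun y _ => sum_prod_apply fun t j => f t (y t) j

/-- The isometry that adds to a party's qubits the bit `0` at each block without the party. -/
def bitEmbedding [DecidableEq T] {K : Type*} {κ : T → Finset (Fin 3)} {a : Fin 3}
    (e : K ≃ {t // a ∈ κ t}) : Matrix (T → Fin 2) (K → Fin 2) ℂ :=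
  Matrix.of fun y x => if y = extendBits e x then 1 else 0

lemma extendBits_injective {K : Type*} {κ : T → Finset (Fin 3)} {a : Fin 3}
    (e : K ≃ {t // a ∈ κ t}) : Function.Injective (extendBits e) := by
  intro x y h
  funext k
  rw [← extendBits_apply e x, h, extendBits_apply]

lemma exists_extendBits_eq {K : Type*} {κ : T → Finset (Fin 3)} {a : Fin 3}
    (e : K ≃ {t // a ∈ κ t}) {y : T → Fin 2} (h : ∀ t, a ∉ κ t → y t = 0) :
    ∃ x, extendBits e x = y := by
  refine ⟨fun k => y (e k), funext fun t => ?_⟩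
  by_cases ht : a ∈ κ t
  · simp [extendBits, ht]
  · simp [extendBits, ht, h t ht]

lemma bitEmbedding_isometry [DecidableEq T] {K : Type*} [Fintype K] [DecidableEq K]
    {κ : T → Finset (Fin 3)} {a : Fin 3} (e : K ≃ {t // a ∈ κ t}) :
    (bitEmbedding e)ᴴ * bitEmbedding e = 1 := by
  ext x y
  simp only [Matrix.mul_apply, Matrix.conjTranspose_apply, bitEmbedding, Matrix.of_apply,
    Matrix.one_apply]
  rw [Finset.sum_eq_single (extendBits e x)]
  · simp [(extendBits_injective e).eq_iff]
  · intro z _ hz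
    simp [hz]
  · simp

lemma bitEmbedding_mul_isometry [DecidableEq T] {K : Type*} [Fintype K] [DecidableEq K]
    {κ : T → Finset (Fin 3)} {a : Fin 3} (e : K ≃ {t // a ∈ κ t}) (U : QubitOp K) :
    (bitEmbedding e * U.1)ᴴ * (bitEmbedding e * U.1) = 1 := by
  rw [Matrix.conjTranspose_mul, Matrix.mul_assoc, ← Matrix.mul_assoc (bitEmbedding e)ᴴ,
    bitEmbedding_isometry, Matrix.one_mul]
  exact Matrix.mem_unitaryGroup_iff'.1 U.2

/-- A tensor that vanishes unless the bits of absent parties are 0 is recovered from its restriction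
to the embedded bit strings. -/
lemma sum_bitEmbedding_mul [DecidableEq T] {K : Type*} [Fintype K] [DecidableEq K]
    {κ : T → Finset (Fin 3)} {a : Fin 3} (e : K ≃ {t // a ∈ κ t}) (f : (T → Fin 2) → ℂ)
    (hf : ∀ y t, a ∉ κ t → y t ≠ 0 → f y = 0) (y : T → Fin 2) :
    ∑ x, bitEmbedding e y x * f (extendBits e x) = f y := by
  by_cases h : ∃ x, extendBits e x = y
  · obtain ⟨x, rfl⟩ := h
    rw [Finset.sum_eq_single x]
    · simp [bitEmbedding]
    · intro z _ hz
      simp [bitEmbedding, (extendBits_injective e).eq_iff, hz.symm]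
    · simp
  · rw [Finset.sum_eq_zero]
    · by_contra hne
      refine h (exists_extendBits_eq e fun t ht => ?_)
      by_contra h0
      exact hne (hf y t ht h0).symm
    · intro x _
      have : y ≠ extendBits e x := fun hx => h ⟨x, hx.symm⟩
      simp [bitEmbedding, this]

lemma productState_eq_zero {κ : T → Finset (Fin 3)} {x y z : T → Fin 2} {t : T}
    (h : blockTensor (κ t) (x t) (y t) (z t) = 0) : productState κ x y z = 0 :=
  Finset.prod_eq_zero (Finset.mem_univ t) (by rw [h, Int.cast_zero])

/-- A state in canonical form is isometric to a product of blocks. -/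
lemma exists_isometry_productState [DecidableEq T] {A B C : Type*} [Fintype A] [Fintype B]
    [Fintype C] [DecidableEq A] [DecidableEq B] [DecidableEq C] {κ : T → Finset (Fin 3)}
    (eA : A ≃ {t // 0 ∈ κ t}) (eB : B ≃ {t // 1 ∈ κ t}) (eC : C ≃ {t // 2 ∈ κ t})
    {U : QubitOp A} {V : QubitOp B} {W : QubitOp C} {c₀ : ℂ}
    {ψ : (A → Fin 2) → (B → Fin 2) → (C → Fin 2) → ℂ}
    (h : ∀ a b c, actA U.1 (actB V.1 (actC W.1 ψ)) a b c =
      c₀ * productState κ (extendBits eA a) (extendBits eB b) (extendBits eC c)) :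
    ∃ (P : Matrix (T → Fin 2) (A → Fin 2) ℂ) (Q : Matrix (T → Fin 2) (B → Fin 2) ℂ)
      (R : Matrix (T → Fin 2) (C → Fin 2) ℂ), Pᴴ * P = 1 ∧ Qᴴ * Q = 1 ∧ Rᴴ * R = 1 ∧
      (fun x y z => c₀ * productState κ x y z) = actA P (actB Q (actC R ψ)) := by
  refine ⟨bitEmbedding eA * U.1, bitEmbedding eB * V.1, bitEmbedding eC * W.1,
    bitEmbedding_mul_isometry eA U, bitEmbedding_mul_isometry eB V, bitEmbedding_mul_isometry eC W,
    ?_⟩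
  · have h' : actA U.1 (actB V.1 (actC W.1 ψ)) = fun a b c =>
        c₀ * productState κ (extendBits eA a) (extendBits eB b) (extendBits eC c) := by
      funext a b c; exact h a b c
    rw [← act_act_mul, h']
    funext x y z
    have hC : ∀ a b, actC (bitEmbedding eC) (fun a b c =>
        c₀ * productState κ (extendBits eA a) (extendBits eB b) (extendBits eC c)) a b z =
        c₀ * productState κ (extendBits eA a) (extendBits eB b) z := fun a b =>
      sum_bitEmbedding_mul eC (fun z => c₀ * productState κ (extendBits eA a) (extendBits eB b) z)
        (fun z t ht hz => by
          rw [productState_eq_zero (t := t), mul_zero]; simp [blockTensor, ht, hz]) z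
    simp only [actA, actB, hC]
    have hB : ∀ a, ∑ b, bitEmbedding eB y b *
        (c₀ * productState κ (extendBits eA a) (extendBits eB b) z) =
        c₀ * productState κ (extendBits eA a) y z := fun a =>
      sum_bitEmbedding_mul eB (fun y => c₀ * productState κ (extendBits eA a) y z)
        (fun y t ht hy => by
          rw [productState_eq_zero (t := t), mul_zero]; simp [blockTensor, ht, hy]) y
    simp only [hB]
    exact (sum_bitEmbedding_mul eA (fun x => c₀ * productState κ x y z)
        (fun x t ht hx => by
          rw [productState_eq_zero (t := t), mul_zero]; simp [blockTensor, ht, hx]) x).symm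

/-- The reduced density matrix of a block on the party `C`. -/
def blockC (κ : Finset (Fin 3)) (i j : Fin 2) : ℤ :=
  ∑ k, ∑ l, blockTensor κ k l i * blockTensor κ k l j

/-- The reduced density matrix of a block on the parties `A` and `B`. -/
def blockAB (κ : Finset (Fin 3)) (i j i' j' : Fin 2) : ℤ :=
  ∑ k, blockTensor κ i j k * blockTensor κ i' j' k

/-- The reduced density matrix of two copies of `A` in the purification of `blockAB`. -/
def blockAA (κ : Finset (Fin 3)) (i i' j j' : Fin 2) : ℤ :=
  ∑ k, ∑ l, blockAB κ i k i' l * blockAB κ j k j' l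

/-- The entropy of the party `C` in a block. -/
def blockEntropyC (κ : Finset (Fin 3)) : ℕ := if 2 ∈ κ ∧ 2 ≤ κ.card then 1 else 0

/-- The reflected entropy of a block. -/
def blockReflectedEntropy (κ : Finset (Fin 3)) : ℕ :=
  if 0 ∈ κ ∧ 1 ∈ κ then (if 2 ∈ κ then 1 else 2) else 0

/-- Ensures that the natural subtraction in `blockAA_mul` is not truncated. -/
lemma blockEntropy_add_le (κ : Finset (Fin 3)) :
    blockEntropyC κ + blockReflectedEntropy κ ≤ 2 := by
  revert κ; decide

lemma blockEntropyC_le (κ : Finset (Fin 3)) : blockEntropyC κ ≤ 1 := by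
  revert κ; decide

/-- Every block has squared norm 2; this fixes the normalization `|c₀|² = 2 ^ (-#blocks)`. -/
lemma trace_blockC {κ : Finset (Fin 3)} (h : κ.Nonempty) : ∑ i, blockC κ i i = 2 := by
  revert κ; decide

/-- After division by the squared norm 2 this says that the nonzero eigenvalues are `2 ^ (-S(C))`.
-/
lemma blockC_mul {κ : Finset (Fin 3)} (h : κ.Nonempty) (i j : Fin 2) :
    ∑ k, blockC κ i k * blockC κ k j = 2 ^ (1 - blockEntropyC κ) * blockC κ i j := by
  revert κ i j; decide

-- The same constant as for `C`, since the complementary reduced states of a pure state share their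
-- nonzero spectrum.
set_option maxRecDepth 10000 in
set_option maxHeartbeats 1000000 in
lemma blockAB_mul {κ : Finset (Fin 3)} (h : κ.Nonempty) (i j i' j' : Fin 2) :
    ∑ k, ∑ l, blockAB κ i j k l * blockAB κ k l i' j' =
      2 ^ (1 - blockEntropyC κ) * blockAB κ i j i' j' := by
  revert κ i j i' j'; decide

-- After normalization by `1/4` the eigenvalue is `2 ^ (-(S(C) + S^(R)))`; the quotient by that of
-- `ρ_AB` is `2 ^ (-S^(R))`.
set_option maxRecDepth 10000 in
set_option maxHeartbeats 1000000 in
lemma blockAA_mul {κ : Finset (Fin 3)} (h : κ.Nonempty) (i i' j j' : Fin 2) :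
    ∑ k, ∑ l, blockAA κ i i' k l * blockAA κ k l j j' =
      2 ^ (2 - (blockEntropyC κ + blockReflectedEntropy κ)) * blockAA κ i i' j j' := by
  revert κ i i' j j'; decide

variable [DecidableEq T] {κ : T → Finset (Fin 3)} {c₀ : ℂ}

lemma star_productState (x y z : T → Fin 2) :
    star (productState κ x y z) = productState κ x y z := by
  simp [productState]

lemma mul_star_productState (x y z x' y' z' : T → Fin 2) :
    c₀ * productState κ x y z * star (c₀ * productState κ x' y' z') = (c₀ * star c₀) *
      ∏ t, ((blockTensor (κ t) (x t) (y t) (z t) : ℂ) *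
        (blockTensor (κ t) (x' t) (y' t) (z' t) : ℂ)) := by
  rw [star_mul', star_productState, Finset.prod_mul_distrib, productState, productState]
  ring

lemma reducedDensityC_productState (z z' : T → Fin 2) :
    reducedDensity (fun (c : T → Fin 2) (ab : (T → Fin 2) × (T → Fin 2)) =>
      c₀ * productState κ ab.1 ab.2 c) z z' =
      (c₀ * star c₀) * ∏ t, (blockC (κ t) (z t) (z' t) : ℂ) := by
  simp only [reducedDensity, Matrix.of_apply, Fintype.sum_prod_type, mul_star_productState,
    ← Finset.mul_sum]
  congr 1
  refine (sum_sum_prod_apply fun t i j => (blockTensor (κ t) i j (z t) : ℂ) *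
    (blockTensor (κ t) i j (z' t) : ℂ)).trans ?_
  refine Finset.prod_congr rfl fun t _ => ?_
  simp only [blockC]
  push_cast
  rfl

lemma reducedDensityAB_productState (x y x' y' : T → Fin 2) :
    reducedDensity (fun (ab : (T → Fin 2) × (T → Fin 2)) (c : T → Fin 2) =>
      c₀ * productState κ ab.1 ab.2 c) (x, y) (x', y') =
      (c₀ * star c₀) * ∏ t, (blockAB (κ t) (x t) (y t) (x' t) (y' t) : ℂ) := by
  simp only [reducedDensity, Matrix.of_apply, mul_star_productState, ← Finset.mul_sum]
  congr 1
  refine (sum_prod_apply fun t i => (blockTensor (κ t) (x t) (y t) i : ℂ) *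
    (blockTensor (κ t) (x' t) (y' t) i : ℂ)).trans ?_
  refine Finset.prod_congr rfl fun t _ => ?_
  simp only [blockAB]
  push_cast
  rfl

lemma realignedDensity_productState (x x' u u' : T → Fin 2) :
    (realignedDensity (fun x y z => c₀ * productState κ x y z) *
      (realignedDensity (fun x y z => c₀ * productState κ x y z))ᴴ) (x, x') (u, u') =
      (c₀ * star c₀) ^ 2 * ∏ t, (blockAA (κ t) (x t) (x' t) (u t) (u' t) : ℂ) := by
  simp only [Matrix.mul_apply, Matrix.conjTranspose_apply, realignedDensity, Matrix.of_apply,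
    reducedDensityAB_productState, Fintype.sum_prod_type]
  have h : ∀ y y' : T → Fin 2,
      (c₀ * star c₀) * (∏ t, (blockAB (κ t) (x t) (y t) (x' t) (y' t) : ℂ)) *
      star ((c₀ * star c₀) * ∏ t, (blockAB (κ t) (u t) (y t) (u' t) (y' t) : ℂ)) =
      (c₀ * star c₀) ^ 2 * ∏ t, ((blockAB (κ t) (x t) (y t) (x' t) (y' t) : ℂ) *
        (blockAB (κ t) (u t) (y t) (u' t) (y' t) : ℂ)) := by
    intro y y'
    rw [star_mul', star_mul', star_star, Finset.prod_mul_distrib]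
    simp only [star_prod, star_intCast]
    ring
  simp only [h, ← Finset.mul_sum]
  congr 1
  refine (sum_sum_prod_apply fun t i j => (blockAB (κ t) (x t) i (x' t) j : ℂ) *
    (blockAB (κ t) (u t) i (u' t) j : ℂ)).trans ?_
  refine Finset.prod_congr rfl fun t _ => ?_
  simp only [blockAA]
  push_cast
  rfl

lemma reducedDensityC_productState_mul_self (hκ : ∀ t, (κ t).Nonempty) :
    reducedDensity (fun (c : T → Fin 2) (ab : (T → Fin 2) × (T → Fin 2)) =>
      c₀ * productState κ ab.1 ab.2 c) *
    reducedDensity (fun (c : T → Fin 2) (ab : (T → Fin 2) × (T → Fin 2)) =>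
      c₀ * productState κ ab.1 ab.2 c) =
    ((c₀ * star c₀) * ∏ t, (2 : ℂ) ^ (1 - blockEntropyC (κ t))) •
    reducedDensity (fun (c : T → Fin 2) (ab : (T → Fin 2) × (T → Fin 2)) =>
      c₀ * productState κ ab.1 ab.2 c) := by
  ext z z'
  simp only [Matrix.mul_apply, Matrix.smul_apply, reducedDensityC_productState, smul_eq_mul]
  have h : ∀ w : T → Fin 2, c₀ * star c₀ * (∏ t, (blockC (κ t) (z t) (w t) : ℂ)) *
      (c₀ * star c₀ * ∏ t, (blockC (κ t) (w t) (z' t) : ℂ)) = (c₀ * star c₀) ^ 2 *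
      ∏ t, ((blockC (κ t) (z t) (w t) : ℂ) * (blockC (κ t) (w t) (z' t) : ℂ)) := fun w => by
    rw [Finset.prod_mul_distrib]; ring
  simp only [h, ← Finset.mul_sum]
  have h2 : ∑ w : T → Fin 2,
      ∏ t, ((blockC (κ t) (z t) (w t) : ℂ) * (blockC (κ t) (w t) (z' t) : ℂ)) =
      ∏ t, ((2 : ℂ) ^ (1 - blockEntropyC (κ t)) * (blockC (κ t) (z t) (z' t) : ℂ)) := by
    refine (sum_prod_apply fun t i => (blockC (κ t) (z t) i : ℂ) *
      (blockC (κ t) i (z' t) : ℂ)).trans (Finset.prod_congr rfl fun t _ => ?_)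
    exact_mod_cast blockC_mul (hκ t) (z t) (z' t)
  rw [h2, Finset.prod_mul_distrib]
  ring

lemma reducedDensityAB_productState_mul_self (hκ : ∀ t, (κ t).Nonempty) :
    reducedDensity (fun (ab : (T → Fin 2) × (T → Fin 2)) (c : T → Fin 2) =>
      c₀ * productState κ ab.1 ab.2 c) *
    reducedDensity (fun (ab : (T → Fin 2) × (T → Fin 2)) (c : T → Fin 2) =>
      c₀ * productState κ ab.1 ab.2 c) =
    ((c₀ * star c₀) * ∏ t, (2 : ℂ) ^ (1 - blockEntropyC (κ t))) •
    reducedDensity (fun (ab : (T → Fin 2) × (T → Fin 2)) (c : T → Fin 2) =>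
      c₀ * productState κ ab.1 ab.2 c) := by
  ext ⟨x, y⟩ ⟨x', y'⟩
  simp only [Matrix.mul_apply, Matrix.smul_apply, reducedDensityAB_productState, smul_eq_mul,
    Fintype.sum_prod_type]
  have h : ∀ w w' : T → Fin 2,
      c₀ * star c₀ * (∏ t, (blockAB (κ t) (x t) (y t) (w t) (w' t) : ℂ)) *
      (c₀ * star c₀ * ∏ t, (blockAB (κ t) (w t) (w' t) (x' t) (y' t) : ℂ)) = (c₀ * star c₀) ^ 2 *
      ∏ t, ((blockAB (κ t) (x t) (y t) (w t) (w' t) : ℂ) *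
        (blockAB (κ t) (w t) (w' t) (x' t) (y' t) : ℂ)) := fun w w' => by
    rw [Finset.prod_mul_distrib]; ring
  simp only [h, ← Finset.mul_sum]
  have h2 : ∑ w : T → Fin 2, ∑ w' : T → Fin 2,
      ∏ t, ((blockAB (κ t) (x t) (y t) (w t) (w' t) : ℂ) *
        (blockAB (κ t) (w t) (w' t) (x' t) (y' t) : ℂ)) =
      ∏ t, ((2 : ℂ) ^ (1 - blockEntropyC (κ t)) *
        (blockAB (κ t) (x t) (y t) (x' t) (y' t) : ℂ)) := by
    refine (sum_sum_prod_apply fun t i j => (blockAB (κ t) (x t) (y t) i j : ℂ) *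
      (blockAB (κ t) i j (x' t) (y' t) : ℂ)).trans (Finset.prod_congr rfl fun t _ => ?_)
    exact_mod_cast blockAB_mul (hκ t) (x t) (y t) (x' t) (y' t)
  rw [h2, Finset.prod_mul_distrib]
  ring

lemma realignedDensity_productState_mul_self (hκ : ∀ t, (κ t).Nonempty) :
    (realignedDensity (fun x y z => c₀ * productState κ x y z) *
      (realignedDensity (fun x y z => c₀ * productState κ x y z))ᴴ) *
    (realignedDensity (fun x y z => c₀ * productState κ x y z) *
      (realignedDensity (fun x y z => c₀ * productState κ x y z))ᴴ) =
    ((c₀ * star c₀) ^ 2 *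
      ∏ t, (2 : ℂ) ^ (2 - (blockEntropyC (κ t) + blockReflectedEntropy (κ t)))) •
    (realignedDensity (fun x y z => c₀ * productState κ x y z) *
      (realignedDensity (fun x y z => c₀ * productState κ x y z))ᴴ) := by
  ext ⟨x, y⟩ ⟨x', y'⟩
  rw [Matrix.mul_apply, Matrix.smul_apply]
  simp only [realignedDensity_productState, smul_eq_mul, Fintype.sum_prod_type]
  have h : ∀ w w' : T → Fin 2,
      (c₀ * star c₀) ^ 2 * (∏ t, (blockAA (κ t) (x t) (y t) (w t) (w' t) : ℂ)) *
      ((c₀ * star c₀) ^ 2 * ∏ t, (blockAA (κ t) (w t) (w' t) (x' t) (y' t) : ℂ)) =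
      (c₀ * star c₀) ^ 4 *
      ∏ t, ((blockAA (κ t) (x t) (y t) (w t) (w' t) : ℂ) *
        (blockAA (κ t) (w t) (w' t) (x' t) (y' t) : ℂ)) := fun w w' => by
    rw [Finset.prod_mul_distrib]; ring
  simp only [h, ← Finset.mul_sum]
  have h2 : ∑ w : T → Fin 2, ∑ w' : T → Fin 2,
      ∏ t, ((blockAA (κ t) (x t) (y t) (w t) (w' t) : ℂ) *
        (blockAA (κ t) (w t) (w' t) (x' t) (y' t) : ℂ)) =
      ∏ t, ((2 : ℂ) ^ (2 - (blockEntropyC (κ t) + blockReflectedEntropy (κ t))) *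
        (blockAA (κ t) (x t) (y t) (x' t) (y' t) : ℂ)) := by
    refine (sum_sum_prod_apply fun t i j => (blockAA (κ t) (x t) (y t) i j : ℂ) *
      (blockAA (κ t) i j (x' t) (y' t) : ℂ)).trans (Finset.prod_congr rfl fun t _ => ?_)
    exact_mod_cast blockAA_mul (hκ t) (x t) (y t) (x' t) (y' t)
  rw [h2, Finset.prod_mul_distrib]
  ring

/-! ### States isometric to a product of blocks. -/

section Isometric

variable {α β γ : Type*} [Fintype α] [Fintype β] [Fintype γ] [DecidableEq α] [DecidableEq β]
  [DecidableEq γ] {P : Matrix (T → Fin 2) α ℂ} {Q : Matrix (T → Fin 2) β ℂ}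
  {R : Matrix (T → Fin 2) γ ℂ} {ψ : α → β → γ → ℂ}

lemma normalization_productState (hκ : ∀ t, (κ t).Nonempty) (hP : Pᴴ * P = 1) (hQ : Qᴴ * Q = 1)
    (hR : Rᴴ * R = 1) (h1 : ∑ a, ∑ b, ∑ c, ‖ψ a b c‖ ^ 2 = 1)
    (hφ : (fun x y z => c₀ * productState κ x y z) = actA P (actB Q (actC R ψ))) :
    c₀ * star c₀ = ((1 / 2 : ℝ) ^ Fintype.card T : ℝ) := by
  have h := reducedDensityC_act (R := R) ψ hP hQ
  rw [← hφ] at h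
  have h2 := congrArg Matrix.trace h
  rw [Matrix.trace_mul_comm, ← Matrix.mul_assoc, hR, Matrix.one_mul, trace_reducedDensityC h1] at h2
  simp only [Matrix.trace, Matrix.diag_apply, reducedDensityC_productState, ← Finset.mul_sum] at h2
  have h3 : ∑ z : T → Fin 2, ∏ t, (blockC (κ t) (z t) (z t) : ℂ) = 2 ^ Fintype.card T := by
    refine (sum_prod_apply fun t i => (blockC (κ t) i i : ℂ)).trans ?_
    rw [Finset.prod_congr rfl fun t _ => show ∑ i, (blockC (κ t) i i : ℂ) = 2 from by
      exact_mod_cast trace_blockC (hκ t), Finset.prod_const, Finset.card_univ]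
  rw [h3] at h2
  push_cast
  rw [one_div, inv_pow]
  exact eq_inv_of_mul_eq_one_left h2

lemma half_pow_card_eq_prod : (1 / 2 : ℝ) ^ Fintype.card T = ∏ _t : T, (2 : ℝ)⁻¹ := by
  simp

/-- The normalization supplies a factor `1/2` for each block, so the eigenvalue is the product over
blocks of `2 ^ (-S(C))`, and its logarithm is a sum. -/
lemma entropyC_productState (hκ : ∀ t, (κ t).Nonempty) (hP : Pᴴ * P = 1) (hQ : Qᴴ * Q = 1)
    (hR : Rᴴ * R = 1) (h1 : ∑ a, ∑ b, ∑ c, ‖ψ a b c‖ ^ 2 = 1)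
    (hφ : (fun x y z => c₀ * productState κ x y z) = actA P (actB Q (actC R ψ))) :
    entropyC ψ = ∑ t, (blockEntropyC (κ t) : ℝ) := by
  have hc := normalization_productState hκ hP hQ hR h1 hφ
  have h := reducedDensityC_productState_mul_self (c₀ := c₀) hκ
  have hl : (c₀ * star c₀) * ∏ t, (2 : ℂ) ^ (1 - blockEntropyC (κ t)) =
      ((∏ t, (2 : ℝ) ^ (-(blockEntropyC (κ t) : ℤ)) : ℝ) : ℂ) := by
    rw [hc, half_pow_card_eq_prod]
    push_cast
    rw [← Finset.prod_mul_distrib]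
    refine Finset.prod_congr rfl fun t _ => ?_
    have := blockEntropyC_le (κ t)
    interval_cases blockEntropyC (κ t) <;> norm_num
  rw [hl] at h
  rw [entropyC_eq hP hQ hR h1 hφ (by positivity) h, Real.logb_prod _ _ (fun t _ => by positivity),
    ← Finset.sum_neg_distrib]
  refine Finset.sum_congr rfl fun t _ => ?_
  rw [← Real.rpow_intCast, Real.logb_rpow (by norm_num) (by norm_num)]
  simp

lemma reflectedEntropy_productState (hκ : ∀ t, (κ t).Nonempty) (hP : Pᴴ * P = 1) (hQ : Qᴴ * Q = 1)
    (hR : Rᴴ * R = 1) (h1 : ∑ a, ∑ b, ∑ c, ‖ψ a b c‖ ^ 2 = 1)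
    (hφ : (fun x y z => c₀ * productState κ x y z) = actA P (actB Q (actC R ψ))) :
    reflectedEntropy ψ = ∑ t, (blockReflectedEntropy (κ t) : ℝ) := by
  have hc := normalization_productState hκ hP hQ hR h1 hφ
  have h := reducedDensityAB_productState_mul_self (c₀ := c₀) hκ
  have h' := realignedDensity_productState_mul_self (c₀ := c₀) hκ
  have hl : (c₀ * star c₀) * ∏ t, (2 : ℂ) ^ (1 - blockEntropyC (κ t)) =
      ((∏ t, (2 : ℝ) ^ (-(blockEntropyC (κ t) : ℤ)) : ℝ) : ℂ) := by
    rw [hc, half_pow_card_eq_prod]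
    push_cast
    rw [← Finset.prod_mul_distrib]
    refine Finset.prod_congr rfl fun t _ => ?_
    have := blockEntropyC_le (κ t)
    interval_cases blockEntropyC (κ t) <;> norm_num
  have hu : (c₀ * star c₀) ^ 2 *
      ∏ t, (2 : ℂ) ^ (2 - (blockEntropyC (κ t) + blockReflectedEntropy (κ t))) =
      ((∏ t, (2 : ℝ) ^ (-(blockEntropyC (κ t) + blockReflectedEntropy (κ t) : ℤ)) : ℝ) : ℂ) := by
    rw [hc, half_pow_card_eq_prod]
    push_cast
    rw [← Finset.prod_pow, ← Finset.prod_mul_distrib]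
    refine Finset.prod_congr rfl fun t _ => ?_
    have := blockEntropy_add_le (κ t)
    rw [← Nat.cast_add]
    interval_cases blockEntropyC (κ t) + blockReflectedEntropy (κ t) <;> norm_num
  rw [hl] at h
  rw [hu] at h'
  rw [reflectedEntropy_eq hP hQ hR h1 hφ (by positivity) (by positivity) h h',
    ← Finset.prod_div_distrib, Real.logb_prod _ _ (fun t _ => by positivity),
    ← Finset.sum_neg_distrib]
  refine Finset.sum_congr rfl fun t _ => ?_
  rw [← zpow_sub₀ two_ne_zero, ← Real.rpow_intCast, Real.logb_rpow (by norm_num) (by norm_num)]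
  simp

end Isometric

end Blocks

end

noncomputable section

/-! ### The replica contraction -/

section Contraction

variable {S : Type*} [Fintype S]

/-- The contraction of copies of `ψ` and of its conjugate along three permutations of the sites. -/
def contraction {α β γ : Type*} [Fintype α] [Fintype β] [Fintype γ] [DecidableEq S]
    (σ : Fin 3 → Equiv.Perm S) (ψ : α → β → γ → ℂ) : ℂ :=
  ∑ a : S → α, ∑ b : S → β, ∑ c : S → γ,
    ∏ r, ψ (a r) (b r) (c r) * star (ψ (a (σ 0 r)) (b (σ 1 r)) (c (σ 2 r)))

lemma sum_isometry_mul_star {m m' : Type*} [Fintype m] [Fintype m'] [DecidableEq m]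
    {P : Matrix m' m ℂ} (hP : Pᴴ * P = 1) (f g : m → ℂ) :
    ∑ y, (∑ x, P y x * f x) * star (∑ x, P y x * g x) = ∑ x, f x * star (g x) := by
  have h : (P *ᵥ f) ⬝ᵥ star (P *ᵥ g) = f ⬝ᵥ star g := by
    rw [dotProduct_comm, Matrix.star_mulVec, ← Matrix.dotProduct_mulVec, Matrix.mulVec_mulVec, hP,
      Matrix.one_mulVec, dotProduct_comm]
  exact h

/-- Each index occurs in exactly two factors, at `r` in `F` and at `σ⁻¹ r` in `G`, so the sum
factors over sites. -/
lemma sum_prod_mul_star [DecidableEq S] {α : Type*} [Fintype α] (σ : Equiv.Perm S)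
    (F G : S → α → ℂ) :
    ∑ a : S → α, ∏ r, F r (a r) * star (G r (a (σ r))) =
      ∏ r, ∑ i, F r i * star (G (σ.symm r) i) := by
  rw [← sum_prod_apply fun r i => F r i * star (G (σ.symm r) i)]
  refine Finset.sum_congr rfl fun a _ => ?_
  rw [Finset.prod_mul_distrib, Finset.prod_mul_distrib]
  congr 1
  rw [← Equiv.prod_comp σ fun r => star (G (σ.symm r) (a r))]
  simp

lemma sum_prod_isometry [DecidableEq S] {m m' : Type*} [Fintype m] [Fintype m'] [DecidableEq m]
    {P : Matrix m' m ℂ} (hP : Pᴴ * P = 1) (σ : Equiv.Perm S) (F G : S → m → ℂ) :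
    ∑ a : S → m', ∏ r, (∑ x, P (a r) x * F r x) * star (∑ x, P (a (σ r)) x * G r x) =
      ∑ a : S → m, ∏ r, F r (a r) * star (G r (a (σ r))) := by
  rw [sum_prod_mul_star, sum_prod_mul_star σ (fun r i => ∑ x, P i x * F r x)
    fun r i => ∑ x, P i x * G r x]
  exact Finset.prod_congr rfl fun r _ => sum_isometry_mul_star hP _ _

variable [DecidableEq S] {α β γ α' β' γ' : Type*} [Fintype α] [Fintype β] [Fintype γ]
  [Fintype α'] [Fintype β'] [Fintype γ'] (σ : Fin 3 → Equiv.Perm S) (ψ : α → β → γ → ℂ)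

/-- Each leg of `ψ` is contracted with a leg of the same party of the conjugate, where the isometry
cancels. -/
lemma contraction_actA [DecidableEq α] {P : Matrix α' α ℂ} (hP : Pᴴ * P = 1) :
    contraction σ (actA P ψ) = contraction σ ψ := by
  rw [contraction, contraction, Finset.sum_comm]
  conv_rhs => rw [Finset.sum_comm]
  refine Finset.sum_congr rfl fun b _ => ?_
  rw [Finset.sum_comm]
  conv_rhs => rw [Finset.sum_comm]
  exact Finset.sum_congr rfl fun c _ => sum_prod_isometry hP (σ 0)
    (fun r i => ψ i (b r) (c r)) fun r i => ψ i (b (σ 1 r)) (c (σ 2 r))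

lemma contraction_actB [DecidableEq β] {P : Matrix β' β ℂ} (hP : Pᴴ * P = 1) :
    contraction σ (actB P ψ) = contraction σ ψ := by
  refine Finset.sum_congr rfl fun a _ => ?_
  rw [Finset.sum_comm]
  conv_rhs => rw [Finset.sum_comm]
  exact Finset.sum_congr rfl fun c _ => sum_prod_isometry hP (σ 1)
    (fun r i => ψ (a r) i (c r)) fun r i => ψ (a (σ 0 r)) i (c (σ 2 r))

lemma contraction_actC [DecidableEq γ] {P : Matrix γ' γ ℂ} (hP : Pᴴ * P = 1) :
    contraction σ (actC P ψ) = contraction σ ψ :=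
  Finset.sum_congr rfl fun a _ => Finset.sum_congr rfl fun b _ => sum_prod_isometry hP (σ 2)
    (fun r i => ψ (a r) (b r) i) fun r i => ψ (a (σ 0 r)) (b (σ 1 r)) i

lemma sum_sum_sum_prod_apply {T : Type*} [Fintype T] [DecidableEq T] {K : Type*} [Fintype K]
    (f : T → K → K → K → ℂ) :
    ∑ x : T → K, ∑ y : T → K, ∑ z : T → K, ∏ t, f t (x t) (y t) (z t) =
      ∏ t, ∑ i, ∑ j, ∑ k, f t i j k := by
  rw [← sum_prod_apply]
  exact Finset.sum_congr rfl fun y _ => sum_sum_prod_apply fun t j => f t (y t) j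

/-- The contraction of a single block. -/
def blockContraction (κ : Finset (Fin 3)) : ℂ :=
  contraction σ fun i j k => (blockTensor κ i j k : ℂ)

/-- Exchanging the roles of sites and blocks in the indices separates the blocks. -/
lemma contraction_productState {T : Type*} [Fintype T] [DecidableEq T] (κ : T → Finset (Fin 3))
    (c₀ : ℂ) : contraction σ (fun x y z => c₀ * productState κ x y z) =
      (c₀ * star c₀) ^ Fintype.card S * ∏ t, blockContraction σ (κ t) := by
  have h1 : ∏ t, blockContraction σ (κ t) =
      ∑ a : T → S → Fin 2, ∑ b : T → S → Fin 2, ∑ c : T → S → Fin 2, ∏ t, ∏ r,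
        ((blockTensor (κ t) (a t r) (b t r) (c t r) : ℂ) *
          (blockTensor (κ t) (a t (σ 0 r)) (b t (σ 1 r)) (c t (σ 2 r)) : ℂ)) := by
    rw [sum_sum_sum_prod_apply fun t (a b c : S → Fin 2) => ∏ r,
      ((blockTensor (κ t) (a r) (b r) (c r) : ℂ) *
        (blockTensor (κ t) (a (σ 0 r)) (b (σ 1 r)) (c (σ 2 r)) : ℂ))]
    simp only [blockContraction, contraction, star_intCast]
  have h2 : ∀ a b c : S → T → Fin 2, (∏ r, c₀ * productState κ (a r) (b r) (c r) *
      star (c₀ * productState κ (a (σ 0 r)) (b (σ 1 r)) (c (σ 2 r)))) =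
      (c₀ * star c₀) ^ Fintype.card S * ∏ t, ∏ r,
        ((blockTensor (κ t) (a r t) (b r t) (c r t) : ℂ) *
          (blockTensor (κ t) (a (σ 0 r) t) (b (σ 1 r) t) (c (σ 2 r) t) : ℂ)) := by
    intro a b c
    simp only [mul_star_productState]
    rw [Finset.prod_mul_distrib, Finset.prod_const, Finset.card_univ, Finset.prod_comm]
  rw [h1, contraction]
  simp only [h2, Finset.mul_sum]
  refine Fintype.sum_equiv (Equiv.piComm fun _ _ => Fin 2) _ _ fun a => ?_
  refine Fintype.sum_equiv (Equiv.piComm fun _ _ => Fin 2) _ _ fun b => ?_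
  exact Fintype.sum_equiv (Equiv.piComm fun _ _ => Fin 2) _ _ fun c => rfl

/-- The condition for the components of a block not to vanish. -/
def BlockCond (κ : Finset (Fin 3)) (v : Fin 3 → Fin 2) : Prop :=
  (∀ i ∉ κ, v i = 0) ∧ ∀ i ∈ κ, ∀ j ∈ κ, v i = v j

instance (κ : Finset (Fin 3)) (v : Fin 3 → Fin 2) : Decidable (BlockCond κ v) :=
  inferInstanceAs (Decidable (_ ∧ _))

lemma blockTensor_eq (κ : Finset (Fin 3)) (i j k : Fin 2) :
    blockTensor κ i j k = if BlockCond κ ![i, j, k] then 1 else 0 := by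
  revert κ i j k; decide

/-- The contraction of a block counts the functions on the quotient of the sites that identifies
the neighbours in the directions of the parties of the block. -/
lemma blockContraction_eq {κ : Finset (Fin 3)} (hκ : κ.Nonempty) {W : Type*} [Fintype W]
    {p : S → W} (hp : Function.Surjective p)
    (hinv : ∀ i ∈ κ, ∀ j ∈ κ, ∀ r, p (σ i r) = p (σ j r))
    (hfac : ∀ s : S → Fin 2, (∀ i ∈ κ, ∀ j ∈ κ, ∀ r, s (σ i r) = s (σ j r)) → ∃ f, s = f ∘ p) :
    blockContraction σ κ = 2 ^ Fintype.card W := by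
  classical
  let m : Fin 3 → (W → Fin 2) → S → Fin 2 := fun i f r => if i ∈ κ then f (p r) else 0
  let good : (S → Fin 2) × (S → Fin 2) × (S → Fin 2) → Prop := fun q =>
    ∀ r, BlockCond κ ![q.1 r, q.2.1 r, q.2.2 r] ∧
      BlockCond κ ![q.1 (σ 0 r), q.2.1 (σ 1 r), q.2.2 (σ 2 r)]
  have hv : ∀ (q : (S → Fin 2) × (S → Fin 2) × (S → Fin 2)) (r s t : S) (i : Fin 3),
      ![q.1 r, q.2.1 s, q.2.2 t] i = ![q.1, q.2.1, q.2.2] i (![r, s, t] i) := by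
    intro q r s t i; fin_cases i <;> rfl
  have hvr : ∀ (r : S) (i : Fin 3), ![r, r, r] i = r := by intro r i; fin_cases i <;> rfl
  have hvσ : ∀ (r : S) (i : Fin 3), ![σ 0 r, σ 1 r, σ 2 r] i = σ i r := by
    intro r i; fin_cases i <;> rfl
  have hgood : ∀ q, good q ↔ ∀ r,
      ((∀ i ∉ κ, ![q.1, q.2.1, q.2.2] i r = 0) ∧
        ∀ i ∈ κ, ∀ j ∈ κ, ![q.1, q.2.1, q.2.2] i r = ![q.1, q.2.1, q.2.2] j r) ∧
      ((∀ i ∉ κ, ![q.1, q.2.1, q.2.2] i (σ i r) = 0) ∧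
        ∀ i ∈ κ, ∀ j ∈ κ, ![q.1, q.2.1, q.2.2] i (σ i r) = ![q.1, q.2.1, q.2.2] j (σ j r)) := by
    intro q
    simp only [good, BlockCond, hv, hvr, hvσ]
  have h1 : blockContraction σ κ = ((Finset.univ.filter good).card : ℂ) := by
    rw [Finset.card_filter]
    simp only [blockContraction, contraction, star_intCast, blockTensor_eq, Fintype.sum_prod_type]
    push_cast
    refine Finset.sum_congr rfl fun a _ => Finset.sum_congr rfl fun b _ =>
      Finset.sum_congr rfl fun c _ => ?_
    by_cases h : good (a, b, c)
    · rw [if_pos h]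
      refine Finset.prod_eq_one fun r _ => ?_
      rw [if_pos (h r).1, if_pos (h r).2, mul_one]
    · rw [if_neg h]
      simp only [good, not_forall, not_and_or] at h
      obtain ⟨r, h | h⟩ := h
      · exact Finset.prod_eq_zero (Finset.mem_univ r) (by rw [if_neg h, zero_mul])
      · exact Finset.prod_eq_zero (Finset.mem_univ r) (by rw [if_neg h, mul_zero])
  have hm : ∀ (f : W → Fin 2) (i : Fin 3), ![m 0 f, m 1 f, m 2 f] i = m i f := by
    intro f i; fin_cases i <;> rfl
  -- In a nonvanishing term all parties in `κ` carry the same function of the site and the others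
  -- carry 0. The condition on the conjugates makes this function equal at the neighbours in all
  -- directions of `κ`, so it factors through `p`.
  have h2 : Finset.univ.filter good = Finset.univ.image fun f => (m 0 f, m 1 f, m 2 f) := by
    ext q
    simp only [Finset.mem_filter, Finset.mem_univ, true_and, Finset.mem_image]
    rw [hgood]
    constructor
    · intro h
      obtain ⟨i, hi⟩ := hκ
      obtain ⟨f, hf⟩ := hfac (![q.1, q.2.1, q.2.2] i) fun j hj k hk r => by
        rw [(h _).1.2 i hi j hj, (h _).1.2 i hi k hk]
        exact (h r).2.2 j hj k hk
      have hq : ∀ j, m j f = ![q.1, q.2.1, q.2.2] j := by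
        intro j
        funext r
        by_cases hj : j ∈ κ
        · simp only [m, if_pos hj]
          rw [← (h r).1.2 i hi j hj, hf, Function.comp_apply]
        · simp only [m, if_neg hj]
          exact ((h r).1.1 j hj).symm
      exact ⟨f, Prod.ext (hq 0) (Prod.ext (hq 1) (hq 2))⟩
    · rintro ⟨f, rfl⟩ r
      simp only [hm, m]
      refine ⟨⟨fun i hi => if_neg hi, fun i hi j hj => ?_⟩, fun i hi => if_neg hi,
        fun i hi j hj => ?_⟩
      · rw [if_pos hi, if_pos hj]
      · rw [if_pos hi, if_pos hj, hinv i hi j hj]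
  have hinj : Function.Injective fun f : W → Fin 2 => (m 0 f, m 1 f, m 2 f) := by
    intro f g hfg
    simp only [Prod.mk.injEq] at hfg
    have hall : ∀ i, m i f = m i g := by
      intro i; fin_cases i
      exacts [hfg.1, hfg.2.1, hfg.2.2]
    obtain ⟨i, hi⟩ := hκ
    funext w
    obtain ⟨r, rfl⟩ := hp w
    have := congrFun (hall i) r
    simpa only [m, if_pos hi] using this
  rw [h1, h2, Finset.card_image_of_injective _ hinj]
  simp

end Contraction

end

noncomputable section

/-! ### The multi-entropy of products of blocks -/

section Torus

variable {n : ℕ}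

/-- The unit vectors of the torus. -/
def torusStep (n : ℕ) : Fin 3 → ZMod n × ZMod n × ZMod n :=
  ![(1, 0, 0), (0, 1, 0), (0, 0, 1)]

/-- The translations of the torus by the negatives of the unit vectors. -/
def torusShift (n : ℕ) (i : Fin 3) : Equiv.Perm (ZMod n × ZMod n × ZMod n) :=
  Equiv.subRight (torusStep n i)

lemma replicaContraction_eq {α β γ : Type*} [Fintype α] [Fintype β] [Fintype γ]
    (ψ : α → β → γ → ℂ) [NeZero n] : replicaContraction ψ n = contraction (torusShift n) ψ := rfl

/-- Equality at the two neighbours means invariance under `u - v`; iterating it clears one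
coordinate of the torus below. -/
lemma apply_add_nsmul_of_shift {G X : Type*} [AddCommGroup G] {s : G → X} {u v : G}
    (h : ∀ r, s (r - u) = s (r - v)) (r : G) (k : ℕ) : s (r + k • (u - v)) = s r := by
  induction k with
  | zero => simp
  | succ k ih =>
    rw [← ih, add_smul, one_smul]
    have := h (r + k • (u - v) + u)
    rw [add_sub_cancel_right] at this
    rw [this]
    congr 1
    abel

variable [NeZero n] {X : Type*} {s : ZMod n × ZMod n × ZMod n → X}

lemma apply_eq_of_shift_zero_one (h : ∀ r, s (torusShift n 0 r) = s (torusShift n 1 r))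
    (x y z : ZMod n) : s (x, y, z) = s (x + y, 0, z) := by
  rw [← apply_add_nsmul_of_shift h (x, y, z) y.val]
  congr 1
  simp [torusStep]

lemma apply_eq_of_shift_zero_two (h : ∀ r, s (torusShift n 0 r) = s (torusShift n 2 r))
    (x y z : ZMod n) : s (x, y, z) = s (x + z, y, 0) := by
  rw [← apply_add_nsmul_of_shift h (x, y, z) z.val]
  congr 1
  simp [torusStep]

lemma apply_eq_of_shift_one_two (h : ∀ r, s (torusShift n 1 r) = s (torusShift n 2 r))
    (x y z : ZMod n) : s (x, y, z) = s (x, y + z, 0) := by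
  rw [← apply_add_nsmul_of_shift h (x, y, z) z.val]
  congr 1
  simp [torusStep]

/-- The sites are identified along differences of unit vectors in `κ`. These span a subgroup of
order `n ^ (|κ| - 1)`, so the quotient has `n ^ (4 - |κ|)` elements. -/
lemma blockContraction_torus {κ : Finset (Fin 3)} (hκ : κ.Nonempty) :
    blockContraction (torusShift n) κ = 2 ^ n ^ (4 - κ.card) := by
  have hcases : (∃ i, κ = {i}) ∨ κ = {0, 1} ∨ κ = {0, 2} ∨ κ = {1, 2} ∨ κ = {0, 1, 2} := by
    revert κ; decide
  rcases hcases with ⟨i, rfl⟩ | rfl | rfl | rfl | rfl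
  · rw [blockContraction_eq _ hκ Function.surjective_id (by simp) fun s _ => ⟨s, rfl⟩]
    congr 1
    simp only [Fintype.card_prod, ZMod.card, Finset.card_singleton]
    ring
  · rw [blockContraction_eq _ hκ (p := fun r : ZMod n × ZMod n × ZMod n => (r.1 + r.2.1, r.2.2))
      (fun w => ⟨(w.1, 0, w.2), by simp⟩)
      (by
        intro i hi j hj r
        simp only [Finset.mem_insert, Finset.mem_singleton] at hi hj
        rcases hi with rfl | rfl <;> rcases hj with rfl | rfl <;> simp [torusShift, torusStep] <;>
          ring)
      (fun s hs => ⟨fun w => s (w.1, 0, w.2), funext fun r =>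
        apply_eq_of_shift_zero_one (hs 0 (by simp) 1 (by simp)) r.1 r.2.1 r.2.2⟩)]
    congr 1
    simp [sq]
  · rw [blockContraction_eq _ hκ (p := fun r : ZMod n × ZMod n × ZMod n => (r.1 + r.2.2, r.2.1))
      (fun w => ⟨(w.1, w.2, 0), by simp⟩)
      (by
        intro i hi j hj r
        simp only [Finset.mem_insert, Finset.mem_singleton] at hi hj
        rcases hi with rfl | rfl <;> rcases hj with rfl | rfl <;> simp [torusShift, torusStep] <;>
          ring)
      (fun s hs => ⟨fun w => s (w.1, w.2, 0), funext fun r =>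
        apply_eq_of_shift_zero_two (hs 0 (by simp) 2 (by simp)) r.1 r.2.1 r.2.2⟩)]
    congr 1
    simp [sq]
  · rw [blockContraction_eq _ hκ (p := fun r : ZMod n × ZMod n × ZMod n => (r.1, r.2.1 + r.2.2))
      (fun w => ⟨(w.1, w.2, 0), by simp⟩)
      (by
        intro i hi j hj r
        simp only [Finset.mem_insert, Finset.mem_singleton] at hi hj
        rcases hi with rfl | rfl <;> rcases hj with rfl | rfl <;> simp [torusShift, torusStep] <;>
          ring)
      (fun s hs => ⟨fun w => s (w.1, w.2, 0), funext fun r =>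
        apply_eq_of_shift_one_two (hs 1 (by simp) 2 (by simp)) r.1 r.2.1 r.2.2⟩)]
    congr 1
    simp [sq]
  · rw [blockContraction_eq _ hκ (p := fun r : ZMod n × ZMod n × ZMod n => r.1 + r.2.1 + r.2.2)
      (fun w => ⟨(w, 0, 0), by simp⟩)
      (by
        have : ∀ (i : Fin 3) (r : ZMod n × ZMod n × ZMod n), (torusShift n i r).1 +
            (torusShift n i r).2.1 + (torusShift n i r).2.2 = r.1 + r.2.1 + r.2.2 - 1 := by
          intro i r
          fin_cases i <;> simp [torusShift, torusStep] <;> ring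
        intro i _ j _ r
        rw [this, this])
      (fun s hs => ⟨fun w => s (w, 0, 0), funext fun r =>
        (apply_eq_of_shift_zero_one (hs 0 (by simp) 1 (by simp)) r.1 r.2.1 r.2.2).trans
          (apply_eq_of_shift_zero_two (hs 0 (by simp) 2 (by simp)) (r.1 + r.2.1) 0 r.2.2)⟩)]
    congr 1
    simp

end Torus

/-! ### Analytic continuation of the Rényi multi-entropies. -/

section MultiEntropy

variable {T : Type*} [Fintype T] [DecidableEq T] {κ : T → Finset (Fin 3)} {c₀ : ℂ}
  {α β γ : Type*} [Fintype α] [Fintype β] [Fintype γ] [DecidableEq α] [DecidableEq β]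
  [DecidableEq γ] {P : Matrix (T → Fin 2) α ℂ} {Q : Matrix (T → Fin 2) β ℂ}
  {R : Matrix (T → Fin 2) γ ℂ} {ψ : α → β → γ → ℂ}

/-- The analytic continuation of the Rényi multi-entropies of a block. -/
def blockRenyi (κ : Finset (Fin 3)) (z : ℂ) : ℂ :=
  (if κ.card = 3 then 1 else 0) + (if 2 ≤ κ.card then z else 0)

lemma blockRenyi_one {κ : Finset (Fin 3)} (hκ : κ.Nonempty) :
    blockRenyi κ 1 = ((κ.card - 1 : ℝ) : ℂ) := by
  have h1 : 1 ≤ κ.card := hκ.card_pos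
  have h2 : κ.card ≤ 3 := by simpa using Finset.card_le_univ κ
  rw [blockRenyi]
  interval_cases κ.card <;> norm_num

/-- Exponential type 1, which is less than `π`, suffices for Carlson's theorem. -/
lemma norm_blockRenyi_le (κ : Finset (Fin 3)) (z : ℂ) : ‖blockRenyi κ z‖ ≤ 2 * Real.exp ‖z‖ := by
  have h1 : 1 ≤ Real.exp ‖z‖ := Real.one_le_exp (norm_nonneg z)
  have h2 : ‖z‖ ≤ Real.exp ‖z‖ := by linarith [Real.add_one_le_exp ‖z‖]
  rw [blockRenyi]
  refine (norm_add_le _ _).trans ?_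
  have h3 : ‖(if κ.card = 3 then 1 else 0 : ℂ)‖ ≤ 1 := by split_ifs <;> simp
  have h4 : ‖(if 2 ≤ κ.card then z else 0 : ℂ)‖ ≤ ‖z‖ := by split_ifs <;> simp
  linarith

lemma differentiable_blockRenyi (κ : Finset (Fin 3)) : Differentiable ℂ (blockRenyi κ) := by
  unfold blockRenyi
  split_ifs <;> fun_prop

/-- Each normalized block contributes `2 ^ (n ^ (4 - |κ|) - n ^ 3)`. The product is a positive real,
so the complex logarithm is the real one, and division by `(1 - n) n` leaves a polynomial in `n`. -/
lemma renyiMultiEntropy_productState (hκ : ∀ t, (κ t).Nonempty) (hP : Pᴴ * P = 1)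
    (hQ : Qᴴ * Q = 1) (hR : Rᴴ * R = 1) (h1 : ∑ a, ∑ b, ∑ c, ‖ψ a b c‖ ^ 2 = 1)
    (hφ : (fun x y z => c₀ * productState κ x y z) = actA P (actB Q (actC R ψ)))
    (n : ℕ) [NeZero n] (hn : 2 ≤ n) :
    ∑ t, blockRenyi (κ t) n = renyiMultiEntropy ψ n := by
  have hc := normalization_productState hκ hP hQ hR h1 hφ
  have hZ : replicaContraction ψ n =
      (((2 : ℝ) ^ (∑ t, ((n : ℤ) ^ (4 - (κ t).card) - (n : ℤ) ^ 3)) : ℝ) : ℂ) := by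
    rw [replicaContraction_eq, ← contraction_actC _ ψ hR, ← contraction_actB _ _ hQ,
      ← contraction_actA _ _ hP, ← hφ, contraction_productState, hc, half_pow_card_eq_prod]
    simp only [blockContraction_torus (hκ _)]
    push_cast
    rw [← Finset.prod_pow, ← Finset.prod_mul_distrib]
    have : ∀ (s : Finset T) (f : T → ℤ), (2 : ℂ) ^ (∑ t ∈ s, f t) = ∏ t ∈ s, (2 : ℂ) ^ f t := by
      intro s f
      induction s using Finset.induction_on with
      | empty => simp
      | insert a s ha ih => rw [Finset.sum_insert ha, Finset.prod_insert ha,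
          zpow_add₀ two_ne_zero, ih]
    rw [this]
    refine Finset.prod_congr rfl fun t _ => ?_
    have hcard : Fintype.card (ZMod n × ZMod n × ZMod n) = n ^ 3 := by
      simp only [Fintype.card_prod, ZMod.card]; ring
    rw [zpow_sub₀ two_ne_zero, div_eq_mul_inv, mul_comm, inv_pow, hcard]
    norm_cast
  have hlog : Complex.log (replicaContraction ψ n) / Complex.log 2 =
      ∑ t, ((n : ℂ) ^ (4 - (κ t).card) - (n : ℂ) ^ 3) := by
    have h2 : Complex.log 2 = ((Real.log 2 : ℝ) : ℂ) := by
      rw [Complex.ofReal_log (by norm_num)]; simp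
    have h3 : (Real.log 2 : ℂ) ≠ 0 := by
      exact_mod_cast (Real.log_pos (by norm_num)).ne'
    rw [hZ, ← Complex.ofReal_log (by positivity), Real.log_zpow, h2]
    push_cast
    rw [mul_div_assoc, div_self h3, mul_one]
  rw [renyiMultiEntropy, hlog, Finset.mul_sum]
  refine Finset.sum_congr rfl fun t _ => ?_
  have h4 : 1 ≤ (κ t).card := (hκ t).card_pos
  have h5 : (κ t).card ≤ 3 := by simpa using Finset.card_le_univ (κ t)
  have h6 : (n : ℂ) ≠ 0 := by exact_mod_cast (by omega : n ≠ 0)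
  have h7 : (1 : ℂ) - n ≠ 0 := by
    rw [sub_ne_zero]; exact_mod_cast (by omega : 1 ≠ n)
  rw [blockRenyi]
  interval_cases (κ t).card
  · simp
  · norm_num
    field_simp
  · norm_num
    field_simp
    ring

/-- The sum of the polynomials `blockRenyi` is an admissible continuation. Any other one agrees with
it on the half-plane by Carlson's theorem applied to the difference. -/
theorem isMultiEntropy_productState_iff (hκ : ∀ t, (κ t).Nonempty) (hP : Pᴴ * P = 1)
    (hQ : Qᴴ * Q = 1) (hR : Rᴴ * R = 1) (h1 : ∑ a, ∑ b, ∑ c, ‖ψ a b c‖ ^ 2 = 1)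
    (hφ : (fun x y z => c₀ * productState κ x y z) = actA P (actB Q (actC R ψ))) {s : ℝ} :
    IsMultiEntropy ψ s ↔ s = ∑ t, ((κ t).card - 1 : ℝ) := by
  set g : ℂ → ℂ := fun z => ∑ t, blockRenyi (κ t) z with hg
  have hgd : Differentiable ℂ g :=
    Differentiable.fun_sum fun t _ => differentiable_blockRenyi (κ t)
  have hgb : ∀ z, ‖g z‖ ≤ (2 * Fintype.card T) * Real.exp (1 * ‖z‖) := by
    intro z
    refine (norm_sum_le _ _).trans ((Finset.sum_le_sum fun t _ => norm_blockRenyi_le (κ t) z).trans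
      (le_of_eq ?_))
    simp only [Finset.sum_const, Finset.card_univ, nsmul_eq_mul, one_mul]
    ring
  have hgr := renyiMultiEntropy_productState hκ hP hQ hR h1 hφ
  have hgt : Filter.Tendsto g (𝓝[{z | 1 < z.re}] 1) (𝓝 ((∑ t, ((κ t).card - 1 : ℝ) : ℝ) : ℂ)) := by
    have : g 1 = ((∑ t, ((κ t).card - 1 : ℝ) : ℝ) : ℂ) := by
      rw [Complex.ofReal_sum]
      exact Finset.sum_congr rfl fun t _ => blockRenyi_one (hκ t)
    rw [← this]
    exact (hgd.continuous.tendsto 1).mono_left nhdsWithin_le_nhds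
  constructor
  · rintro ⟨f, hfd, ⟨K, τ, hτ, hfb⟩, hfr, hft⟩
    have heq : ∀ z : ℂ, 1 < z.re → f z - g z = 0 := by
      refine eq_zero_of_exponential_type_lt_pi (h := fun z => f z - g z)
        (hfd.sub hgd.differentiableOn) (K := |K| + 2 * Fintype.card T) (τ := max τ 1)
        (le_max_of_le_right zero_le_one) (max_lt hτ (by linarith [Real.pi_gt_three])) ?_ ?_
      · intro z hz
        refine (norm_sub_le _ _).trans ?_
        rw [add_mul]
        refine add_le_add ((hfb z hz).trans ?_) ((hgb z).trans ?_)
        · refine mul_le_mul (le_abs_self K) (Real.exp_le_exp.2 ?_) (Real.exp_pos _).le (abs_nonneg K)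
          exact mul_le_mul_of_nonneg_right (le_max_left _ _) (norm_nonneg z)
        · refine mul_le_mul_of_nonneg_left (Real.exp_le_exp.2 ?_) (by positivity)
          exact mul_le_mul_of_nonneg_right (le_max_right _ _) (norm_nonneg z)
      · intro n hn
        have : NeZero n := ⟨by omega⟩
        rw [hfr n hn, ← hgr n hn, sub_self]
    -- The point 1 lies on the boundary of the half-plane, so the limit is unique.
    have hne : (𝓝[{z : ℂ | 1 < z.re}] 1).NeBot := by
      rw [← mem_closure_iff_nhdsWithin_neBot, Complex.closure_setOfPred_lt_re]
      simp
    have hfg : Filter.Tendsto f (𝓝[{z | 1 < z.re}] 1)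
        (𝓝 ((∑ t, ((κ t).card - 1 : ℝ) : ℝ) : ℂ)) := by
      refine hgt.congr' ?_
      filter_upwards [self_mem_nhdsWithin] with z hz
      exact (sub_eq_zero.1 (heq z hz)).symm
    exact_mod_cast tendsto_nhds_unique hft hfg
  · rintro rfl
    exact ⟨g, hgd.differentiableOn, ⟨2 * Fintype.card T, 1, by linarith [Real.pi_gt_three],
      fun z _ => hgb z⟩, fun n _ hn => hgr n hn, hgt⟩

end MultiEntropy

end

noncomputable section

/-! ### Extraction of GHZ states -/

set_option linter.unusedSectionVars false

section Extraction

variable {A B C : Type*} [Fintype A] [Fintype B] [Fintype C]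
  [DecidableEq A] [DecidableEq B] [DecidableEq C]

/-- Extension of the bits of some of the qubits by zeros. -/
def fillBits {K : Type*} (p : K → Prop) [DecidablePred p] (x : {k // p k} → Fin 2) (k : K) :
    Fin 2 :=
  if h : p k then x ⟨k, h⟩ else 0

/-- The bit at a block depends only on the party's qubit in that block; the other qubits may be
erased. -/
lemma extendBits_fillBits {K T : Type*} {κ : T → Finset (Fin 3)} {a : Fin 3}
    (e : K ≃ {t // a ∈ κ t}) (p : K → Prop) [DecidablePred p] (x : K → Fin 2) {t : T}
    (h : ∀ k, (e k : T) = t → p k) :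
    extendBits e (fillBits p fun k => x k) t = extendBits e x t := by
  unfold extendBits
  split_ifs with ht
  · have : p (e.symm ⟨t, ht⟩) := h _ (by simp)
    simp [fillBits, this]
  · rfl

lemma ne_symm_of_ne {K T : Type*} {κ : T → Finset (Fin 3)} {i : Fin 3} (e : K ≃ {t // i ∈ κ t})
    {t₀ t : T} (h : i ∈ κ t₀) (ht : t ≠ t₀) {k : K} (hk : (e k : T) = t) :
    k ≠ e.symm ⟨t₀, h⟩ := by
  rintro rfl
  exact ht (by simpa using hk.symm)

variable {T : Type*} [Fintype T] [DecidableEq T] {κ : T → Finset (Fin 3)}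
  {eA : A ≃ {t // 0 ∈ κ t}} {eB : B ≃ {t // 1 ∈ κ t}} {eC : C ≃ {t // 2 ∈ κ t}}
  {U : QubitOp A} {V : QubitOp B} {W : QubitOp C} {c₀ : ℂ}
  {ψ : (A → Fin 2) → (B → Fin 2) → (C → Fin 2) → ℂ}

lemma blockTensor_univ (i j k : Fin 2) :
    (blockTensor Finset.univ i j k : ℂ) = (Real.sqrt 2 : ℂ) * ghz i j k := by
  have h2 : (Real.sqrt 2 : ℂ) ≠ 0 := by
    exact_mod_cast (Real.sqrt_pos.2 (by norm_num : (0 : ℝ) < 2)).ne'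
  have h : blockTensor Finset.univ i j k = if i = j ∧ j = k then 1 else 0 := by
    revert i j k; decide
  rw [h, ghz]
  split_ifs
  · push_cast
    field_simp
  · simp

/-- The factor `t₀` is the GHZ state up to `√2`, and the other factors do not involve its three
qubits. -/
lemma canExtractGHZ_of_productState
    (h : ∀ a b c, actA U.1 (actB V.1 (actC W.1 ψ)) a b c =
      c₀ * productState κ (extendBits eA a) (extendBits eB b) (extendBits eC c))
    {t₀ : T} (ht₀ : κ t₀ = Finset.univ) : CanExtractGHZ ψ := by
  have h0 : (0 : Fin 3) ∈ κ t₀ := by rw [ht₀]; simp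
  have h1 : (1 : Fin 3) ∈ κ t₀ := by rw [ht₀]; simp
  have h2 : (2 : Fin 3) ∈ κ t₀ := by rw [ht₀]; simp
  refine ⟨eA.symm ⟨t₀, h0⟩, eB.symm ⟨t₀, h1⟩, eC.symm ⟨t₀, h2⟩, fun a b c =>
    (Real.sqrt 2 : ℂ) * c₀ * ∏ t ∈ Finset.univ.erase t₀, (blockTensor (κ t)
      (extendBits eA (fillBits _ a) t) (extendBits eB (fillBits _ b) t)
      (extendBits eC (fillBits _ c) t) : ℂ), ?_⟩
  rw [localUnitaryEquiv_iff]
  refine ⟨U, V, W, ?_⟩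
  funext a b c
  rw [h, productState, ← Finset.mul_prod_erase _ _ (Finset.mem_univ t₀), ht₀, blockTensor_univ]
  have hprod : ∏ t ∈ Finset.univ.erase t₀, (blockTensor (κ t) (extendBits eA a t)
      (extendBits eB b t) (extendBits eC c t) : ℂ) = ∏ t ∈ Finset.univ.erase t₀, (blockTensor (κ t)
      (extendBits eA (fillBits (· ≠ eA.symm ⟨t₀, h0⟩) fun i => a i) t)
      (extendBits eB (fillBits (· ≠ eB.symm ⟨t₀, h1⟩) fun i => b i) t)
      (extendBits eC (fillBits (· ≠ eC.symm ⟨t₀, h2⟩) fun i => c i) t) : ℂ) := by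
    refine Finset.prod_congr rfl fun t ht => ?_
    have ht' := Finset.ne_of_mem_erase ht
    rw [extendBits_fillBits eA _ a fun k hk => ne_symm_of_ne eA h0 ht' hk,
      extendBits_fillBits eB _ b fun k hk => ne_symm_of_ne eB h1 ht' hk,
      extendBits_fillBits eC _ c fun k hk => ne_symm_of_ne eC h2 ht' hk]
  rw [hprod]
  simp only [extendBits, dif_pos h0, dif_pos h1, dif_pos h2]
  ring

/-- Every block misses a party. Blocks without `C` go to the factor of `A`, `B`; blocks with `C` but
not `B` to that of `A`, `C`; blocks with `B` and `C`, hence without `A`, to that of `B`, `C`. -/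
lemma isProductOfBipartite_of_productState
    (h : ∀ a b c, actA U.1 (actB V.1 (actC W.1 ψ)) a b c =
      c₀ * productState κ (extendBits eA a) (extendBits eB b) (extendBits eC c))
    (hκ : ∀ t, κ t ≠ Finset.univ) : IsProductOfBipartite ψ := by
  classical
  refine ⟨{a | 2 ∉ κ (eA a)}, {b | 2 ∉ κ (eB b)}, {c | 1 ∉ κ (eC c)},
    fun a b => c₀ * ∏ t, if 2 ∉ κ t then (blockTensor (κ t) (extendBits eA (fillBits _ a) t)
      (extendBits eB (fillBits _ b) t) 0 : ℂ) else 1,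
    fun a c => ∏ t, if 2 ∈ κ t ∧ 1 ∉ κ t then (blockTensor (κ t) (extendBits eA (fillBits _ a) t)
      0 (extendBits eC (fillBits _ c) t) : ℂ) else 1,
    fun b c => ∏ t, if 2 ∈ κ t ∧ 1 ∈ κ t then (blockTensor (κ t) 0
      (extendBits eB (fillBits _ b) t) (extendBits eC (fillBits _ c) t) : ℂ) else 1, ?_⟩
  rw [localUnitaryEquiv_iff]
  refine ⟨U, V, W, ?_⟩
  funext a b c
  rw [h, productState, mul_assoc, mul_assoc, ← Finset.prod_mul_distrib, ← Finset.prod_mul_distrib]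
  congr 1
  refine Finset.prod_congr rfl fun t _ => ?_
  by_cases h2 : 2 ∈ κ t
  · by_cases h1 : 1 ∈ κ t
    · have h0 : 0 ∉ κ t := fun h0 => hκ t (by
        ext i; fin_cases i <;> simp [h0, h1, h2])
      have hA : extendBits eA a t = 0 := by simp [extendBits, h0]
      rw [if_neg (by simp [h2]), if_neg (by simp [h1]), if_pos ⟨h2, h1⟩, one_mul, one_mul, hA,
        extendBits_fillBits, extendBits_fillBits]
      · rintro k rfl
        simpa using h1
      · rintro k rfl
        simpa using h2
    · have hB : extendBits eB b t = 0 := by simp [extendBits, h1]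
      rw [if_neg (by simp [h2]), if_pos ⟨h2, h1⟩, if_neg (by simp [h1]), one_mul, mul_one, hB,
        extendBits_fillBits, extendBits_fillBits]
      · rintro k rfl
        simpa using h1
      · rintro k rfl
        simpa using h2
  · have hC : extendBits eC c t = 0 := by simp [extendBits, h2]
    rw [if_pos h2, if_neg (by simp [h2]), if_neg (by simp [h2]), mul_one, mul_one, hC,
        extendBits_fillBits, extendBits_fillBits]
    · rintro k rfl
      simpa using h2
    · rintro k rfl
      simpa using h2

end Extraction

/-! ### Operations that every party can perform alone. -/

section Proportional

variable {α β γ A₁ A₂ B₁ B₂ C₁ C₂ : Type*} [Fintype α] [Fintype β] [Fintype γ]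

/-- An operation on a product of bipartite states that each of the three parties can perform
is trivial. -/
lemma exists_smul_of_act_eq {a₁ : α → A₁} {a₂ : α → A₂} {b₁ : β → B₁} {b₂ : β → B₂} {c₁ : γ → C₁}
    {c₂ : γ → C₂} (ha : ∀ x y, ∃ z, a₁ z = a₁ x ∧ a₂ z = a₂ y)
    (hb : ∀ x y, ∃ z, b₁ z = b₁ x ∧ b₂ z = b₂ y) (hc : ∀ x y, ∃ z, c₁ z = c₁ x ∧ c₂ z = c₂ y)
    {f : A₁ → B₁ → ℂ} {g : A₂ → C₁ → ℂ} {h : B₂ → C₂ → ℂ} {φ : α → β → γ → ℂ}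
    (hφ : ∀ a b c, φ a b c = f (a₁ a) (b₁ b) * g (a₂ a) (c₁ c) * h (b₂ b) (c₂ c))
    {X : Matrix α α ℂ} {Y : Matrix β β ℂ} {Z : Matrix γ γ ℂ}
    (hXY : actA X φ = actB Y φ) (hXZ : actA X φ = actC Z φ) : ∃ μ : ℂ, actA X φ = μ • φ := by
  by_cases hne : ∃ a b c, φ a b c ≠ 0
  · obtain ⟨a, b, c, hne⟩ := hne
    set η := actA X φ with hη
    -- An operation of the first party leaves the factor `h` alone, one of the second leaves `g`,
    -- one of the third leaves `f`; here all three give the same `η`.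
    have e1 : ∀ x y z, η x y z = (∑ x', X x x' * (f (a₁ x') (b₁ y) * g (a₂ x') (c₁ z))) *
        h (b₂ y) (c₂ z) := fun x y z => by
      simp only [hη, actA, hφ, Finset.sum_mul, mul_assoc]
    have e2 : ∀ x y z, η x y z = g (a₂ x) (c₁ z) *
        (∑ y', Y y y' * (f (a₁ x) (b₁ y') * h (b₂ y') (c₂ z))) := fun x y z => by
      rw [hXY]
      simp only [actB, hφ, Finset.mul_sum]
      exact Finset.sum_congr rfl fun _ _ => by ring
    have e3 : ∀ x y z, η x y z = f (a₁ x) (b₁ y) *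
        (∑ z', Z z z' * (g (a₂ x) (c₁ z') * h (b₂ y) (c₂ z'))) := fun x y z => by
      rw [hXZ]
      simp only [actC, hφ, Finset.mul_sum]
      exact Finset.sum_congr rfl fun _ _ => by ring
    refine ⟨η a b c / φ a b c, ?_⟩
    funext x y z
    obtain ⟨x', hx1, hx2⟩ := ha x a
    obtain ⟨y', hy1, hy2⟩ := hb y b
    obtain ⟨z', hz1, hz2⟩ := hc z c
    -- The point `(x, y, z)` is moved to the base point `(a, b, c)` by changing the indices of one
    -- factor at a time. At each step `η` changes in the same ratio as `φ`.
    have s1 : η x y z * h (b₂ b) (c₂ c) = h (b₂ y) (c₂ z) * η x y' z' := by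
      rw [e1 x y z, e1 x y' z', hy1, hy2, hz1, hz2]; ring
    have s2 : η x y' z' * g (a₂ a) (c₁ c) = g (a₂ x) (c₁ z) * η x' y' c := by
      rw [e2 x y' z', e2 x' y' c, hx1, hx2, hz1, hz2]; ring
    have s3 : η x' y' c * f (a₁ a) (b₁ b) = f (a₁ x) (b₁ y) * η a b c := by
      rw [e3 x' y' c, e3 a b c, hx1, hx2, hy1, hy2]; ring
    change η x y z = η a b c / φ a b c * φ x y z
    rw [div_mul_eq_mul_div, eq_div_iff hne, hφ a b c, hφ x y z]
    linear_combination (f (a₁ a) (b₁ b) * g (a₂ a) (c₁ c)) * s1 +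
      f (a₁ a) (b₁ b) * h (b₂ y) (c₂ z) * s2 + h (b₂ y) (c₂ z) * g (a₂ x) (c₁ z) * s3
  · push Not at hne
    refine ⟨0, ?_⟩
    funext x y z
    simp [actA, hne]

lemma actA_smul_right {α' : Type*} (M : Matrix α' α ℂ) (μ : ℂ) (φ : α → β → γ → ℂ) :
    actA M (μ • φ) = μ • actA M φ := by
  funext a b c
  simp only [actA, Pi.smul_apply, smul_eq_mul, Finset.mul_sum, mul_left_comm]

lemma actB_smul_right {β' : Type*} (M : Matrix β' β ℂ) (μ : ℂ) (φ : α → β → γ → ℂ) :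
    actB M (μ • φ) = μ • actB M φ := by
  funext a b c
  simp only [actB, Pi.smul_apply, smul_eq_mul, Finset.mul_sum, mul_left_comm]

lemma actC_smul_right {γ' : Type*} (M : Matrix γ' γ ℂ) (μ : ℂ) (φ : α → β → γ → ℂ) :
    actC M (μ • φ) = μ • actC M φ := by
  funext a b c
  simp only [actC, Pi.smul_apply, smul_eq_mul, Finset.mul_sum, mul_left_comm]

variable {M M' : Matrix α α ℂ} {N N' : Matrix β β ℂ} {O O' : Matrix γ γ ℂ}
  [DecidableEq α] [DecidableEq β] [DecidableEq γ]

lemma actA_conj (hM : M' * M = 1) (X : Matrix α α ℂ) (φ : α → β → γ → ℂ) :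
    actA (M * X * M') (actA M (actB N (actC O φ))) = actA M (actB N (actC O (actA X φ))) := by
  rw [actA_actA, Matrix.mul_assoc, hM, Matrix.mul_one, ← actA_actA, actA_actB, actA_actC]

lemma actB_conj (hN : N' * N = 1) (X : Matrix β β ℂ) (φ : α → β → γ → ℂ) :
    actB (N * X * N') (actA M (actB N (actC O φ))) = actA M (actB N (actC O (actB X φ))) := by
  rw [← actA_actB, actB_actB, Matrix.mul_assoc, hN, Matrix.mul_one, ← actB_actB, actB_actC]

lemma actC_conj (hO : O' * O = 1) (X : Matrix γ γ ℂ) (φ : α → β → γ → ℂ) :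
    actC (O * X * O') (actA M (actB N (actC O φ))) = actA M (actB N (actC O (actC X φ))) := by
  rw [← actA_actC, ← actB_actC, actC_actC, Matrix.mul_assoc, hO, Matrix.mul_one, ← actC_actC]

lemma act_inv (hM : M' * M = 1) (hN : N' * N = 1) (hO : O' * O = 1) (φ : α → β → γ → ℂ) :
    actA M' (actB N' (actC O' (actA M (actB N (actC O φ))))) = φ := by
  rw [act_act_mul, hM, hN, hO, actA_one, actB_one, actC_one]

lemma exists_apply_eq_of_restrict {K : Type*} (S : Set K) (x y : K → Fin 2) :
    ∃ z : K → Fin 2, (fun i : {i // i ∈ S} => z i) = (fun i : {i // i ∈ S} => x i) ∧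
      (fun i : {i // i ∉ S} => z i) = fun i : {i // i ∉ S} => y i := by
  classical
  exact ⟨fun i => if i ∈ S then x i else y i, funext fun i => if_pos i.2,
    funext fun i => if_neg i.2⟩

end Proportional

/-! ### GHZ extraction excludes a product of bipartite states. -/

section GHZ

variable {A B C : Type*} [Fintype A] [Fintype B] [Fintype C]
  [DecidableEq A] [DecidableEq B] [DecidableEq C]
  {ψ : (A → Fin 2) → (B → Fin 2) → (C → Fin 2) → ℂ}

lemma bitSign_mul_ghz (i j k : Fin 2) : bitSign i * ghz i j k = bitSign j * ghz i j k ∧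
    bitSign i * ghz i j k = bitSign k * ghz i j k := by
  unfold ghz
  split_ifs with h
  · obtain ⟨rfl, rfl⟩ := h; simp
  · simp

lemma restrict_update {K : Type*} [DecidableEq K] (x : K → Fin 2) (k₀ : K) (i : Fin 2) :
    (fun k : {k // k ≠ k₀} => Function.update x k₀ i k) = fun k : {k // k ≠ k₀} => x k :=
  funext fun k => Function.update_of_ne k.2 _ _

/-- A state from which a GHZ state can be extracted is not a product of bipartite states. -/
theorem not_isProductOfBipartite_of_canExtractGHZ (hψ : ψ ≠ 0) (h : CanExtractGHZ ψ) :
    ¬ IsProductOfBipartite ψ := by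
  rintro ⟨S, T, R, f, g, k, h'⟩
  obtain ⟨a₀, b₀, c₀, χ, h⟩ := h
  rw [localUnitaryEquiv_iff] at h h'
  obtain ⟨U, V, W, h⟩ := h
  obtain ⟨U', V', W', h'⟩ := h'
  set φ : (A → Fin 2) → (B → Fin 2) → (C → Fin 2) → ℂ := fun a b c =>
    ghz (a a₀) (b b₀) (c c₀) * χ (fun i => a i) (fun j => b j) (fun k => c k) with hφ
  set φ' : (A → Fin 2) → (B → Fin 2) → (C → Fin 2) → ℂ := fun a b c =>
      f (fun i => a i) (fun j => b j) * g (fun i => a i) (fun k => c k) *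
        k (fun j => b j) (fun k => c k) with hφ'
  have hM := Matrix.UnitaryGroup.star_mul_self (U' * U⁻¹)
  have hN := Matrix.UnitaryGroup.star_mul_self (V' * V⁻¹)
  have hO := Matrix.UnitaryGroup.star_mul_self (W' * W⁻¹)
  have hMNO : φ' = actA (U' * U⁻¹).1 (actB (V' * V⁻¹).1 (actC (W' * W⁻¹).1 φ)) := by
    rw [h, act_act_mul, h', ← Submonoid.coe_mul, ← Submonoid.coe_mul, ← Submonoid.coe_mul,
      inv_mul_cancel_right, inv_mul_cancel_right, inv_mul_cancel_right]
  set M := (U' * U⁻¹).1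
  set N := (V' * V⁻¹).1
  set O := (W' * W⁻¹).1
  -- The sign flip on the GHZ qubit of each party. The three flips act alike on `φ`; conjugated by
  -- the local unitaries, they act alike on the bipartite product `φ'`.
  set X : Matrix (A → Fin 2) (A → Fin 2) ℂ := Matrix.diagonal fun a => bitSign (a a₀) with hX
  set Y : Matrix (B → Fin 2) (B → Fin 2) ℂ := Matrix.diagonal fun b => bitSign (b b₀) with hY
  set Z : Matrix (C → Fin 2) (C → Fin 2) ℂ := Matrix.diagonal fun c => bitSign (c c₀) with hZ
  have aX : ∀ a b c, actA X φ a b c = bitSign (a a₀) * φ a b c := fun a b c => by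
    simp [actA, hX, Matrix.diagonal_apply]
  have aY : ∀ a b c, actB Y φ a b c = bitSign (b b₀) * φ a b c := fun a b c => by
    simp [actB, hY, Matrix.diagonal_apply]
  have aZ : ∀ a b c, actC Z φ a b c = bitSign (c c₀) * φ a b c := fun a b c => by
    simp [actC, hZ, Matrix.diagonal_apply]
  have hXY : actA X φ = actB Y φ := by
    funext a b c
    rw [aX, aY, hφ, ← mul_assoc, (bitSign_mul_ghz _ _ _).1, mul_assoc]
  have hXZ : actA X φ = actC Z φ := by
    funext a b c
    rw [aX, aZ, hφ, ← mul_assoc, (bitSign_mul_ghz _ _ _).2, mul_assoc]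
  obtain ⟨μ, hμ⟩ := exists_smul_of_act_eq (X := M * X * star M) (Y := N * Y * star N)
    (Z := O * Z * star O) (φ := φ') (exists_apply_eq_of_restrict S)
    (exists_apply_eq_of_restrict T) (exists_apply_eq_of_restrict R) (fun a b c => rfl)
    (by rw [hMNO, actA_conj hM, actB_conj hN, hXY]) (by rw [hMNO, actA_conj hM, actC_conj hO, hXZ])
  rw [hMNO, actA_conj hM, ← actA_smul_right, ← actB_smul_right, ← actC_smul_right] at hμ
  have hμ' := congrArg (fun φ => actA (star M) (actB (star N) (actC (star O) φ))) hμ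
  simp only [act_inv hM hN hO] at hμ'
  have hφ0 : ∃ a b c, φ a b c ≠ 0 := by
    by_contra! h0
    refine hψ ?_
    rw [← act_inv (Matrix.UnitaryGroup.star_mul_self U) (Matrix.UnitaryGroup.star_mul_self V)
      (Matrix.UnitaryGroup.star_mul_self W) ψ, ← h]
    funext a b c
    simp [actA, actB, actC, h0]
  obtain ⟨a, b, c, h0⟩ := hφ0
  have hval : ∀ i, φ (Function.update a a₀ i) (Function.update b b₀ i) (Function.update c c₀ i) =
      1 / (Real.sqrt 2 : ℂ) * χ (fun i => a i) (fun j => b j) (fun k => c k) := by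
    intro i
    simp only [hφ, Function.update_self, restrict_update]
    simp [ghz]
  have hv0 : 1 / (Real.sqrt 2 : ℂ) * χ (fun i => a i) (fun j => b j) (fun k => c k) ≠ 0 := by
    have h1 := right_ne_zero_of_mul h0
    have h2 : (Real.sqrt 2 : ℂ) ≠ 0 := by
      exact_mod_cast (Real.sqrt_pos.2 (by norm_num : (0 : ℝ) < 2)).ne'
    exact mul_ne_zero (one_div_ne_zero h2) h1
  -- So `φ` is an eigenvector of the sign flip. But its components with all three GHZ bits 0, or all
  -- 1, are equal and nonzero, and the flip treats them differently.
  have hev : ∀ i, bitSign i = μ := by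
    intro i
    have := congrFun (congrFun (congrFun hμ' (Function.update a a₀ i)) (Function.update b b₀ i))
      (Function.update c c₀ i)
    rw [aX, Pi.smul_apply, Pi.smul_apply, Pi.smul_apply, smul_eq_mul, hval,
      Function.update_self] at this
    exact mul_right_cancel₀ hv0 this
  have := (hev 0).trans (hev 1).symm
  norm_num [bitSign] at this

end GHZ

end

noncomputable section

/-! ### The GHZ-forbidding inequality -/

lemma sum_norm_components {A B C : Type*} [Fintype A] [Fintype B] [Fintype C]
    [DecidableEq A] [DecidableEq B] [DecidableEq C] (Ψ : (A ⊕ B ⊕ C → Fin 2) → ℂ) :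
    ∑ a, ∑ b, ∑ c, ‖components Ψ a b c‖ ^ 2 = ∑ x, ‖Ψ x‖ ^ 2 := by
  rw [Fintype.sum_equiv ((Equiv.sumArrowEquivProdArrow A (B ⊕ C) (Fin 2)).trans
    ((Equiv.refl _).prodCongr (Equiv.sumArrowEquivProdArrow B C (Fin 2)))) (fun x => ‖Ψ x‖ ^ 2)
    (fun p => ‖components Ψ p.1 p.2.1 p.2.2‖ ^ 2)]
  · simp only [Fintype.sum_prod_type]
  · intro x
    simp only [components]
    congr 3
    funext i
    rcases i with i | i | i <;> rfl

/-- Twice the multi-entropy `|κ| - 1` of a block exceeds its reflected entropy plus twice its `S(C)`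
by 1 for the GHZ block and by 0 for all others. -/
lemma two_mul_card_block {κ : Finset (Fin 3)} (h : κ.Nonempty) :
    2 * κ.card = 2 + blockReflectedEntropy κ + 2 * blockEntropyC κ +
      if κ = Finset.univ then 1 else 0 := by
  revert κ; decide

/-- The entropies of a tripartite stabilizer state, in terms of the number `p` of GHZ states that
can be extracted. -/
theorem IsStabilizerState.exists_excess {A B C : Type*} [Fintype A] [Fintype B] [Fintype C]
    [DecidableEq A] [DecidableEq B] [DecidableEq C]
    {g : Fin (Fintype.card (A ⊕ B ⊕ C)) → QubitOp (A ⊕ B ⊕ C)}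
    {Ψ : (A ⊕ B ⊕ C → Fin 2) → ℂ} (hΨ : IsStabilizerState g Ψ) :
    ∃ p : ℕ, (∀ s : ℝ, IsMultiEntropy (components Ψ) s ↔
        s = 1 / 2 * reflectedEntropy (components Ψ) + entropyC (components Ψ) + p / 2) ∧
      (p = 0 ↔ groupProd (stabilizerGroup g) =
        (stabilizerGroup g : Set (QubitOp (A ⊕ B ⊕ C)))) ∧
      (p = 0 ↔ ¬ CanExtractGHZ (components Ψ)) ∧
      (p = 0 ↔ IsProductOfBipartite (components Ψ)) := by
  obtain ⟨n, κ, eA, eB, eC, U, V, W, c₀, hκ, h, hG⟩ := hΨ.exists_canonicalForm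
  have h1 : ∑ a, ∑ b, ∑ c, ‖components Ψ a b c‖ ^ 2 = 1 := by
    rw [sum_norm_components, hΨ.norm_one]
  have hne : components Ψ ≠ 0 := by
    intro h0
    simp [h0] at h1
  obtain ⟨P, Q, R, hP, hQ, hR, hφ⟩ := exists_isometry_productState eA eB eC h
  have hp : (Finset.univ.filter fun t => κ t = Finset.univ).card = 0 ↔
      ∀ t, κ t ≠ Finset.univ := by
    rw [Finset.card_eq_zero, Finset.filter_eq_empty_iff]
    simp
  have hprod : (∀ t, κ t ≠ Finset.univ) → IsProductOfBipartite (components Ψ) :=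
    isProductOfBipartite_of_productState h
  have hext : ¬ (∀ t, κ t ≠ Finset.univ) → CanExtractGHZ (components Ψ) := by
    intro hn
    push Not at hn
    obtain ⟨t₀, ht₀⟩ := hn
    exact canExtractGHZ_of_productState h ht₀
  have hexcl := not_isProductOfBipartite_of_canExtractGHZ hne
  refine ⟨(Finset.univ.filter fun t => κ t = Finset.univ).card, fun s => ?_, hp.trans hG.symm,
    hp.trans ⟨fun hu hc => hexcl hc (hprod hu), fun hc => by_contra fun hu => hc (hext hu)⟩,
    hp.trans ⟨hprod, fun hb => by_contra fun hu => hexcl (hext hu) hb⟩⟩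
  rw [isMultiEntropy_productState_iff hκ hP hQ hR h1 hφ,
    reflectedEntropy_productState hκ hP hQ hR h1 hφ, entropyC_productState hκ hP hQ hR h1 hφ]
  have hsum : ∑ t, ((κ t).card - 1 : ℝ) = 1 / 2 * ∑ t, (blockReflectedEntropy (κ t) : ℝ) +
      ∑ t, (blockEntropyC (κ t) : ℝ) +
      ((Finset.univ.filter fun t => κ t = Finset.univ).card : ℝ) / 2 := by
    rw [Finset.card_filter, Finset.mul_sum]
    push_cast
    rw [Finset.sum_div, ← Finset.sum_add_distrib, ← Finset.sum_add_distrib]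
    refine Finset.sum_congr rfl fun t _ => ?_
    have := congrArg (Nat.cast (R := ℝ)) (two_mul_card_block (hκ t))
    push_cast at this
    linarith
  rw [hsum]

end

end TripartiteStabilizer

open TripartiteStabilizer in
theorem mainTheorem1 {A B C : Type*} [Fintype A] [Fintype B] [Fintype C]
    [DecidableEq A] [DecidableEq B] [DecidableEq C]
    (g : Fin (Fintype.card (A ⊕ B ⊕ C)) → QubitOp (A ⊕ B ⊕ C))
    (Ψ : (A ⊕ B ⊕ C → Fin 2) → ℂ) (hΨ : IsStabilizerState g Ψ) :
    (∃! s : ℝ, IsMultiEntropy (components Ψ) s) ∧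
    ∀ S₃ : ℝ, IsMultiEntropy (components Ψ) S₃ →
      (1 / 2 * reflectedEntropy (components Ψ) + entropyC (components Ψ) ≤ S₃) ∧
      (S₃ ≤ 1 / 2 * reflectedEntropy (components Ψ) + entropyC (components Ψ) ↔
        Nat.card (stabilizerGroup g) ≤ Nat.card (groupProd (stabilizerGroup g))) ∧
      (1 / 2 * reflectedEntropy (components Ψ) + entropyC (components Ψ) = S₃ ↔
        groupProd (stabilizerGroup g) = (stabilizerGroup g : Set (QubitOp (A ⊕ B ⊕ C)))) ∧
      (1 / 2 * reflectedEntropy (components Ψ) + entropyC (components Ψ) = S₃ ↔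
        ¬ CanExtractGHZ (components Ψ)) ∧
      (1 / 2 * reflectedEntropy (components Ψ) + entropyC (components Ψ) < S₃ ↔
        CanExtractGHZ (components Ψ)) ∧
      (1 / 2 * reflectedEntropy (components Ψ) + entropyC (components Ψ) < S₃ ↔
        HasGenuineTripartiteEntanglement (components Ψ)) := by
  obtain ⟨p, hS, hG, hE, hB⟩ := hΨ.exists_excess
  refine ⟨⟨_, (hS _).2 rfl, fun s hs => (hS s).1 hs⟩, fun S₃ h₃ => ?_⟩
  rw [hS] at h₃
  have hp : (0 : ℝ) ≤ p := Nat.cast_nonneg p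
  have heq : 1 / 2 * reflectedEntropy (components Ψ) + entropyC (components Ψ) = S₃ ↔ p = 0 := by
    rw [h₃, ← Nat.cast_eq_zero (R := ℝ)]
    constructor <;> intro h <;> linarith
  have hle : S₃ ≤ 1 / 2 * reflectedEntropy (components Ψ) + entropyC (components Ψ) ↔ p = 0 := by
    rw [h₃, ← Nat.cast_eq_zero (R := ℝ)]
    constructor <;> intro h <;> linarith
  have hlt : 1 / 2 * reflectedEntropy (components Ψ) + entropyC (components Ψ) < S₃ ↔ ¬ p = 0 := by
    rw [← hle, not_le]
  refine ⟨by linarith, ?_, heq.trans hG, heq.trans hE, ?_, ?_⟩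
  · rw [hle, hG, hΨ.card_le_iff]
  · rw [hlt, hE, not_not]
  · rw [hlt, hB, HasGenuineTripartiteEntanglement]
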